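/- **Conventions.** $g=\mathrm{diag}(1,-1,-1,-1)$; $\sigma^\mu=(\mathbf 1,\sigma_1,\sigma_2,\sigma_3)$ with elements $\sigma^\mu_{a\bar b}$; $\epsilon_{12}=1$, $\epsilon^{ab}=-\epsilon_{ab}$, $\psi^b=\epsilon^{bc}\psi_c$; $\sigma^{\mu\nu}_{ab}=\frac i4\epsilon^{\bar c\bar d}(\sigma^\mu_{a\bar c}\sigma^\nu_{b\bar d}-\sigma^\nu_{a\bar c}\sigma^\mu_{b\bar d})$; repeated indices are summed. For $m\ge 0$ let $D_m=D_m^{(+)}+D_m^{(-)}$ be the Pauli–Jordan distribution, $D_m^{(\pm)}(x)=\pm\frac{i}{(2\pi)^3}\int\frac{d^3k}{2\omega}e^{\mp ik\cdot x}$ with $k=(\omega,\mathbf k)$, $\omega=\sqrt{\mathbf k^2+m^2}$. **The reduced multiplet.** Let $m\ge 0$. The reduced multiplet of mass $m$ consists of distributions $(z,F_{\mu\nu},C_{jk},\chi_{ja})$ ($j,k,a\in\{1,2\}$) with values in a non-zero complex $*$-algebra, $z,F,C$ bosonic and $\chi$ fermionic, with $\bar\chi=\chi^*$, $C_{jk}=C_{kj}$,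 $C_{jk}^*=\epsilon_{jl}\epsilon_{kn}C_{ln}$, $F_{\mu\nu}=-F_{\nu\mu}=F_{\mu\nu}^*$, $\epsilon^{\mu\nu\rho\lambda}\partial_\nu F_{\rho\lambda}=0$, where $z$ is a complex scalar field of mass $m$: $(\partial^2+m^2)z=0$, $[z(x),z(y)]=0$, $[z(x),z^*(y)]=-iD_m(x-y)$. All causal (anti)commutators are of the form $p(\partial)D_m(x-y)$ with constant-coefficient polynomials $p$, bosonic fields commute with fermionic ones, and the fields are covariant under unitary representations of the covering $inSL(2,\mathbb C)$ of the Poincaré group and, commuting with it, of $SU(2)$ ($z$ is a Lorentz and $SU(2)$ scalar; $F_{\mu\nu}$ is a Lorentz tensor and an $SU(2)$ scalar; $C_{jk}$ are Lorentz scalars, with $V_U^{-1}C_{jk}V_U=U_{jl}U_{kn}C_{ln}$; $\chi_{ja}$ is a Weyl spinor, with $V_U^{-1}\chi_{ja}V_U=U_{jk}\chi_{ka}$). There are supercharges $Q_{ja}$ with $\bar Q_{j\bar a}=Q_{ja}^*$, transforming like $\chi_{ja}$, and $P_\mu$ with $[P_\mu,\phi]=-i\partial_\mu\phi$ for every field $\phi$,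 $[Q_{ja},P_\mu]=0$, $\{Q_{ja},Q_{kb}\}=0$, $\{Q_{ja},\bar Q_{k\bar b}\}=2\delta_{jk}\sigma^\mu_{a\bar b}P_\mu$, and $$i[Q_{ja},z]=\chi_{ja},\qquad [\bar Q_{j\bar a},z]=0,\qquad [Q_{ja},F^{\mu\nu}]=\tfrac i2\epsilon_{jk}(\sigma^\mu_{a\bar b}\partial^\nu\bar\chi_k^{\bar b}-\sigma^\nu_{a\bar b}\partial^\mu\bar\chi_k^{\bar b}),$$ $$[Q_{ja},C_{kl}]=-i\sigma^\mu_{a\bar b}\partial_\mu(\epsilon_{jk}\epsilon_{ln}\bar\chi_n^{\bar b}+\epsilon_{jl}\epsilon_{kn}\bar\chi_n^{\bar b}),\qquad [\bar Q_{j\bar a},C_{kl}]=i\sigma^\mu_{b\bar a}\partial_\mu(\delta_{jk}\chi_l^b+\delta_{jl}\chi_k^b),$$ $$\{Q_{ja},\chi_{kb}\}=-2i\epsilon_{jk}\sigma^{\mu\nu}_{ab}F_{\mu\nu}+\epsilon_{ab}C_{jk},\qquad \{Q_{ja},\bar\chi_{k\bar b}\}=2\delta_{jk}\sigma^\mu_{a\bar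 b}\partial_\mu z^*.$$ **Theorem.** (i) The causal (anti)commutators of the reduced multiplet are $$[z(x),z^*(y)]=-iD_m(x-y),$$ $$[F_{\mu\nu}(x),F_{\rho\sigma}(y)]=-\tfrac i2\,(g_{\mu\rho}\partial_\nu\partial_\sigma-g_{\nu\rho}\partial_\mu\partial_\sigma+g_{\nu\sigma}\partial_\mu\partial_\rho-g_{\mu\sigma}\partial_\nu\partial_\rho)D_m(x-y),$$ $$[C_{jk}(x),C_{ln}(y)]=-2im^2(\epsilon_{jl}\epsilon_{kn}+\epsilon_{jn}\epsilon_{kl})D_m(x-y),$$ $$[C_{jk}(x),C_{ln}^*(y)]=-2im^2(\delta_{jl}\delta_{kn}+\delta_{jn}\delta_{kl})D_m(x-y),$$ $$\{\chi_{ja}(x),\bar\chi_{k\bar b}(y)\}=2\delta_{jk}\sigma^\mu_{a\bar b}\partial_\mu D_m(x-y),$$ together with those obtained by taking adjoints or exchanging the two fields; all others vanish. (ii) This corresponds to $\alpha=2m^2$: put $D=-2i\,\partial^2z^*$, $F_{ab}=-2i\sigma^{\mu\nu}_{ab}F_{\mu\nu}$ and $\lambda_{ja}=i\epsilon_{jk}\sigma^\mu_{a\bar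 b}\partial_\mu\bar\chi_k^{\bar b}$. For $\alpha\in\mathbb C$ the fields $(z,D,F_{ab},C_{jk},\lambda_{ja},\chi_{ja})$ satisfy the relations $$[F_{ab}(x),F_{cd}(y)]=i\alpha(\epsilon_{ac}\epsilon_{bd}+\epsilon_{ad}\epsilon_{bc})D_m(x-y),\qquad [C_{jk}(x),C_{ln}(y)]=-i\alpha(\epsilon_{jl}\epsilon_{kn}+\epsilon_{jn}\epsilon_{kl})D_m(x-y),$$ $$[z(x),D(y)]=\alpha D_m(x-y),\qquad \{\chi_{ja}(x),\lambda_{kb}(y)\}=-i\alpha\,\epsilon_{ab}\epsilon_{jk}D_m(x-y),$$ $$[z(x),z^*(y)]=-iD_m(x-y),\qquad [D(x),D^*(y)]=-4im^4D_m(x-y),$$ $$[F_{ab}(x),F^*_{\bar c\bar d}(y)]=2i(\sigma^\mu_{a\bar c}\sigma^\nu_{b\bar d}+\sigma^\mu_{a\bar d}\sigma^\nu_{b\bar c})\partial_\mu\partial_\nu D_m(x-y),$$ $$[C_{jk}(x),C^*_{ln}(y)]=-2im^2(\delta_{jl}\delta_{kn}+\delta_{jn}\delta_{kl})D_m(x-y),$$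 $$\{\chi_{ja}(x),\bar\chi_{k\bar b}(y)\}=2\delta_{jk}\sigma^\mu_{a\bar b}\partial_\mu D_m(x-y),\qquad \{\lambda_{ja}(x),\bar\lambda_{k\bar b}(y)\}=2\delta_{jk}m^2\sigma^\mu_{a\bar b}\partial_\mu D_m(x-y),$$ with all other (anti)commutators $[\phi(x),\psi(y)]$ and $[\phi(x),\psi^*(y)]$ that do not follow from these by exchanging the two fields or taking adjoints equal to zero, if and only if $\alpha=2m^2$. Moreover $\mathcal D_{jk}:=\frac i2(C_{jk}-\epsilon_{jl}\epsilon_{kn}C^*_{ln})=0$, and $\mathcal C_{jk}:=\frac12(C_{jk}+\epsilon_{jl}\epsilon_{kn}C^*_{ln})=C_{jk}$. (iii) Let the two-point functions $\langle\Omega,\phi(x)\psi(y)\Omega\rangle$ be obtained from the causal (anti)commutators by the substitution $D_m\to D_m^{(+)}$. The positivity condition (the resulting squared norm of every one-particle state is $\ge0$, and each of the field components $z$, $z^*$, $F_{\mu\nu}$ with $\mu\neq\nu$, $C_{jk}$, $C_{jk}^*$, $\chi_{ja}$, $\bar\chi_{ja}$ creates some one-particle state of strictly positive norm, i.e. is not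 represented by zero) holds if and only if $m>0$; at $m=0$ it fails. The two-point functions, and hence the condition, do not depend on which polynomials are used to write the commutators of the multiplet, and the equivalence also holds for the two-point functions read off from the list in (i). -/

import Mathlib

open scoped SchwartzMap LineDeriv

noncomputable section

namespace SUSY

/-! ### Spacetime, test functions, differential operators -/

/-- Points of Minkowski space, with coordinates `x 0, x 1, x 2, x 3`. -/
abbrev Spacetime := EuclideanSpace ℝ (Fin 4)

/-- Complex Schwartz test functions on spacetime. -/
abbrev Test := 𝓢(Spacetime, ℂ)

/-- The diagonal entries `1, -1, -1, -1` of the Minkowski pseudo-metric (both `g_{μμ}` and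
`g^{μμ}`). -/
def gdiag : Fin 4 → ℂ := ![1, -1, -1, -1]

/-- `g_{μν} = g^{μν}`. -/
def gM (μ ν : Fin 4) : ℂ := if μ = ν then gdiag μ else 0

/-- `∂_μ = ∂ / ∂x^μ` on test functions. -/
def partialD (μ : Fin 4) : Test →ₗ[ℂ] Test :=
  (LineDeriv.lineDerivOpCLM ℂ Test (EuclideanSpace.single μ (1 : ℝ))).toLinearMap

/-- The d'Alembertian `∂² = g^{μν} ∂_μ ∂_ν` on test functions. -/
def box : Test →ₗ[ℂ] Test := ∑ μ, gdiag μ • (partialD μ ∘ₗ partialD μ)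

/-- Complex conjugation of test functions. -/
def conjTest (f : Test) : Test :=
  SchwartzMap.postcompCLM (𝕜 := ℝ) (Complex.conjCLE : ℂ →L[ℝ] ℂ) f

/-- The transpose `p(-∂)` of the constant-coefficient operator `p(∂)`, acting on test functions. -/
def transposeOp (p : MvPolynomial (Fin 4) ℂ) (f : Test) : Test :=
  ∑ s ∈ p.support, p.coeff s •
    ((-partialD 0) ^ s 0 * (-partialD 1) ^ s 1 * (-partialD 2) ^ s 2 * (-partialD 3) ^ s 3 :
      Module.End ℂ Test) f

/-! ### The Pauli–Jordan distribution -/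

/-- The energy `ω = √(|𝐤|² + m²)`. -/
def energy (m : ℝ) (k : EuclideanSpace ℝ (Fin 3)) : ℝ := Real.sqrt (‖k‖ ^ 2 + m ^ 2)

/-- The Minkowski product `k · x = ω x⁰ - 𝐤 · 𝐱` for `k = (ω, 𝐤)` on the upper hyperboloid of
mass `m`. -/
def shellProd (m : ℝ) (k : EuclideanSpace ℝ (Fin 3)) (x : Spacetime) : ℝ :=
  energy m k * x 0 - (k 0 * x 1 + k 1 * x 2 + k 2 * x 3)

/-- `∫ f(x) e^{i s k·x} dx` with `k` on the upper hyperboloid of mass `m`; used for `s = ± 1`. -/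
def shellFourier (m s : ℝ) (f : Test) (k : EuclideanSpace ℝ (Fin 3)) : ℂ :=
  ∫ x : Spacetime, f x * Complex.exp (Complex.I * (s * shellProd m k x : ℝ))

/-- The positive-frequency part
`D_m^{(+)}(x) = i (2π)⁻³ ∫ d³k / (2ω) e^{-i k·x}`, as the kernel `D_m^{(+)}(x - y)` smeared with
`f(x) g(y)`. -/
def Dplus (m : ℝ) (f g : Test) : ℂ :=
  Complex.I / (2 * Real.pi : ℂ) ^ 3 *
    ∫ k : EuclideanSpace ℝ (Fin 3),
      shellFourier m (-1) f k * shellFourier m 1 g k / (2 * energy m k : ℂ)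

/-- The Pauli–Jordan causal distribution `D_m(x) = D_m^{(+)}(x) - D_m^{(+)}(-x)`, that is
`i (2π)⁻³ ∫ d³k / (2ω) (e^{-i k·x} - e^{i k·x})`, as the kernel `D_m(x - y)` smeared with
`f(x) g(y)`. -/
def pauliJordan (m : ℝ) (f g : Test) : ℂ := Dplus m f g - Dplus m g f

/-- The kernel `(p(∂) D_m)(x - y)` smeared with `f(x) g(y)`. -/
def causalKernel (m : ℝ) (p : MvPolynomial (Fin 4) ℂ) (f g : Test) : ℂ :=
  pauliJordan m (transposeOp p f) g

/-- The kernel `(p(∂) D_m^{(+)})(x - y)` smeared with `f(x) g(y)`. -/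
def plusKernel (m : ℝ) (p : MvPolynomial (Fin 4) ℂ) (f g : Test) : ℂ :=
  Dplus m (transposeOp p f) g

/-! ### Spinor conventions -/

/-- `ε_{ab}` with `ε_{12} = 1`; also `ε_{jk}` for the internal indices. -/
def epsL (a b : Fin 2) : ℂ := !![0, 1; -1, 0] a b

/-- `ε^{ab} = - ε_{ab}`. -/
def epsU (a b : Fin 2) : ℂ := -epsL a b

/-- Kronecker's `δ_{jk}`. -/
def kd (j k : Fin 2) : ℂ := if j = k then 1 else 0

/-- The matrices `σ^μ = (1, σ₁, σ₂, σ₃)`, with elements `σ^μ_{a b̄}`. -/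
def pauli : Fin 4 → Matrix (Fin 2) (Fin 2) ℂ :=
  ![1, !![0, 1; 1, 0], !![0, -Complex.I; Complex.I, 0], !![1, 0; 0, -1]]

/-- `σ^{μν}_{ab} = (i/4) ε^{c̄ d̄} (σ^μ_{a c̄} σ^ν_{b d̄} - σ^ν_{a c̄} σ^μ_{b d̄})`. -/
def sigma2 (μ ν : Fin 4) (a b : Fin 2) : ℂ :=
  Complex.I / 4 * ∑ c, ∑ d, epsU c d * (pauli μ a c * pauli ν b d - pauli ν a c * pauli μ b d)

/-- The totally antisymmetric symbol `ε^{μνρλ}` with `ε^{0123} = 1`. -/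
def levi (μ ν ρ l : Fin 4) : ℂ :=
  Matrix.det (Matrix.of fun i j : Fin 4 => if ![μ, ν, ρ, l] i = j then (1 : ℂ) else 0)

/-- The Lorentz matrix `Λ(A)^μ_ν` of `A ∈ SL(2,ℂ)`: with `x̃ = x_μ σ^μ` one has
`A x̃ A† = (Λ(A) x)~`. -/
def lorentz (A : Matrix.SpecialLinearGroup (Fin 2) ℂ) : Matrix (Fin 4) (Fin 4) ℝ :=
  Matrix.of fun μ ν =>
    (gdiag μ * gdiag ν / 2 * (pauli μ * A.1 * pauli ν * A.1.conjTranspose).trace).re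

/-- The action of `A ∈ SL(2,ℂ)` on spacetime. -/
def lorentzAct (A : Matrix.SpecialLinearGroup (Fin 2) ℂ) (x : Spacetime) : Spacetime :=
  WithLp.toLp 2 fun μ => ∑ ν, lorentz A μ ν * x ν

/-! ### Smeared quantum fields with values in a `*`-algebra -/

section Fields

variable {𝒜 : Type*} [Ring 𝒜] [StarRing 𝒜] [Algebra ℂ 𝒜] [StarModule ℂ 𝒜]

/-- Commutator. -/
def comm (x y : 𝒜) : 𝒜 := x * y - y * x

/-- Anticommutator. -/
def acomm (x y : 𝒜) : 𝒜 := x * y + y * x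

/-- The adjoint field: `φ*(f) = (φ(f̄))*`. -/
def adj (φ : Test →ₗ[ℂ] 𝒜) : Test →ₗ[ℂ] 𝒜 where
  toFun f := star (φ (conjTest f))
  map_add' f g := by
    have h : conjTest (f + g) = conjTest f + conjTest g := by
      simp [conjTest]
    rw [h, map_add, star_add]
  map_smul' c f := by
    have h : conjTest (c • f) = (starRingEnd ℂ c) • conjTest f := by
      ext x
      simp [conjTest]
    rw [h, map_smul, star_smul]
    simp

/-- The derivative `∂_μ φ` of a field: `(∂_μ φ)(f) = - φ(∂_μ f)`. -/
def dField (μ : Fin 4) (φ : Test →ₗ[ℂ] 𝒜) : Test →ₗ[ℂ] 𝒜 := -(φ ∘ₗ partialD μ)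

/-- `∂^μ φ = g^{μν} ∂_ν φ`. -/
def dFieldUp (μ : Fin 4) (φ : Test →ₗ[ℂ] 𝒜) : Test →ₗ[ℂ] 𝒜 := gdiag μ • dField μ φ

/-- `∂² φ`. -/
def boxField (φ : Test →ₗ[ℂ] 𝒜) : Test →ₗ[ℂ] 𝒜 := φ ∘ₗ box

/-- Raising a Weyl index: `ψ^b = ε^{bc} ψ_c`. -/
def raise (ψ : Fin 2 → Test →ₗ[ℂ] 𝒜) (b : Fin 2) : Test →ₗ[ℂ] 𝒜 := ∑ c, epsU b c • ψ c

end Fields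

/-! ### The reduced multiplet -/

/-- Field components of the reduced multiplet and their adjoints. -/
inductive Comp
  | z
  | zStar
  | F (μ ν : Fin 4)
  | C (j k : Fin 2)
  | CStar (j k : Fin 2)
  | chi (j a : Fin 2)
  | chiBar (j a : Fin 2)
  deriving Fintype

/-- The component of the adjoint field (`F_{μν}` is real). -/
def Comp.conj : Comp → Comp
  | .z => .zStar
  | .zStar => .z
  | .F μ ν => .F μ ν
  | .C j k => .CStar j k
  | .CStar j k => .C j k
  | .chi j a => .chiBar j a
  | .chiBar j a => .chi j a

/-- The fermionic components. -/
def Comp.IsFermi : Comp → Prop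
  | .chi _ _ => True
  | .chiBar _ _ => True
  | _ => False

/-- The fields `(z, F_{μν}, C_{jk}, χ_{ja})`. -/
structure FieldContent (𝒜 : Type*) [Ring 𝒜] [StarRing 𝒜] [Algebra ℂ 𝒜] [StarModule ℂ 𝒜] where
  z : Test →ₗ[ℂ] 𝒜
  F : Fin 4 → Fin 4 → Test →ₗ[ℂ] 𝒜
  C : Fin 2 → Fin 2 → Test →ₗ[ℂ] 𝒜
  chi : Fin 2 → Fin 2 → Test →ₗ[ℂ] 𝒜

namespace FieldContent

variable {𝒜 : Type*} [Ring 𝒜] [StarRing 𝒜] [Algebra ℂ 𝒜] [StarModule ℂ 𝒜]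

/-- `F^{μν}`. -/
def Fup (Φ : FieldContent 𝒜) (μ ν : Fin 4) : Test →ₗ[ℂ] 𝒜 := (gdiag μ * gdiag ν) • Φ.F μ ν

/-- `χ̄_{j ā} = (χ_{ja})*`. -/
def chiBar (Φ : FieldContent 𝒜) (j a : Fin 2) : Test →ₗ[ℂ] 𝒜 := adj (Φ.chi j a)

/-- The field with a given component label. -/
def field (Φ : FieldContent 𝒜) : Comp → Test →ₗ[ℂ] 𝒜
  | .z => Φ.z
  | .zStar => adj Φ.z
  | .F μ ν => Φ.F μ ν
  | .C j k => Φ.C j k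
  | .CStar j k => adj (Φ.C j k)
  | .chi j a => Φ.chi j a
  | .chiBar j a => Φ.chiBar j a

open Classical in
/-- The causal bracket `[φ_I(f), φ_J(g)]`, an anticommutator when both fields are fermionic. -/
def bracket (Φ : FieldContent 𝒜) (I J : Comp) (f g : Test) : 𝒜 :=
  if I.IsFermi ∧ J.IsFermi then acomm (Φ.field I f) (Φ.field J g)
  else comm (Φ.field I f) (Φ.field J g)

/-- The causal (anti)commutators of the fields are `[φ_I(x), φ_J(y)] = (T_{IJ}(∂) D_m)(x - y)`. -/
def HasCommutators (m : ℝ) (Φ : FieldContent 𝒜) (T : Comp → Comp → MvPolynomial (Fin 4) ℂ) :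
    Prop :=
  ∀ I J f g, Φ.bracket I J f g = algebraMap ℂ 𝒜 (causalKernel m (T I J) f g)

end FieldContent

/-- The reduced multiplet of free fields built on a complex scalar field `z` of mass `m`, with two
supercharges `Q_{ja}`, internal symmetry group `SU(2)` and no central charges, realised by
distributions with values in a `*`-algebra (no positivity is imposed). -/
structure ReducedMultiplet (m : ℝ) (𝒜 : Type*) [Ring 𝒜] [StarRing 𝒜] [Algebra ℂ 𝒜]
    [StarModule ℂ 𝒜] extends FieldContent 𝒜 where
  /-- The supercharges `Q_{ja}`; `Q̄_{j ā} = (Q_{ja})*`. -/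
  Q : Fin 2 → Fin 2 → 𝒜
  /-- The generators `P_μ` of the translations. -/
  P : Fin 4 → 𝒜
  /-- The representations of `SL(2,ℂ)`, of the translations and of `SU(2)`. -/
  U : Matrix.SpecialLinearGroup (Fin 2) ℂ →* unitary 𝒜
  T : Multiplicative Spacetime →* unitary 𝒜
  V : Matrix.specialUnitaryGroup (Fin 2) ℂ →* unitary 𝒜
  -- algebraic restrictions on the fields
  C_symm : ∀ j k, C j k = C k j
  C_real : ∀ j k, adj (C j k) = ∑ l, ∑ n, (epsL j l * epsL k n) • C l n
  F_antisymm : ∀ μ ν, F μ ν = -F ν μ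
  F_real : ∀ μ ν, adj (F μ ν) = F μ ν
  F_closed : ∀ μ, ∑ ν, ∑ ρ, ∑ l, levi μ ν ρ l • dField ν (F ρ l) = 0
  -- `z` is a complex scalar field of mass `m`
  klein_gordon : boxField z + ((m : ℂ) ^ 2) • z = 0
  comm_z_z : ∀ f g, comm (z f) (z g) = 0
  comm_z_zStar : ∀ f g, comm (z f) (adj z g) = algebraMap ℂ 𝒜 (-Complex.I * pauliJordan m f g)
  -- causal (anti)commutation relations: numerical kernels of the form `(p(∂) D_m)(x - y)`, and
  -- bosonic fields commute with fermionic ones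
  causal : ∀ I J : Comp, ∃ p : MvPolynomial (Fin 4) ℂ, ∀ f g,
    toFieldContent.bracket I J f g = algebraMap ℂ 𝒜 (causalKernel m p f g)
  causal_mixed : ∀ I J : Comp, ¬ I.IsFermi → J.IsFermi → ∀ f g,
    comm (toFieldContent.field I f) (toFieldContent.field J g) = 0
  -- the representation of the Poincaré group and of `SU(2)`
  U_T : ∀ A a, U A * T (Multiplicative.ofAdd a) * (U A)⁻¹ =
    T (Multiplicative.ofAdd (lorentzAct A a))
  V_U : ∀ B A, Commute (V B) (U A)
  V_T : ∀ B a, Commute (V B) (T a)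
  -- `T_a⁻¹ φ(x) T_a = φ(x - a)`
  translation : ∀ (I : Comp) (a : Spacetime) (f f' : Test), (∀ x, f' x = f (x + a)) →
    star (T (Multiplicative.ofAdd a) : 𝒜) * toFieldContent.field I f *
      (T (Multiplicative.ofAdd a) : 𝒜) = toFieldContent.field I f'
  -- Lorentz covariance, e.g. `U_A⁻¹ χ_{ja}(x) U_A = A_a^b χ_{jb}(Λ⁻¹ x)`
  lorentz_z : ∀ A (f f' : Test), (∀ x, f' x = f (lorentzAct A x)) →
    star (U A : 𝒜) * z f * (U A : 𝒜) = z f'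
  lorentz_C : ∀ A j k (f f' : Test), (∀ x, f' x = f (lorentzAct A x)) →
    star (U A : 𝒜) * C j k f * (U A : 𝒜) = C j k f'
  lorentz_F : ∀ A μ ν (f f' : Test), (∀ x, f' x = f (lorentzAct A x)) →
    star (U A : 𝒜) * F μ ν f * (U A : 𝒜) =
      ∑ ρ, ∑ l, ((lorentz A⁻¹ ρ μ * lorentz A⁻¹ l ν : ℝ) : ℂ) • F ρ l f'
  lorentz_chi : ∀ A j a (f f' : Test), (∀ x, f' x = f (lorentzAct A x)) →
    star (U A : 𝒜) * chi j a f * (U A : 𝒜) = ∑ b, A.1 a b • chi j b f'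
  lorentz_Q : ∀ A j a, star (U A : 𝒜) * Q j a * (U A : 𝒜) = ∑ b, A.1 a b • Q j b
  -- `SU(2)` covariance
  su2_z : ∀ B f, star (V B : 𝒜) * z f * (V B : 𝒜) = z f
  su2_F : ∀ B μ ν f, star (V B : 𝒜) * F μ ν f * (V B : 𝒜) = F μ ν f
  su2_C : ∀ B j k f, star (V B : 𝒜) * C j k f * (V B : 𝒜) =
    ∑ l, ∑ n, (B.1 j l * B.1 k n) • C l n f
  su2_chi : ∀ B j a f, star (V B : 𝒜) * chi j a f * (V B : 𝒜) = ∑ k, B.1 j k • chi k a f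
  su2_Q : ∀ B j a, star (V B : 𝒜) * Q j a * (V B : 𝒜) = ∑ k, B.1 j k • Q k a
  -- the supersymmetry algebra
  P_field : ∀ μ I f, comm (P μ) (toFieldContent.field I f) =
    -Complex.I • dField μ (toFieldContent.field I) f
  Q_P : ∀ j a μ, comm (Q j a) (P μ) = 0
  Q_Q : ∀ j a k b, acomm (Q j a) (Q k b) = 0
  Q_Qbar : ∀ j a k b, acomm (Q j a) (star (Q k b)) =
    ∑ μ, (2 * kd j k * pauli μ a b) • P μ
  -- the action of the supercharges on the fields
  Q_z : ∀ j a f, Complex.I • comm (Q j a) (z f) = chi j a f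
  Qbar_z : ∀ j a f, comm (star (Q j a)) (z f) = 0
  Q_F : ∀ j a μ ν f, comm (Q j a) (toFieldContent.Fup μ ν f) =
    ∑ k, (Complex.I / 2 * epsL j k) • ∑ b,
      (pauli μ a b • dFieldUp ν (raise (toFieldContent.chiBar k) b) f
        - pauli ν a b • dFieldUp μ (raise (toFieldContent.chiBar k) b) f)
  Q_C : ∀ j a k l f, comm (Q j a) (C k l f) =
    -Complex.I • ∑ μ, ∑ b, pauli μ a b • ∑ n, (epsL j k * epsL l n + epsL j l * epsL k n) •
      dField μ (raise (toFieldContent.chiBar n) b) f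
  Qbar_C : ∀ j a k l f, comm (star (Q j a)) (C k l f) =
    Complex.I • ∑ μ, ∑ b, pauli μ b a •
      (kd j k • dField μ (raise (chi l) b) f + kd j l • dField μ (raise (chi k) b) f)
  Q_chi : ∀ j a k b f, acomm (Q j a) (chi k b f) =
    (-2 * Complex.I * epsL j k) • ∑ μ, ∑ ν, sigma2 μ ν a b • F μ ν f + epsL a b • C j k f
  Q_chiBar : ∀ j a k b f, acomm (Q j a) (toFieldContent.chiBar k b f) =
    (2 * kd j k) • ∑ μ, pauli μ a b • dField μ (adj z) f

/-! ### The list of causal (anti)commutators -/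

open MvPolynomial in
/-- The causal (anti)commutators of the reduced multiplet, as polynomials in `∂_μ = X μ` applied
to `D_m`; brackets that are not listed vanish. -/
def reducedTable (m : ℝ) : Comp → Comp → MvPolynomial (Fin 4) ℂ
  | .z, .zStar => C (-Complex.I)
  | .zStar, .z => C (-Complex.I)
  | .F μ ν, .F ρ l => C (-Complex.I / 2) *
      (C (gM μ ρ) * X ν * X l - C (gM ν ρ) * X μ * X l
        + C (gM ν l) * X μ * X ρ - C (gM μ l) * X ν * X ρ)
  | .C j k, .C l n => C (-2 * Complex.I * m ^ 2 * (epsL j l * epsL k n + epsL j n * epsL k l))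
  | .CStar j k, .CStar l n =>
      C (-2 * Complex.I * m ^ 2 * (epsL j l * epsL k n + epsL j n * epsL k l))
  | .C j k, .CStar l n => C (-2 * Complex.I * m ^ 2 * (kd j l * kd k n + kd j n * kd k l))
  | .CStar j k, .C l n => C (-2 * Complex.I * m ^ 2 * (kd j l * kd k n + kd j n * kd k l))
  | .chi j a, .chiBar k b => C (2 * kd j k) * ∑ μ, C (pauli μ a b) * X μ
  | .chiBar k b, .chi j a => C (2 * kd j k) * ∑ μ, C (pauli μ a b) * X μ
  | _, _ => 0

/-! ### Positivity of the two-point functions -/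

/-- The squared norm of the one-particle state `Ψ = ∑_I φ_I(f_I) Ω`, computed from the two-point
functions `⟨Ω, φ_I(x) φ_J(y) Ω⟩ = (T_{IJ}(∂) D_m^{(+)})(x - y)` that one gets from the causal
(anti)commutators `T_{IJ}(∂) D_m` by the substitution `D_m → D_m^{(+)}`. -/
def oneParticleNormSq (m : ℝ) (T : Comp → Comp → MvPolynomial (Fin 4) ℂ) (f : Comp → Test) : ℂ :=
  ∑ I, ∑ J, plusKernel m (T I.conj J) (conjTest (f I)) (f J)

/-- The components that are not zero by the antisymmetry of `F`. -/
def Comp.IsProper : Comp → Prop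
  | .F μ ν => μ ≠ ν
  | _ => True

/-- The positivity condition: the squared norms of the one-particle states are non-negative, and
every field of the multiplet is really represented, i.e. it creates from the vacuum some state of
strictly positive norm (a field all of whose one-particle states are null is represented by `0`
in the Hilbert space). -/
def PositivityCondition (m : ℝ) (T : Comp → Comp → MvPolynomial (Fin 4) ℂ) : Prop :=
  (∀ f : Comp → Test, 0 ≤ (oneParticleNormSq m T f).re ∧ (oneParticleNormSq m T f).im = 0) ∧
  ∀ I : Comp, I.IsProper → ∃ f : Test, 0 < (plusKernel m (T I.conj I) (conjTest f) f).re

/-! ### The unreduced multiplet `(z, D, F_{ab}, C_{jk}, λ_{ja}, χ_{ja})` -/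

/-- Field components of the unreduced multiplet. -/
inductive FullComp
  | z
  | D
  | F (a b : Fin 2)
  | C (j k : Fin 2)
  | lam (j a : Fin 2)
  | chi (j a : Fin 2)

/-- The fermionic components. -/
def FullComp.IsFermi : FullComp → Prop
  | .lam _ _ => True
  | .chi _ _ => True
  | _ => False

open MvPolynomial in
/-- The causal (anti)commutators `[φ(x), ψ(y)]` of the unreduced multiplet with parameter `α`. -/
def fullTable (α : ℂ) : FullComp → FullComp → MvPolynomial (Fin 4) ℂ
  | .F a b, .F c d => C (Complex.I * α * (epsL a c * epsL b d + epsL a d * epsL b c))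
  | .C j k, .C l n => C (-Complex.I * α * (epsL j l * epsL k n + epsL j n * epsL k l))
  | .z, .D => C α
  | .D, .z => C α
  | .chi j a, .lam k b => C (-Complex.I * α * epsL a b * epsL j k)
  | .lam k b, .chi j a => C (Complex.I * α * epsL a b * epsL j k)
  | _, _ => 0

open MvPolynomial in
/-- The causal (anti)commutators `[φ(x), ψ*(y)]` of the unreduced multiplet. -/
def fullStarTable (m : ℝ) : FullComp → FullComp → MvPolynomial (Fin 4) ℂ
  | .z, .z => C (-Complex.I)
  | .D, .D => C (-4 * Complex.I * m ^ 4)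
  | .F a b, .F c d => C (2 * Complex.I) * ∑ μ, ∑ ν,
      C (pauli μ a c * pauli ν b d + pauli μ a d * pauli ν b c) * X μ * X ν
  | .C j k, .C l n => C (-2 * Complex.I * m ^ 2 * (kd j l * kd k n + kd j n * kd k l))
  | .chi j a, .chi k b => C (2 * kd j k) * ∑ μ, C (pauli μ a b) * X μ
  | .lam j a, .lam k b => C (2 * kd j k * m ^ 2) * ∑ μ, C (pauli μ a b) * X μ
  | _, _ => 0

namespace FieldContent

variable {𝒜 : Type*} [Ring 𝒜] [StarRing 𝒜] [Algebra ℂ 𝒜] [StarModule ℂ 𝒜]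

/-- The fields of the unreduced multiplet expressed by those of the reduced one:
`D = -2i ∂² z*`, `F_{ab} = -2i σ^{μν}_{ab} F_{μν}` and
`λ_{ja} = i ε_{jk} σ^μ_{a b̄} ∂_μ χ̄_k^{b̄}`. -/
def fullField (Φ : FieldContent 𝒜) : FullComp → Test →ₗ[ℂ] 𝒜
  | .z => Φ.z
  | .D => (-2 * Complex.I) • boxField (adj Φ.z)
  | .F a b => (-2 * Complex.I) • ∑ μ, ∑ ν, sigma2 μ ν a b • Φ.F μ ν
  | .C j k => Φ.C j k
  | .lam j a => ∑ k, (Complex.I * epsL j k) •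
      ∑ μ, ∑ b, pauli μ a b • dField μ (raise (Φ.chiBar k) b)
  | .chi j a => Φ.chi j a

open Classical in
/-- The causal (anti)commutators of the unreduced multiplet hold with the parameter `α`. -/
def HasFullCommutators (m : ℝ) (Φ : FieldContent 𝒜) (α : ℂ) : Prop :=
  ∀ I J : FullComp, ∀ f g : Test,
    (if I.IsFermi ∧ J.IsFermi then acomm (Φ.fullField I f) (Φ.fullField J g)
      else comm (Φ.fullField I f) (Φ.fullField J g)) =
        algebraMap ℂ 𝒜 (causalKernel m (fullTable α I J) f g) ∧
    (if I.IsFermi ∧ J.IsFermi then acomm (Φ.fullField I f) (adj (Φ.fullField J) g)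
      else comm (Φ.fullField I f) (adj (Φ.fullField J) g)) =
        algebraMap ℂ 𝒜 (causalKernel m (fullStarTable m I J) f g)

/-- `𝒞_{jk} = (C_{jk} + ε_{jl} ε_{kn} C*_{ln}) / 2`. -/
def scriptC (Φ : FieldContent 𝒜) (j k : Fin 2) : Test →ₗ[ℂ] 𝒜 :=
  (1 / 2 : ℂ) • (Φ.C j k + ∑ l, ∑ n, (epsL j l * epsL k n) • adj (Φ.C l n))

/-- `𝒟_{jk} = (i/2) (C_{jk} - ε_{jl} ε_{kn} C*_{ln})`. -/
def scriptD (Φ : FieldContent 𝒜) (j k : Fin 2) : Test →ₗ[ℂ] 𝒜 :=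
  (Complex.I / 2) • (Φ.C j k - ∑ l, ∑ n, (epsL j l * epsL k n) • adj (Φ.C l n))

end FieldContent

end SUSY

end

/-! Everything is read off in momentum space. A kernel `p(∂) D_m` depends only on the values of `p`
on the two-sheeted mass shell `v = ∓i k`, and conversely it vanishes only if `p` vanishes there
(`causalKernel_congr`, `eval_eq_zero_of_causalKernel`). For the converse, a test function whose
Fourier transform is a bump at positive energy removes the lower sheet, and a suitable second test
function turns the rest into the integral of a square. Hence each bracket has a well-defined symbol
on the shell (`HasSymbol`), and linear combinations, derivatives, exchange and comparison of
brackets become algebra of functions.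

The brackets come from `[z, z*]` by the graded Jacobi identity `{[q, b], x} + [b, {q, x}] = 0`,
valid because the bosonic `b` commutes with the fermionic `x`. The triple `(Q, z, χ̄)` gives `{χ,
χ̄}`. Invariance under `SU(2)` makes the triplet `C` commute with the singlets `z`, `z*`, `F`. The
delicate point is `[F, z] = 0` (`comm_F_z`): the triples `(Q, z, χ)` and `(Q̄, F, χ)` make the
symbol of `[F, z]` satisfy `E = iB`, closedness of `F` gives `n·B = 0` along the momentum direction
`n`, and covariance under the rotation by `π` about `n` removes the transverse part. Then `{χ, χ} =
0`. The triple `(Q, C, χ)` gives `[C, C]`, where `∂² = -m²` on the shell produces the factor `m²`.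
The triples `(Q, F, χ)` and `(Q̄, F, χ̄)` give the self-dual and anti-self-dual contractions of `[F,
F]`, which together determine it. Brackets with `C*` follow from the reality condition.

The unreduced fields are linear combinations of derivatives of the reduced ones, so their brackets
are computed with the same calculus. The relation `[z, D] = α D_m` alone already forces `α = 2m²`.

For positivity, the one-particle norm is an integral over the upper sheet of a block-diagonal
Hermitian form. Its blocks are squares for `z`, a tensor form that is non-negative because a vector
orthogonal to a timelike one is not timelike, `2m²` times a sum of squares for `C`, and the form of
a future-directed momentum for the spinors. At `m = 0` the `C` block vanishes, so `C` is represented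
by zero. Independence of the chosen polynomials is again the uniqueness of symbols. -/

noncomputable section

namespace SUSY

open MeasureTheory Filter Topology
open scoped FourierTransform

/-! ### Fourier transforms on the mass shell -/

/-- The wave vector `(ω, -𝐤)`, so that `k · x` is its Euclidean inner product with `x`. -/
def waveVec (m : ℝ) (k : EuclideanSpace ℝ (Fin 3)) : Spacetime :=
  !₂[energy m k, -k 0, -k 1, -k 2]

/-- The value `-i k_μ` of the symbol of `∂_μ` on the upper hyperboloid. -/
def shellVec (m : ℝ) (k : EuclideanSpace ℝ (Fin 3)) : Fin 4 → ℂ :=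
  fun μ => -Complex.I * (waveVec m k μ : ℂ)

lemma inner_waveVec (m : ℝ) (k : EuclideanSpace ℝ (Fin 3)) (x : Spacetime) :
    inner ℝ x (waveVec m k) = shellProd m k x := by
  simp [PiLp.inner_apply, Fin.sum_univ_four, waveVec, shellProd]
  ring

/-- The transform `𝓕` has kernel `e^{-2πi⟨x,ξ⟩}`, whence the frequency `-s/(2π)` times the wave
vector. All regularity and decay on the shell is inherited from `𝓕 f`. -/
lemma shellFourier_eq (m s : ℝ) (f : Test) (k : EuclideanSpace ℝ (Fin 3)) :
    shellFourier m s f k = (𝓕 f) (-(s / (2 * Real.pi)) • waveVec m k) := by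
  rw [SchwartzMap.fourier_coe, Real.fourier_eq', shellFourier]
  refine integral_congr_ae (Eventually.of_forall fun x => ?_)
  simp only [inner_smul_right, inner_waveVec, smul_eq_mul]
  rw [mul_comm]
  congr 2
  push_cast
  have : (Real.pi : ℂ) ≠ 0 := by exact_mod_cast Real.pi_ne_zero
  field_simp

lemma shellFourier_add (m s : ℝ) (f g : Test) (k : EuclideanSpace ℝ (Fin 3)) :
    shellFourier m s (f + g) k = shellFourier m s f k + shellFourier m s g k := by
  simp only [shellFourier_eq, FourierTransform.fourier_add, add_apply]

lemma shellFourier_smul (m s : ℝ) (c : ℂ) (f : Test) (k : EuclideanSpace ℝ (Fin 3)) :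
    shellFourier m s (c • f) k = c * shellFourier m s f k := by
  simp only [shellFourier_eq, FourierTransform.fourier_smul, smul_apply, smul_eq_mul]

/-- `f ↦ shellFourier m s f k` as a linear form. -/
def shellFourierL (m s : ℝ) (k : EuclideanSpace ℝ (Fin 3)) : Test →ₗ[ℂ] ℂ where
  toFun f := shellFourier m s f k
  map_add' f g := shellFourier_add m s f g k
  map_smul' c f := shellFourier_smul m s c f k

lemma shellFourier_partialD (m s : ℝ) (μ : Fin 4) (f : Test) (k : EuclideanSpace ℝ (Fin 3)) :
    shellFourier m s (partialD μ f) k = s * shellVec m k μ * shellFourier m s f k := by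
  simp only [shellFourier_eq]
  have h : (partialD μ f) = ∂_{EuclideanSpace.single μ (1 : ℝ)} f := rfl
  rw [h, SchwartzMap.fourier_lineDerivOp_eq]
  have ht : (fun x : Spacetime => inner ℝ x (EuclideanSpace.single μ (1 : ℝ))).HasTemperateGrowth :=
    ((innerSL ℝ).flip (EuclideanSpace.single μ (1 : ℝ))).hasTemperateGrowth
  rw [smul_apply, SchwartzMap.smulLeftCLM_apply_apply ht]
  simp only [EuclideanSpace.inner_single_right, PiLp.smul_apply, smul_eq_mul, Complex.real_smul,
    shellVec]
  have : (Real.pi : ℂ) ≠ 0 := by exact_mod_cast Real.pi_ne_zero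
  simp
  field_simp

lemma shellFourier_pow (m s : ℝ) (μ : Fin 4) (n : ℕ) (f : Test) (k : EuclideanSpace ℝ (Fin 3)) :
    shellFourier m s (((-partialD μ) ^ n : Module.End ℂ Test) f) k =
      (-s * shellVec m k μ) ^ n * shellFourier m s f k := by
  induction n generalizing f with
  | zero => simp
  | succ n ih =>
    rw [pow_succ, Module.End.mul_apply, ih]
    have : (-partialD μ : Module.End ℂ Test) f = (-1 : ℂ) • partialD μ f := by simp
    rw [this, shellFourier_smul, shellFourier_partialD]
    ring

/-- Integration by parts twice over: the transpose carries a sign, and so does `∂_μ` acting on the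
exponential. For `s = -1` the symbol is taken at `shellVec`, for `s = 1` at its negative; these are
the two sheets. -/
lemma shellFourier_transposeOp (m s : ℝ) (p : MvPolynomial (Fin 4) ℂ) (f : Test)
    (k : EuclideanSpace ℝ (Fin 3)) :
    shellFourier m s (transposeOp p f) k =
      MvPolynomial.eval (fun μ => -s * shellVec m k μ) p * shellFourier m s f k := by
  have h : shellFourier m s (transposeOp p f) k = shellFourierL m s k (transposeOp p f) := rfl
  rw [h, transposeOp, map_sum, MvPolynomial.eval_eq', Finset.sum_mul]
  refine Finset.sum_congr rfl fun d _ => ?_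
  rw [map_smul]
  simp only [shellFourierL, LinearMap.coe_mk, AddHom.coe_mk, Module.End.mul_apply,
    shellFourier_pow, Fin.prod_univ_four, smul_eq_mul, MvPolynomial.coeff]
  ring

lemma conjTest_apply (f : Test) (x : Spacetime) : conjTest f x = (starRingEnd ℂ) (f x) := rfl

lemma shellFourier_conjTest (m s : ℝ) (f : Test) (k : EuclideanSpace ℝ (Fin 3)) :
    shellFourier m s (conjTest f) k = (starRingEnd ℂ) (shellFourier m (-s) f k) := by
  rw [shellFourier, shellFourier, ← integral_conj]
  refine integral_congr_ae (Eventually.of_forall fun x => ?_)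
  simp only [conjTest_apply, map_mul, ← Complex.exp_conj, Complex.conj_I, Complex.conj_ofReal]
  congr 2
  push_cast
  ring

lemma energy_nonneg (m : ℝ) (k : EuclideanSpace ℝ (Fin 3)) : 0 ≤ energy m k := Real.sqrt_nonneg _

lemma norm_le_energy (m : ℝ) (k : EuclideanSpace ℝ (Fin 3)) : ‖k‖ ≤ energy m k :=
  Real.le_sqrt_of_sq_le (by nlinarith [sq_nonneg m])

lemma energy_pos (m : ℝ) {k : EuclideanSpace ℝ (Fin 3)} (hk : k ≠ 0) : 0 < energy m k :=
  (norm_pos_iff.2 hk).trans_le (norm_le_energy m k)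

lemma energy_sq (m : ℝ) (k : EuclideanSpace ℝ (Fin 3)) :
    energy m k ^ 2 = k 0 ^ 2 + k 1 ^ 2 + k 2 ^ 2 + m ^ 2 := by
  rw [energy, Real.sq_sqrt (by positivity), EuclideanSpace.norm_sq_eq, Fin.sum_univ_three]
  simp

@[fun_prop]
lemma continuous_energy (m : ℝ) : Continuous (energy m) := by
  unfold energy; fun_prop

@[fun_prop]
lemma continuous_waveVec (m : ℝ) : Continuous (waveVec m) := by
  refine (PiLp.continuous_toLp 2 _).comp (continuous_pi fun i => ?_)
  fin_cases i <;> simp <;> fun_prop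

@[fun_prop]
lemma continuous_shellVec (m : ℝ) : Continuous (shellVec m) := by
  refine continuous_pi fun i => ?_
  unfold shellVec
  fun_prop

@[fun_prop]
lemma continuous_shellFourier (m s : ℝ) (f : Test) : Continuous (shellFourier m s f) := by
  have h : shellFourier m s f = fun k => (𝓕 f) (-(s / (2 * Real.pi)) • waveVec m k) :=
    funext (shellFourier_eq m s f)
  rw [h]
  exact (SchwartzMap.continuous _).comp (by fun_prop)

lemma norm_le_norm_waveVec (m : ℝ) (k : EuclideanSpace ℝ (Fin 3)) : ‖k‖ ≤ ‖waveVec m k‖ := by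
  rw [← sq_le_sq₀ (norm_nonneg _) (norm_nonneg _), EuclideanSpace.norm_sq_eq,
    EuclideanSpace.norm_sq_eq, Fin.sum_univ_three, Fin.sum_univ_four]
  simp [waveVec]
  positivity

lemma shellFourier_decay (m : ℝ) {s : ℝ} (hs : |s| = 1) (f : Test) (n : ℕ) :
    ∃ A : ℝ, 0 ≤ A ∧ ∀ k, ‖k‖ ^ n * ‖shellFourier m s f k‖ ≤ A := by
  obtain ⟨A, hA, h⟩ := (𝓕 f).decay n 0
  refine ⟨(2 * Real.pi) ^ n * A, by positivity, fun k => ?_⟩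
  have h1 := h (-(s / (2 * Real.pi)) • waveVec m k)
  rw [norm_iteratedFDeriv_zero, ← shellFourier_eq, norm_smul, Real.norm_eq_abs, abs_neg, abs_div,
    hs, abs_of_pos (by positivity : (0 : ℝ) < 2 * Real.pi)] at h1
  calc ‖k‖ ^ n * ‖shellFourier m s f k‖
      ≤ ‖waveVec m k‖ ^ n * ‖shellFourier m s f k‖ := by gcongr; exact norm_le_norm_waveVec m k
    _ = (2 * Real.pi) ^ n * ((1 / (2 * Real.pi) * ‖waveVec m k‖) ^ n * ‖shellFourier m s f k‖) := by
        rw [← mul_assoc, ← mul_pow, ← mul_assoc, mul_one_div_cancel (by positivity), one_mul]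
    _ ≤ _ := by gcongr

/-- Dominating function for the shell integrals. The singularity `1/‖k‖` majorises `1/(2ω)` for
every mass, including `m = 0`. -/
lemma integrable_radial :
    Integrable (fun k : EuclideanSpace ℝ (Fin 3) => ‖k‖⁻¹ * ((1 + ‖k‖ ^ 2) ^ 2)⁻¹) := by
  rw [integrable_fun_norm_addHaar volume (f := fun r : ℝ => r⁻¹ * ((1 + r ^ 2) ^ 2)⁻¹)]
  simp only [finrank_euclideanSpace, Fintype.card_fin]
  refine (integrable_inv_one_add_sq.integrableOn (s := Set.Ioi (0 : ℝ))).mono' ?_ ?_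
  · exact (by fun_prop : Measurable _).aestronglyMeasurable
  · filter_upwards [ae_restrict_mem measurableSet_Ioi] with r hr
    have hr' : (0 : ℝ) < r := hr
    rw [Real.norm_of_nonneg (by simp only [smul_eq_mul]; positivity), smul_eq_mul]
    -- The volume element `r²` leaves `r / (1 + r²)²`, which is at most `1 / (1 + r²)` because `r ≤
    -- 1 + r²`.
    rw [show r ^ (3 - 1) * (r⁻¹ * ((1 + r ^ 2) ^ 2)⁻¹) = r / (1 + r ^ 2) ^ 2 by field_simp,
      inv_eq_one_div, div_le_div_iff₀ (by positivity) (by positivity)]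
    nlinarith [sq_nonneg (r - 1), mul_pos hr' hr', mul_pos hr' (mul_pos hr' hr')]

lemma integrable_shell (m : ℝ) {s t : ℝ} (hs : |s| = 1) (ht : |t| = 1) (f g : Test) :
    Integrable (fun k => shellFourier m s f k * shellFourier m t g k / (2 * energy m k : ℂ)) := by
  obtain ⟨A, hA, h0⟩ := shellFourier_decay m hs f 0
  -- The orders 0, 2, 4 together bound `(1 + ‖k‖²)² = 1 + 2‖k‖² + ‖k‖⁴` times the transform.
  obtain ⟨B0, hB0, g0⟩ := shellFourier_decay m ht g 0
  obtain ⟨B2, hB2, g2⟩ := shellFourier_decay m ht g 2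
  obtain ⟨B4, hB4, g4⟩ := shellFourier_decay m ht g 4
  refine (integrable_radial.const_mul (A * (B0 + 2 * B2 + B4))).mono' ?_ ?_
  · refine Measurable.aestronglyMeasurable ?_
    have := (continuous_shellFourier m s f).measurable
    have := (continuous_shellFourier m t g).measurable
    have := (continuous_energy m).measurable
    fun_prop
  · have h3 : ∀ᵐ k : EuclideanSpace ℝ (Fin 3), k ≠ 0 := by
      simp [ae_iff]
    filter_upwards [h3] with k hk
    have hn := norm_pos_iff.2 hk
    have he := norm_le_energy m k
    have hf := h0 k
    have hg : (1 + ‖k‖ ^ 2) ^ 2 * ‖shellFourier m t g k‖ ≤ B0 + 2 * B2 + B4 := by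
      nlinarith [g0 k, g2 k, g4 k]
    rw [pow_zero, one_mul] at hf
    have hd : ‖(2 * energy m k : ℂ)‖ = 2 * energy m k := by
      rw [norm_mul, Complex.norm_real, Real.norm_of_nonneg (energy_nonneg m k)]; simp
    rw [norm_div, norm_mul, hd, div_le_iff₀ (by linarith)]
    calc ‖shellFourier m s f k‖ * ‖shellFourier m t g k‖
        ≤ A * ((B0 + 2 * B2 + B4) * ((1 + ‖k‖ ^ 2) ^ 2)⁻¹) := by
          gcongr
          rw [← div_eq_mul_inv, le_div_iff₀ (by positivity)]
          linarith
      _ = A * (B0 + 2 * B2 + B4) * (‖k‖⁻¹ * ((1 + ‖k‖ ^ 2) ^ 2)⁻¹) * ‖k‖ := by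
          field_simp
      _ ≤ _ := by gcongr; linarith

/-- The symbol of `p(∂)` on the two shells times the Fourier transforms. -/
lemma integrable_symbol (m : ℝ) {s t : ℝ} (hs : |s| = 1) (ht : |t| = 1)
    (p : MvPolynomial (Fin 4) ℂ) (f g : Test) :
    Integrable (fun k => MvPolynomial.eval (fun μ => -s * shellVec m k μ) p *
      (shellFourier m s f k * shellFourier m t g k) / (2 * energy m k : ℂ)) := by
  refine (integrable_shell m hs ht (transposeOp p f) g).congr (Eventually.of_forall fun k => ?_)
  simp only [shellFourier_transposeOp]
  ring

lemma plusKernel_eq (m : ℝ) (p : MvPolynomial (Fin 4) ℂ) (f g : Test) :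
    plusKernel m p f g = Complex.I / (2 * Real.pi : ℂ) ^ 3 *
      ∫ k, MvPolynomial.eval (shellVec m k) p *
        (shellFourier m (-1) f k * shellFourier m 1 g k) / (2 * energy m k : ℂ) := by
  rw [plusKernel, Dplus]
  congr 2
  funext k
  rw [shellFourier_transposeOp]
  simp only [Complex.ofReal_neg, Complex.ofReal_one, neg_neg, one_mul]
  ring

/-- The contribution of the lower hyperboloid to `p(∂) D_m`. -/
lemma Dplus_transposeOp_right (m : ℝ) (p : MvPolynomial (Fin 4) ℂ) (f g : Test) :
    Dplus m g (transposeOp p f) = Complex.I / (2 * Real.pi : ℂ) ^ 3 *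
      ∫ k, MvPolynomial.eval (-shellVec m k) p *
        (shellFourier m 1 f k * shellFourier m (-1) g k) / (2 * energy m k : ℂ) := by
  rw [Dplus]
  congr 2
  funext k
  rw [shellFourier_transposeOp]
  simp only [Complex.ofReal_one, neg_mul, one_mul]
  rw [show (fun μ => -shellVec m k μ) = -shellVec m k from rfl]
  ring

lemma causalKernel_eq (m : ℝ) (p : MvPolynomial (Fin 4) ℂ) (f g : Test) :
    causalKernel m p f g = plusKernel m p f g - Dplus m g (transposeOp p f) := rfl

end SUSY
end

noncomputable section

namespace SUSY

open MeasureTheory Filter Topology MvPolynomial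
open scoped FourierTransform

/-! ### Kernels and their symbols on the mass shell -/

/-- The two-sheeted mass shell, in terms of the values of the symbols of `∂_μ`. -/
def Shell (m : ℝ) : Set (Fin 4 → ℂ) :=
  {v | ∃ k : EuclideanSpace ℝ (Fin 3), k ≠ 0 ∧ (v = shellVec m k ∨ v = -shellVec m k)}

lemma ae_ne_zero : ∀ᵐ k : EuclideanSpace ℝ (Fin 3), k ≠ 0 := by simp [ae_iff]

lemma plusKernel_congr {m : ℝ} {p q : MvPolynomial (Fin 4) ℂ}
    (h : ∀ k ≠ 0, eval (shellVec m k) p = eval (shellVec m k) q) (f g : Test) :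
    plusKernel m p f g = plusKernel m q f g := by
  rw [plusKernel_eq, plusKernel_eq]
  congr 1
  refine integral_congr_ae ?_
  filter_upwards [ae_ne_zero] with k hk
  rw [h k hk]

/-- The apex `k = 0` is a null set. It is left out of `Shell` because at `m = 0` the energy vanishes
there and the momentum has no direction. -/
lemma causalKernel_congr {m : ℝ} {p q : MvPolynomial (Fin 4) ℂ}
    (h : ∀ v ∈ Shell m, eval v p = eval v q) (f g : Test) :
    causalKernel m p f g = causalKernel m q f g := by
  rw [causalKernel_eq, causalKernel_eq, Dplus_transposeOp_right, Dplus_transposeOp_right,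
    plusKernel_congr (fun k hk => h _ ⟨k, hk, .inl rfl⟩)]
  congr 2
  refine integral_congr_ae ?_
  filter_upwards [ae_ne_zero] with k hk
  rw [h _ ⟨k, hk, .inr rfl⟩]

lemma integrable_upper (m : ℝ) (p : MvPolynomial (Fin 4) ℂ) (f g : Test) :
    Integrable (fun k => eval (shellVec m k) p *
      (shellFourier m (-1) f k * shellFourier m 1 g k) / (2 * energy m k : ℂ)) := by
  simpa using integrable_symbol m (s := -1) (t := 1) (by simp) (by simp) p f g

lemma integrable_lower (m : ℝ) (p : MvPolynomial (Fin 4) ℂ) (f g : Test) :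
    Integrable (fun k => eval (-shellVec m k) p *
      (shellFourier m 1 f k * shellFourier m (-1) g k) / (2 * energy m k : ℂ)) := by
  simpa [← Pi.neg_def] using integrable_symbol m (s := 1) (t := -1) (by simp) (by simp) p f g

lemma plusKernel_add (m : ℝ) (p q : MvPolynomial (Fin 4) ℂ) (f g : Test) :
    plusKernel m (p + q) f g = plusKernel m p f g + plusKernel m q f g := by
  simp only [plusKernel_eq]
  rw [← mul_add, ← integral_add (integrable_upper m p f g) (integrable_upper m q f g)]
  congr 2; funext k; rw [map_add]; ring

lemma causalKernel_add (m : ℝ) (p q : MvPolynomial (Fin 4) ℂ) (f g : Test) :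
    causalKernel m (p + q) f g = causalKernel m p f g + causalKernel m q f g := by
  simp only [causalKernel_eq, plusKernel_add, Dplus_transposeOp_right]
  have h : ∫ k, eval (-shellVec m k) (p + q) *
        (shellFourier m 1 f k * shellFourier m (-1) g k) / (2 * energy m k : ℂ) =
      (∫ k, eval (-shellVec m k) p *
        (shellFourier m 1 f k * shellFourier m (-1) g k) / (2 * energy m k : ℂ)) +
      ∫ k, eval (-shellVec m k) q *
        (shellFourier m 1 f k * shellFourier m (-1) g k) / (2 * energy m k : ℂ) := by
    rw [← integral_add (integrable_lower m p f g) (integrable_lower m q f g)]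
    congr 1; funext k; rw [map_add]; ring
  rw [h]
  ring

lemma causalKernel_C_mul (m : ℝ) (c : ℂ) (p : MvPolynomial (Fin 4) ℂ) (f g : Test) :
    causalKernel m (C c * p) f g = c * causalKernel m p f g := by
  simp only [causalKernel_eq, plusKernel_eq, Dplus_transposeOp_right, map_mul, eval_C, mul_assoc,
    mul_div_assoc, integral_const_mul]
  ring

lemma causalKernel_zero (m : ℝ) (f g : Test) : causalKernel m 0 f g = 0 := by
  have := causalKernel_C_mul m 0 0 f g
  simpa using this

lemma causalKernel_partialD_left (m : ℝ) (p : MvPolynomial (Fin 4) ℂ) (μ : Fin 4) (f g : Test) :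
    causalKernel m p (partialD μ f) g = causalKernel m (-X μ * p) f g := by
  simp only [causalKernel_eq, plusKernel_eq, Dplus_transposeOp_right]
  congr 3 <;> funext k <;> rw [shellFourier_partialD] <;> simp <;> ring

lemma causalKernel_partialD_right (m : ℝ) (p : MvPolynomial (Fin 4) ℂ) (μ : Fin 4) (f g : Test) :
    causalKernel m p f (partialD μ g) = causalKernel m (X μ * p) f g := by
  simp only [causalKernel_eq, plusKernel_eq, Dplus_transposeOp_right]
  congr 3 <;> funext k <;> rw [shellFourier_partialD] <;> simp <;> ring

lemma eval_aeval_neg (v : Fin 4 → ℂ) (p : MvPolynomial (Fin 4) ℂ) :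
    eval v (aeval (fun μ => -X μ : Fin 4 → MvPolynomial (Fin 4) ℂ) p) = eval (-v) p := by
  have := congrArg (fun φ : MvPolynomial (Fin 4) ℂ →ₐ[ℂ] ℂ => φ p)
    (MvPolynomial.comp_aeval (R := ℂ) (fun μ => -X μ : Fin 4 → MvPolynomial (Fin 4) ℂ)
      (aeval v : MvPolynomial (Fin 4) ℂ →ₐ[ℂ] ℂ))
  simpa [MvPolynomial.coe_aeval_eq_eval, ← Pi.neg_def] using this

/-- `D_m` is odd, so exchanging the arguments turns `p(∂)` into `-p(-∂)`. -/
lemma causalKernel_swap (m : ℝ) (p : MvPolynomial (Fin 4) ℂ) (f g : Test) :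
    causalKernel m p g f = -causalKernel m (aeval (fun μ => -X μ) p) f g := by
  simp only [causalKernel_eq, plusKernel_eq, Dplus_transposeOp_right, eval_aeval_neg, neg_neg]
  simp only [mul_comm (shellFourier m 1 f _), mul_comm (shellFourier m (-1) f _)]
  ring

lemma pauliJordan_eq (m : ℝ) (f g : Test) : pauliJordan m f g = causalKernel m 1 f g := by
  rw [causalKernel_eq, plusKernel_eq, Dplus_transposeOp_right, pauliJordan, Dplus, Dplus]
  simp only [map_one, one_mul]
  simp only [mul_comm (shellFourier m 1 f _)]

/-! ### Separation of points of the shell -/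

/-- The two transforms sample `𝓕 f` at positive and at negative energy. Prescribing `𝓕 f` as a bump
supported at positive energies separates the two sheets. -/
lemma exists_bump (m : ℝ) {k₀ : EuclideanSpace ℝ (Fin 3)} (hk : k₀ ≠ 0) :
    ∃ f : Test, shellFourier m (-1) f k₀ = 1 ∧ ∀ k, shellFourier m 1 f k = 0 := by
  have he := energy_pos m hk
  have hpi := Real.pi_pos
  set w : Spacetime := (1 / (2 * Real.pi)) • waveVec m k₀ with hw
  have hw0 : w 0 = energy m k₀ / (2 * Real.pi) := by
    simp [hw, waveVec]; ring
  have hw0' : 0 < w 0 := by rw [hw0]; positivity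
  -- The outer radius is the energy coordinate of the centre, so every point of non-positive energy
  -- has distance at least `w 0` and the bump vanishes there.
  let b : ContDiffBump w := ⟨w 0 / 2, w 0, by linarith, by linarith⟩
  have hc : HasCompactSupport fun x => (b x : ℂ) := b.hasCompactSupport.comp_left Complex.ofReal_zero
  have hd : ContDiff ℝ ((⊤ : ℕ∞) : WithTop ℕ∞) fun x => (b x : ℂ) :=
    Complex.ofRealCLM.contDiff.comp b.contDiff
  refine ⟨𝓕⁻ (hc.toSchwartzMap hd), ?_, fun k => ?_⟩
  · rw [shellFourier_eq, FourierTransform.fourier_fourierInv_eq]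
    have : -(-1 / (2 * Real.pi)) • waveVec m k₀ = w := by rw [hw]; congr 1; ring
    rw [this]
    have hb : b w = 1 := b.one_of_mem_closedBall (Metric.mem_closedBall_self (by
      change (0 : ℝ) ≤ w 0 / 2; linarith))
    simp [hb]
  · rw [shellFourier_eq, FourierTransform.fourier_fourierInv_eq]
    have hb : b (-(1 / (2 * Real.pi)) • waveVec m k) = 0 := by
      refine b.zero_of_le_dist ?_
      change w 0 ≤ _
      rw [dist_comm, dist_eq_norm]
      refine le_trans ?_ (PiLp.norm_apply_le (w - -(1 / (2 * Real.pi)) • waveVec m k) 0)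
      have : (w - -(1 / (2 * Real.pi)) • waveVec m k) 0 = w 0 + energy m k / (2 * Real.pi) := by
        simp [waveVec]; ring
      rw [this]
      refine le_trans ?_ (le_abs_self _)
      have := energy_nonneg m k
      have : 0 ≤ energy m k / (2 * Real.pi) := by positivity
      linarith
    rw [HasCompactSupport.toSchwartzMap_toFun, hb, Complex.ofReal_zero]

/-- A weighted integral of a square over the shell that vanishes has vanishing integrand. -/
lemma eq_zero_of_integral_shell {m : ℝ} {h : EuclideanSpace ℝ (Fin 3) → ℂ} (hc : Continuous h)
    (hi : Integrable fun k => h k * (starRingEnd ℂ) (h k) / (2 * energy m k : ℂ))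
    (h0 : ∫ k, h k * (starRingEnd ℂ) (h k) / (2 * energy m k : ℂ) = 0) (k : EuclideanSpace ℝ (Fin 3)) :
    h k = 0 := by
  have e : (fun k => h k * (starRingEnd ℂ) (h k) / (2 * energy m k : ℂ)) =
      fun k => ((Complex.normSq (h k) / (2 * energy m k) : ℝ) : ℂ) := by
    funext k
    rw [Complex.mul_conj]; push_cast; rfl
  rw [e] at hi h0
  rw [integral_complex_ofReal, Complex.ofReal_eq_zero, integral_eq_zero_iff_of_nonneg] at h0
  · have hz : h =ᵐ[volume] fun _ => 0 := by
      filter_upwards [h0, ae_ne_zero] with k h1 h2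
      have := energy_pos m h2
      simpa [this.ne'] using h1
    have := (Continuous.ae_eq_iff_eq volume hc continuous_const).1 hz
    exact congrFun this k
  · intro k
    have := energy_nonneg m k
    have := Complex.normSq_nonneg (h k)
    simp only [Pi.zero_apply]
    positivity
  · exact hi.re

@[fun_prop]
lemma continuous_eval_shellVec (m : ℝ) (p : MvPolynomial (Fin 4) ℂ) :
    Continuous fun k => eval (shellVec m k) p :=
  (MvPolynomial.continuous_eval p).comp (continuous_shellVec m)

/-- Once the lower sheet has been switched off, the kernel can be made the weighted integral of `|p
f̂|²` by the choice of the second test function. -/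
lemma eval_upper_eq_zero {m : ℝ} {p : MvPolynomial (Fin 4) ℂ}
    (h : ∀ f g, causalKernel m p f g = 0) {k₀ : EuclideanSpace ℝ (Fin 3)} (hk : k₀ ≠ 0) :
    eval (shellVec m k₀) p = 0 := by
  obtain ⟨f, hf0, hf1⟩ := exists_bump m hk
  -- With this second argument its transform is the complex conjugate of `p f̂` on the upper sheet.
  have h1 := h f (conjTest (transposeOp p f))
  rw [causalKernel_eq, Dplus_transposeOp_right, plusKernel_eq] at h1
  simp only [hf1, zero_mul, mul_zero, zero_div, integral_zero, sub_zero, mul_eq_zero] at h1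
  have hpi : (Real.pi : ℂ) ≠ 0 := by exact_mod_cast Real.pi_ne_zero
  replace h1 := h1.resolve_left (by
    rw [div_eq_zero_iff]; push Not; exact ⟨Complex.I_ne_zero, pow_ne_zero _ (mul_ne_zero two_ne_zero hpi)⟩)
  have h2 := integrable_upper m p f (conjTest (transposeOp p f))
  simp only [shellFourier_conjTest, shellFourier_transposeOp, Complex.ofReal_neg, Complex.ofReal_one,
    neg_neg, one_mul, ← mul_assoc] at h1 h2
  have h3 := eq_zero_of_integral_shell (m := m)
    (h := fun k => eval (shellVec m k) p * shellFourier m (-1) f k) (by fun_prop) h2 h1 k₀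
  simpa [hf0] using h3

/-- Exchanging the arguments maps the lower sheet to the upper one, so both sheets are covered. This
converse of `causalKernel_congr` is what makes symbols unique. -/
lemma eval_eq_zero_of_causalKernel {m : ℝ} {p : MvPolynomial (Fin 4) ℂ}
    (h : ∀ f g, causalKernel m p f g = 0) : ∀ v ∈ Shell m, eval v p = 0 := by
  rintro v ⟨k, hk, rfl | rfl⟩
  · exact eval_upper_eq_zero h hk
  · have h' : ∀ f g, causalKernel m (aeval (fun μ => -X μ) p) f g = 0 := fun f g => by
      have := causalKernel_swap m p f g
      rw [h g f] at this
      simpa using this.symm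
    have := eval_upper_eq_zero h' hk
    rwa [eval_aeval_neg] at this

lemma Shell.neg_mem {m : ℝ} {v : Fin 4 → ℂ} (hv : v ∈ Shell m) : -v ∈ Shell m := by
  obtain ⟨k, hk, rfl | rfl⟩ := hv
  · exact ⟨k, hk, .inr rfl⟩
  · exact ⟨k, hk, .inl (neg_neg _)⟩

/-- The points are `v = ∓i k`, so squares change sign and the mass enters as `-m²`: this is `∂² =
-m²`. -/
lemma Shell.sq {m : ℝ} {v : Fin 4 → ℂ} (hv : v ∈ Shell m) :
    v 0 ^ 2 = v 1 ^ 2 + v 2 ^ 2 + v 3 ^ 2 - m ^ 2 := by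
  obtain ⟨k, hk, rfl | rfl⟩ := hv
  all_goals
    have := congrArg (fun x : ℝ => (x : ℂ)) (energy_sq m k)
    push_cast at this
    simp [shellVec, waveVec, mul_pow, this]
    ring

lemma Shell.zero_ne {m : ℝ} {v : Fin 4 → ℂ} (hv : v ∈ Shell m) : v 0 ≠ 0 := by
  obtain ⟨k, hk, rfl | rfl⟩ := hv
  all_goals
    have := (energy_pos m hk).ne'
    simpa [shellVec, waveVec] using this

lemma Shell.nonempty (m : ℝ) : (Shell m).Nonempty :=
  ⟨shellVec m (EuclideanSpace.single 0 1), _, by simp, .inl rfl⟩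

end SUSY
end

noncomputable section

namespace SUSY

open MvPolynomial

/-! ### Brackets with numerical kernels -/

section Symbols

variable {𝒜 : Type*} [Ring 𝒜] [Algebra ℂ 𝒜]

/-- The bracket `φ(f) ψ(g) + η ψ(g) φ(f)`: a commutator for `η = -1`, an anticommutator for
`η = 1`. -/
def brk (η : ℂ) (φ ψ : Test →ₗ[ℂ] 𝒜) (f g : Test) : 𝒜 := φ f * ψ g + η • (ψ g * φ f)

lemma brk_neg_one (φ ψ : Test →ₗ[ℂ] 𝒜) (f g : Test) : brk (-1) φ ψ f g = comm (φ f) (ψ g) := by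
  simp [brk, comm, sub_eq_add_neg]

lemma brk_one (φ ψ : Test →ₗ[ℂ] 𝒜) (f g : Test) : brk 1 φ ψ f g = acomm (φ f) (ψ g) := by
  simp [brk, acomm]

/-- The bracket of `φ` and `ψ` is `(p(∂) D_m)(x - y)` for a polynomial `p` that agrees with `s` on
the mass shell. -/
def HasSymbol (m : ℝ) (η : ℂ) (φ ψ : Test →ₗ[ℂ] 𝒜) (s : (Fin 4 → ℂ) → ℂ) : Prop :=
  ∃ p : MvPolynomial (Fin 4) ℂ, (∀ v ∈ Shell m, eval v p = s v) ∧
    ∀ f g, brk η φ ψ f g = algebraMap ℂ 𝒜 (causalKernel m p f g)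

variable {m : ℝ} {η : ℂ} {φ φ' ψ ψ' : Test →ₗ[ℂ] 𝒜} {s t : (Fin 4 → ℂ) → ℂ}

lemma HasSymbol.congr (h : HasSymbol m η φ ψ s) (hst : ∀ v ∈ Shell m, s v = t v) :
    HasSymbol m η φ ψ t := by
  obtain ⟨p, hp, hb⟩ := h
  exact ⟨p, fun v hv => (hp v hv).trans (hst v hv), hb⟩

lemma HasSymbol.kernel (h : HasSymbol m η φ ψ s) {p : MvPolynomial (Fin 4) ℂ}
    (hp : ∀ v ∈ Shell m, s v = eval v p) (f g : Test) :
    brk η φ ψ f g = algebraMap ℂ 𝒜 (causalKernel m p f g) := by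
  obtain ⟨q, hq, hb⟩ := h
  rw [hb, causalKernel_congr fun v hv => (hq v hv).trans (hp v hv)]

lemma HasSymbol.of_zero (h : ∀ f g, brk η φ ψ f g = 0) : HasSymbol m η φ ψ 0 :=
  ⟨0, by simp, fun f g => by rw [h, causalKernel_zero, map_zero]⟩

lemma HasSymbol.add_left (h : HasSymbol m η φ ψ s) (h' : HasSymbol m η φ' ψ t) :
    HasSymbol m η (φ + φ') ψ (fun v => s v + t v) := by
  obtain ⟨p, hp, hb⟩ := h
  obtain ⟨q, hq, hc⟩ := h'
  refine ⟨p + q, fun v hv => by rw [map_add, hp v hv, hq v hv], fun f g => ?_⟩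
  rw [causalKernel_add, map_add, ← hb, ← hc]
  simp only [brk, LinearMap.add_apply, add_mul, mul_add, smul_add]
  abel

lemma HasSymbol.add_right (h : HasSymbol m η φ ψ s) (h' : HasSymbol m η φ ψ' t) :
    HasSymbol m η φ (ψ + ψ') (fun v => s v + t v) := by
  obtain ⟨p, hp, hb⟩ := h
  obtain ⟨q, hq, hc⟩ := h'
  refine ⟨p + q, fun v hv => by rw [map_add, hp v hv, hq v hv], fun f g => ?_⟩
  rw [causalKernel_add, map_add, ← hb, ← hc]
  simp only [brk, LinearMap.add_apply, add_mul, mul_add, smul_add]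
  abel

lemma HasSymbol.smul_left (h : HasSymbol m η φ ψ s) (c : ℂ) :
    HasSymbol m η (c • φ) ψ (fun v => c * s v) := by
  obtain ⟨p, hp, hb⟩ := h
  refine ⟨C c * p, fun v hv => by rw [map_mul, eval_C, hp v hv], fun f g => ?_⟩
  rw [causalKernel_C_mul, map_mul, ← hb, ← Algebra.smul_def]
  simp only [brk, LinearMap.smul_apply, smul_mul_assoc, mul_smul_comm, smul_add, smul_comm c]

lemma HasSymbol.smul_right (h : HasSymbol m η φ ψ s) (c : ℂ) :
    HasSymbol m η φ (c • ψ) (fun v => c * s v) := by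
  obtain ⟨p, hp, hb⟩ := h
  refine ⟨C c * p, fun v hv => by rw [map_mul, eval_C, hp v hv], fun f g => ?_⟩
  rw [causalKernel_C_mul, map_mul, ← hb, ← Algebra.smul_def]
  simp only [brk, LinearMap.smul_apply, smul_mul_assoc, mul_smul_comm, smul_add, smul_comm c]

lemma HasSymbol.zero_left : HasSymbol m η (0 : Test →ₗ[ℂ] 𝒜) ψ 0 := .of_zero (by simp [brk])

lemma HasSymbol.zero_right : HasSymbol m η φ (0 : Test →ₗ[ℂ] 𝒜) 0 := .of_zero (by simp [brk])

lemma HasSymbol.sum_left {ι : Type*} {I : Finset ι} {φ : ι → Test →ₗ[ℂ] 𝒜}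
    {s : ι → (Fin 4 → ℂ) → ℂ} (h : ∀ i ∈ I, HasSymbol m η (φ i) ψ (s i)) :
    HasSymbol m η (∑ i ∈ I, φ i) ψ (fun v => ∑ i ∈ I, s i v) := by
  classical
  induction I using Finset.induction_on with
  | empty => simpa [Pi.zero_def] using HasSymbol.zero_left (𝒜 := 𝒜)
  | insert a I ha ih =>
    simp only [Finset.sum_insert ha]
    exact (h a (by simp)).add_left (ih fun i hi => h i (by simp [hi]))

lemma HasSymbol.sum_right {ι : Type*} {I : Finset ι} {ψ : ι → Test →ₗ[ℂ] 𝒜}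
    {s : ι → (Fin 4 → ℂ) → ℂ} (h : ∀ i ∈ I, HasSymbol m η φ (ψ i) (s i)) :
    HasSymbol m η φ (∑ i ∈ I, ψ i) (fun v => ∑ i ∈ I, s i v) := by
  classical
  induction I using Finset.induction_on with
  | empty => simpa [Pi.zero_def] using HasSymbol.zero_right (𝒜 := 𝒜)
  | insert a I ha ih =>
    simp only [Finset.sum_insert ha]
    exact (h a (by simp)).add_right (ih fun i hi => h i (by simp [hi]))

lemma HasSymbol.dField_left (h : HasSymbol m η φ ψ s) (μ : Fin 4) :
    HasSymbol m η (dField μ φ) ψ (fun v => v μ * s v) := by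
  obtain ⟨p, hp, hb⟩ := h
  refine ⟨X μ * p, fun v hv => by rw [map_mul, eval_X, hp v hv], fun f g => ?_⟩
  have h1 : brk η (dField μ φ) ψ f g = -brk η φ ψ (partialD μ f) g := by
    simp [brk, dField, add_comm]
  have h2 : causalKernel m (X μ * p) f g = -causalKernel m p (partialD μ f) g := by
    have := causalKernel_C_mul m (-1) (X μ * p) f g
    rw [causalKernel_partialD_left, show -X μ * p = C (-1) * (X μ * p) by simp]
    rw [this]; ring
  rw [h1, h2, hb, map_neg]

/-- The kernel depends on `x - y`, so a derivative in `y` is minus the derivative in `x`. -/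
lemma HasSymbol.dField_right (h : HasSymbol m η φ ψ s) (μ : Fin 4) :
    HasSymbol m η φ (dField μ ψ) (fun v => -v μ * s v) := by
  obtain ⟨p, hp, hb⟩ := h
  refine ⟨-X μ * p, fun v hv => by rw [map_mul, map_neg, eval_X, hp v hv], fun f g => ?_⟩
  have h1 : brk η φ (dField μ ψ) f g = -brk η φ ψ f (partialD μ g) := by
    simp [brk, dField, add_comm]
  have h2 : causalKernel m (-X μ * p) f g = -causalKernel m p f (partialD μ g) := by
    have := causalKernel_C_mul m (-1) (X μ * p) f g
    rw [causalKernel_partialD_right, show -X μ * p = C (-1) * (X μ * p) by simp]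
    rw [this]; ring
  rw [h1, h2, hb, map_neg]

/-- The sign combines the (anti)symmetry `η` of the bracket with the oddness of `D_m`. -/
lemma HasSymbol.swap (h : HasSymbol m η φ ψ s) (hη : η * η = 1) :
    HasSymbol m η ψ φ (fun v => -η * s (-v)) := by
  obtain ⟨p, hp, hb⟩ := h
  refine ⟨C (-η) * aeval (fun μ => -X μ) p, fun v hv => by
    rw [map_mul, eval_C, eval_aeval_neg, hp _ (Shell.neg_mem hv)], fun f g => ?_⟩
  have h1 : brk η ψ φ f g = η • brk η φ ψ g f := by
    simp [brk, smul_smul, hη, add_comm]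
  rw [h1, hb, causalKernel_C_mul, causalKernel_swap, Algebra.smul_def, ← map_mul]
  congr 1
  ring

variable [Nontrivial 𝒜]

/-- A linear relation between two brackets gives one between their symbols. -/
lemma HasSymbol.add_eq_zero {η' : ℂ} (h : HasSymbol m η φ ψ s) (h' : HasSymbol m η' φ' ψ' t)
    (H : ∀ f g, brk η φ ψ f g + brk η' φ' ψ' f g = 0) {v : Fin 4 → ℂ} (hv : v ∈ Shell m) :
    s v + t v = 0 := by
  obtain ⟨p, hp, hb⟩ := h
  obtain ⟨q, hq, hc⟩ := h'
  rw [← hp v hv, ← hq v hv, ← map_add]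
  refine eval_eq_zero_of_causalKernel (fun f g => ?_) v hv
  have := H f g
  rw [hb, hc, ← map_add] at this
  rw [causalKernel_add]
  exact (algebraMap ℂ 𝒜).injective (by simpa using this)

lemma HasSymbol.unique (h : HasSymbol m η φ ψ s) (h' : HasSymbol m η φ ψ t)
    {v : Fin 4 → ℂ} (hv : v ∈ Shell m) : s v = t v := by
  have := h.add_eq_zero (h'.smul_left (-1)) (fun f g => by simp [brk]; abel) hv
  linear_combination this

end Symbols

section Jacobi

variable {𝒜 : Type*} [Ring 𝒜]

/-- The graded Jacobi identity for an odd `q`, an even `b` and an odd `x` that commute. -/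
lemma acomm_comm_add_comm_acomm {q b x : 𝒜} (h : comm b x = 0) :
    acomm (comm q b) x + comm b (acomm q x) = 0 := by
  have h' : b * x = x * b := sub_eq_zero.1 h
  have e : acomm (comm q b) x + comm b (acomm q x) =
      q * (b * x - x * b) + (b * x - x * b) * q := by
    simp only [acomm, comm]; noncomm_ring
  rw [e, h']; simp

end Jacobi

end SUSY
end

noncomputable section

namespace SUSY

open MvPolynomial

/-! ### Adjoint fields -/

section StarRing

variable {𝒜 : Type*} [Ring 𝒜] [StarRing 𝒜]

lemma star_comm (x y : 𝒜) : star (comm x y) = -comm (star x) (star y) := by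
  simp [comm]

lemma star_acomm (x y : 𝒜) : star (acomm x y) = acomm (star x) (star y) := by
  simp [acomm, add_comm]

lemma star_mul_comm_mul (u : unitary 𝒜) (x y : 𝒜) :
    star (u : 𝒜) * comm x y * u = comm (star (u : 𝒜) * x * u) (star (u : 𝒜) * y * u) := by
  have h : ∀ a b : 𝒜, star (u : 𝒜) * a * u * (star (u : 𝒜) * b * u) = star (u : 𝒜) * (a * b) * u :=
    fun a b => by
      rw [show star (u : 𝒜) * a * u * (star (u : 𝒜) * b * u) =
        star (u : 𝒜) * a * (u * star (u : 𝒜)) * b * u by noncomm_ring, Unitary.mul_star_self_of_mem u.2]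
      noncomm_ring
  simp only [comm, h, mul_sub, sub_mul]

lemma star_mul_algebraMap_mul [Algebra ℂ 𝒜] (u : unitary 𝒜) (c : ℂ) :
    star (u : 𝒜) * algebraMap ℂ 𝒜 c * u = algebraMap ℂ 𝒜 c := by
  rw [mul_assoc, Algebra.commutes, ← mul_assoc, Unitary.star_mul_self_of_mem u.2, one_mul]

end StarRing

section Adjoint

variable {𝒜 : Type*} [Ring 𝒜] [StarRing 𝒜] [Algebra ℂ 𝒜] [StarModule ℂ 𝒜]

lemma conjTest_conjTest (f : Test) : conjTest (conjTest f) = f := by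
  ext x; simp [conjTest_apply]

lemma adj_apply (φ : Test →ₗ[ℂ] 𝒜) (f : Test) : adj φ f = star (φ (conjTest f)) := rfl

lemma adj_adj (φ : Test →ₗ[ℂ] 𝒜) : adj (adj φ) = φ := by
  ext f; simp [adj_apply, conjTest_conjTest]

lemma adj_add (φ ψ : Test →ₗ[ℂ] 𝒜) : adj (φ + ψ) = adj φ + adj ψ := by
  ext f; simp [adj_apply]

lemma adj_sub (φ ψ : Test →ₗ[ℂ] 𝒜) : adj (φ - ψ) = adj φ - adj ψ := by
  ext f; simp [adj_apply]

lemma adj_smul (c : ℂ) (φ : Test →ₗ[ℂ] 𝒜) : adj (c • φ) = (starRingEnd ℂ c) • adj φ := by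
  ext f; simp [adj_apply]

lemma adj_sum {ι : Type*} (I : Finset ι) (φ : ι → Test →ₗ[ℂ] 𝒜) :
    adj (∑ i ∈ I, φ i) = ∑ i ∈ I, adj (φ i) := by
  ext f; simp [adj_apply]

lemma conjTest_partialD (μ : Fin 4) (f : Test) :
    conjTest (partialD μ f) = partialD μ (conjTest f) := by
  ext x
  change (starRingEnd ℂ) ((LineDeriv.lineDerivOp (EuclideanSpace.single μ (1 : ℝ)) f : Test) x) =
    (LineDeriv.lineDerivOp (EuclideanSpace.single μ (1 : ℝ)) (conjTest f) : Test) x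
  rw [SchwartzMap.lineDerivOp_apply_eq_fderiv, SchwartzMap.lineDerivOp_apply_eq_fderiv]
  have h := (Complex.conjCLE.toContinuousLinearMap.hasFDerivAt.comp x
    f.differentiableAt.hasFDerivAt).fderiv
  exact (congrArg (fun L => L (EuclideanSpace.single μ (1 : ℝ))) h).symm

lemma adj_dField (μ : Fin 4) (φ : Test →ₗ[ℂ] 𝒜) : adj (dField μ φ) = dField μ (adj φ) := by
  ext f; simp [adj_apply, dField, conjTest_partialD]

lemma conj_gdiag (μ : Fin 4) : (starRingEnd ℂ) (gdiag μ) = gdiag μ := by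
  fin_cases μ <;> simp [gdiag]

lemma conj_epsL (a b : Fin 2) : (starRingEnd ℂ) (epsL a b) = epsL a b := by
  fin_cases a <;> fin_cases b <;> simp [epsL]

lemma conj_epsU (a b : Fin 2) : (starRingEnd ℂ) (epsU a b) = epsU a b := by
  rw [epsU, map_neg, conj_epsL]

lemma conj_kd (a b : Fin 2) : (starRingEnd ℂ) (kd a b) = kd a b := by
  unfold kd; split_ifs <;> simp

lemma conj_pauli (μ : Fin 4) (a b : Fin 2) : (starRingEnd ℂ) (pauli μ a b) = pauli μ b a := by
  fin_cases μ <;> fin_cases a <;> fin_cases b <;> simp [pauli]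

lemma adj_dFieldUp (μ : Fin 4) (φ : Test →ₗ[ℂ] 𝒜) : adj (dFieldUp μ φ) = dFieldUp μ (adj φ) := by
  rw [dFieldUp, adj_smul, adj_dField, conj_gdiag, dFieldUp]

lemma adj_raise (ψ : Fin 2 → Test →ₗ[ℂ] 𝒜) (b : Fin 2) :
    adj (raise ψ b) = raise (fun c => adj (ψ c)) b := by
  simp only [raise, adj_sum, adj_smul, conj_epsU]

end Adjoint

namespace ReducedMultiplet

variable {𝒜 : Type*} [Ring 𝒜] [StarRing 𝒜] [Algebra ℂ 𝒜] [StarModule ℂ 𝒜] {m : ℝ}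
  (M : ReducedMultiplet m 𝒜)

/-- The self-dual part `F_{ab} = -2i σ^{μν}_{ab} F_{μν}`. -/
abbrev Fab (a b : Fin 2) : Test →ₗ[ℂ] 𝒜 := M.fullField (.F a b)

lemma Fab_eq (a b : Fin 2) :
    M.Fab a b = (-2 * Complex.I) • ∑ μ, ∑ ν, sigma2 μ ν a b • M.F μ ν := rfl

lemma adj_chiBar (j a : Fin 2) : adj (M.chiBar j a) = M.chi j a := adj_adj _

lemma adj_Fup (μ ν : Fin 4) : adj (M.Fup μ ν) = M.Fup μ ν := by
  rw [FieldContent.Fup, adj_smul, map_mul, conj_gdiag, conj_gdiag, M.F_real]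

lemma acomm_Q_chi (j a k b : Fin 2) (f : Test) :
    acomm (M.Q j a) (M.chi k b f) = (epsL j k • M.Fab a b + epsL a b • M.C j k) f := by
  rw [M.Q_chi, Fab_eq]
  simp only [LinearMap.add_apply, LinearMap.smul_apply, LinearMap.sum_apply, smul_smul]
  congr 2
  ring

/-- The field `[Q̄_{j ā}, φ]` (or the anticommutator) for the adjoint field. -/
lemma acomm_Qbar_chi (j a k b : Fin 2) (f : Test) :
    acomm (star (M.Q j a)) (M.chi k b f) =
      ((2 * kd j k) • ∑ μ, pauli μ b a • dField μ M.z) f := by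
  have h := congrArg star (M.Q_chiBar j a k b (conjTest f))
  rw [star_acomm, ← adj_apply, M.adj_chiBar] at h
  have e : (2 * kd j k) • ∑ μ, pauli μ a b • dField μ (adj M.z) (conjTest f) =
      ((2 * kd j k) • ∑ μ, pauli μ a b • dField μ (adj M.z)) (conjTest f) := by
    simp
  rw [h, e, ← adj_apply]
  simp only [adj_smul, adj_sum, adj_dField, adj_adj, conj_pauli, map_mul, conj_kd, map_ofNat]

lemma acomm_Qbar_chiBar (j a k b : Fin 2) (f : Test) :
    acomm (star (M.Q j a)) (M.chiBar k b f) =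
      (epsL j k • adj (M.Fab a b) + epsL a b • adj (M.C j k)) f := by
  have h := congrArg star (M.acomm_Q_chi j a k b (conjTest f))
  rw [star_acomm, ← adj_apply, ← adj_apply] at h
  rw [FieldContent.chiBar, h, adj_add, adj_smul, adj_smul, conj_epsL, conj_epsL]

/-- `[Q_{ja}, F^{μν}]` as a field. -/
def dF (χ : Fin 2 → Fin 2 → Test →ₗ[ℂ] 𝒜) (σ : Fin 4 → Matrix (Fin 2) (Fin 2) ℂ) (j a : Fin 2)
    (μ ν : Fin 4) : Test →ₗ[ℂ] 𝒜 :=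
  ∑ k, (Complex.I / 2 * epsL j k) • ∑ b,
      (σ μ a b • dFieldUp ν (raise (χ k) b) - σ ν a b • dFieldUp μ (raise (χ k) b))

lemma comm_Q_F (j a : Fin 2) (μ ν : Fin 4) (f : Test) :
    comm (M.Q j a) (M.Fup μ ν f) = dF M.chiBar pauli j a μ ν f := by
  rw [M.Q_F]
  simp [dF]

/-- Adjoint of `comm_Q_F`, with `F` real. The sign from reversing a commutator cancels the one from
conjugating `i`, and conjugation transposes the Pauli matrices. -/
lemma comm_Qbar_F (j a : Fin 2) (μ ν : Fin 4) (f : Test) :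
    comm (star (M.Q j a)) (M.Fup μ ν f) =
      dF M.chi (fun μ => (pauli μ).transpose) j a μ ν f := by
  have h := congrArg star (M.comm_Q_F j a μ ν (conjTest f))
  rw [star_comm, ← adj_apply, ← adj_apply, M.adj_Fup, neg_eq_iff_eq_neg] at h
  rw [h, ← LinearMap.neg_apply]
  congr 1
  simp only [dF, adj_sum, adj_smul, adj_sub, adj_dFieldUp, adj_raise, adj_chiBar, conj_pauli,
    map_mul, map_div₀, Complex.conj_I, conj_epsL, map_ofNat, Matrix.transpose_apply,
    ← Finset.sum_neg_distrib]
  refine Finset.sum_congr rfl fun k _ => ?_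
  have e : -Complex.I / 2 * epsL j k = -(Complex.I / 2 * epsL j k) := by ring
  ext g
  simp only [e, LinearMap.neg_apply, LinearMap.smul_apply, neg_smul, neg_neg]

/-- `[Q_{ja}, C_{kl}]` as a field. -/
lemma comm_Q_C (j a k l : Fin 2) (f : Test) :
    comm (M.Q j a) (M.C k l f) = (-Complex.I • ∑ μ, ∑ b, pauli μ a b • ∑ n,
      (epsL j k * epsL l n + epsL j l * epsL k n) • dField μ (raise (M.chiBar n) b)) f := by
  rw [M.Q_C]
  simp

lemma mixed_comm {I J : Comp} (hI : ¬I.IsFermi) (hJ : J.IsFermi) (f g : Test) :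
    comm (M.field I f) (M.field J g) = 0 := M.causal_mixed I J hI hJ f g

/-! ### Consequences of `SU(2)` covariance -/

/-- Rotations by `π` about the third and second axes in isospin space. -/
def isoFlip₃ : Matrix.specialUnitaryGroup (Fin 2) ℂ :=
  ⟨!![Complex.I, 0; 0, -Complex.I], by
    rw [Matrix.mem_specialUnitaryGroup_iff, Matrix.mem_unitaryGroup_iff]
    refine ⟨?_, by simp [Matrix.det_fin_two]⟩
    ext i j; fin_cases i <;> fin_cases j <;> 
      simp [Matrix.star_eq_conjTranspose, Matrix.mul_apply]⟩

def isoFlip₂ : Matrix.specialUnitaryGroup (Fin 2) ℂ :=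
  ⟨!![0, 1; -1, 0], by
    rw [Matrix.mem_specialUnitaryGroup_iff, Matrix.mem_unitaryGroup_iff]
    refine ⟨?_, by simp [Matrix.det_fin_two]⟩
    ext i j; fin_cases i <;> fin_cases j <;> 
      simp [Matrix.star_eq_conjTranspose, Matrix.mul_apply]⟩

/-- A triplet has vanishing numerical commutators with a singlet. -/
lemma comm_C_singlet (ψ : Test →ₗ[ℂ] 𝒜)
    (hψ : ∀ B g, star (M.V B : 𝒜) * ψ g * (M.V B : 𝒜) = ψ g)
    (hc : ∀ j k f g, ∃ c : ℂ, comm (M.C j k f) (ψ g) = algebraMap ℂ 𝒜 c)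
    (j k : Fin 2) (f g : Test) : comm (M.C j k f) (ψ g) = 0 := by
  -- The commutator is a number, hence unchanged by conjugation with the unitary `V B`, while `C`
  -- transforms as a tensor.
  have key : ∀ B : Matrix.specialUnitaryGroup (Fin 2) ℂ, comm (M.C j k f) (ψ g) =
      ∑ l, ∑ n, (B.1 j l * B.1 k n) • comm (M.C l n f) (ψ g) := by
    intro B
    obtain ⟨c, h⟩ := hc j k f g
    have h1 := star_mul_comm_mul (M.V B) (M.C j k f) (ψ g)
    rw [h, star_mul_algebraMap_mul, ← h, hψ, M.su2_C] at h1
    rw [h1]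
    simp only [comm, Finset.sum_mul, Finset.mul_sum, ← Finset.sum_sub_distrib, smul_mul_assoc,
      mul_smul_comm, smul_sub]
  -- The diagonal element reverses the sign of `C 0 0` and `C 1 1`. The other one sends `C 0 1` to
  -- `-C 1 0 = -C 0 1`, which settles the off-diagonal components.
  have h3 := key isoFlip₃
  have h2 := key isoFlip₂
  have two : ∀ x : 𝒜, x = -x → x = 0 := fun x hx => by
    have : (2 : ℂ) • x = 0 := by rw [two_smul]; nth_rewrite 1 [hx]; simp
    simpa using this
  have hs : M.C 1 0 = M.C 0 1 := M.C_symm 1 0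
  fin_cases j <;> fin_cases k <;> simp [isoFlip₃, isoFlip₂, hs] at h2 h3 <;>
    first | exact two _ h3 | (simp only [Fin.mk_one, Fin.zero_eta, hs]; exact two _ h2)

end ReducedMultiplet

end SUSY
end

noncomputable section

namespace SUSY

open MvPolynomial MeasureTheory
open scoped FourierTransform

/-! ### Rotations by `π` about the direction of the momentum -/

/-- The matrix `2 n_i n_j - δ_{ij}` of the rotation by `π` about the unit vector `n`, extended to
spacetime. -/
def flipMat (n : Fin 3 → ℝ) : Matrix (Fin 4) (Fin 4) ℝ :=
  !![1, 0, 0, 0;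
     0, 2 * n 0 * n 0 - 1, 2 * n 0 * n 1, 2 * n 0 * n 2;
     0, 2 * n 1 * n 0, 2 * n 1 * n 1 - 1, 2 * n 1 * n 2;
     0, 2 * n 2 * n 0, 2 * n 2 * n 1, 2 * n 2 * n 2 - 1]

/-- The element `i n·σ` of `SL(2,ℂ)`. -/
def flipSL (n : Fin 3 → ℝ) (hn : n 0 ^ 2 + n 1 ^ 2 + n 2 ^ 2 = 1) :
    Matrix.SpecialLinearGroup (Fin 2) ℂ :=
  ⟨!![Complex.I * n 2, Complex.I * n 0 + n 1; Complex.I * n 0 - n 1, -(Complex.I * n 2)], by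
    have h : (n 0 : ℂ) ^ 2 + n 1 ^ 2 + n 2 ^ 2 = 1 := by exact_mod_cast hn
    rw [Matrix.det_fin_two_of]
    linear_combination h + (-(n 2 : ℂ) ^ 2 - (n 0 : ℂ) ^ 2) * Complex.I_sq⟩

variable {n : Fin 3 → ℝ}

lemma lorentz_flipSL (hn : n 0 ^ 2 + n 1 ^ 2 + n 2 ^ 2 = 1) :
    lorentz (flipSL n hn) = flipMat n := by
  ext μ ν
  fin_cases μ <;> fin_cases ν <;>
    simp [lorentz, flipSL, flipMat, gdiag, pauli, Matrix.trace_fin_two, Matrix.mul_apply,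
      Fin.sum_univ_two] <;> nlinarith [hn]

/-- The inverse of `i n·σ` is its negative, and `Λ(A)` is quadratic in `A`, so the sign drops out.
-/
lemma lorentz_flipSL_inv (hn : n 0 ^ 2 + n 1 ^ 2 + n 2 ^ 2 = 1) :
    lorentz (flipSL n hn)⁻¹ = flipMat n := by
  rw [← lorentz_flipSL hn]
  have h : ((flipSL n hn)⁻¹).1 = -(flipSL n hn).1 := by
    rw [Matrix.SpecialLinearGroup.coe_inv, Matrix.adjugate_fin_two]
    ext i j
    fin_cases i <;> fin_cases j <;> simp [flipSL]
  ext μ ν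
  simp [lorentz, h]

/-- Reflection of spacetime that fixes the time axis and the line through `n`. -/
def flip4 (n : Fin 3 → ℝ) : Spacetime ≃ₗᵢ[ℝ] Spacetime :=
  -- The first reflection fixes only the line through `n` and so also reverses time; the second
  -- restores it. The form of a linear isometry lets the Fourier transform commute with it.
  (Submodule.reflection (ℝ ∙ (!₂[0, n 0, n 1, n 2] : Spacetime))).trans
    (Submodule.reflection (ℝ ∙ (!₂[1, 0, 0, 0] : Spacetime))ᗮ)

/-- The rotation of space by `π` about `n`. -/
def flip3 (n : Fin 3 → ℝ) : EuclideanSpace ℝ (Fin 3) ≃ₗᵢ[ℝ] EuclideanSpace ℝ (Fin 3) :=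
  Submodule.reflection (ℝ ∙ (!₂[n 0, n 1, n 2] : EuclideanSpace ℝ (Fin 3)))

lemma flip4_apply (hn : n 0 ^ 2 + n 1 ^ 2 + n 2 ^ 2 = 1) (x : Spacetime) (μ : Fin 4) :
    flip4 n x μ = ∑ ν, flipMat n μ ν * x ν := by
  have h1 : ‖(!₂[0, n 0, n 1, n 2] : Spacetime)‖ ^ 2 = 1 := by
    rw [EuclideanSpace.norm_sq_eq, Fin.sum_univ_four]
    simpa using hn
  have h2 : ‖(!₂[1, 0, 0, 0] : Spacetime)‖ ^ 2 = 1 := by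
    rw [EuclideanSpace.norm_sq_eq, Fin.sum_univ_four]
    simp
  rw [flip4, LinearIsometryEquiv.trans_apply, Submodule.reflection_orthogonal_apply,
    Submodule.reflection_singleton_apply, Submodule.reflection_singleton_apply]
  simp only [RCLike.ofReal_real_eq_id, id, h1, h2]
  fin_cases μ <;> simp [flipMat, Fin.sum_univ_four, PiLp.inner_apply] <;> ring

lemma flip3_apply (hn : n 0 ^ 2 + n 1 ^ 2 + n 2 ^ 2 = 1) (x : EuclideanSpace ℝ (Fin 3)) (i : Fin 3) :
    flip3 n x i = 2 * (n 0 * x 0 + n 1 * x 1 + n 2 * x 2) * n i - x i := by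
  have h1 : ‖(!₂[n 0, n 1, n 2] : EuclideanSpace ℝ (Fin 3))‖ ^ 2 = 1 := by
    rw [EuclideanSpace.norm_sq_eq, Fin.sum_univ_three]
    simpa using hn
  rw [flip3, Submodule.reflection_singleton_apply]
  simp only [RCLike.ofReal_real_eq_id, id, h1]
  fin_cases i <;> simp [Fin.sum_univ_three, PiLp.inner_apply] <;> ring

lemma lorentzAct_flipSL (hn : n 0 ^ 2 + n 1 ^ 2 + n 2 ^ 2 = 1) (x : Spacetime) :
    lorentzAct (flipSL n hn) x = flip4 n x := by
  ext μ
  rw [flip4_apply hn, lorentzAct, lorentz_flipSL]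

lemma waveVec_flip3 (hn : n 0 ^ 2 + n 1 ^ 2 + n 2 ^ 2 = 1) (m : ℝ) (k : EuclideanSpace ℝ (Fin 3)) :
    waveVec m (flip3 n k) = flip4 n (waveVec m k) := by
  have he : energy m (flip3 n k) = energy m k := by simp [energy]
  ext μ
  rw [flip4_apply hn]
  fin_cases μ <;> simp [waveVec, he, flip3_apply hn, flipMat, Fin.sum_univ_four] <;> ring

/-- Composition of a test function with the rotation. -/
def flipTest (n : Fin 3 → ℝ) (f : Test) : Test :=
  SchwartzMap.compCLMOfContinuousLinearEquiv ℂ (flip4 n).toContinuousLinearEquiv f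

lemma flipTest_apply (f : Test) (x : Spacetime) : flipTest n f x = f (flip4 n x) := rfl

lemma shellFourier_flipTest (hn : n 0 ^ 2 + n 1 ^ 2 + n 2 ^ 2 = 1) (m s : ℝ) (f : Test)
    (k : EuclideanSpace ℝ (Fin 3)) :
    shellFourier m s (flipTest n f) k = shellFourier m s f (flip3 n k) := by
  rw [shellFourier_eq, shellFourier_eq, SchwartzMap.fourier_coe, SchwartzMap.fourier_coe,
    waveVec_flip3 hn, ← map_smul, ← Real.fourier_comp_linearIsometry]
  rfl

lemma flip3_flip3 (k : EuclideanSpace ℝ (Fin 3)) :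
    flip3 n (flip3 n k) = k := by
  simp [flip3]

/-- The polynomial with rotated arguments. -/
def flipPoly (n : Fin 3 → ℝ) (p : MvPolynomial (Fin 4) ℂ) : MvPolynomial (Fin 4) ℂ :=
  aeval (fun μ => ∑ ν, C (flipMat n μ ν : ℂ) * X ν) p

lemma eval_flipPoly (v : Fin 4 → ℂ) (p : MvPolynomial (Fin 4) ℂ) :
    eval v (flipPoly n p) = eval (fun μ => ∑ ν, (flipMat n μ ν : ℂ) * v ν) p := by
  have := congrArg (fun φ : MvPolynomial (Fin 4) ℂ →ₐ[ℂ] ℂ => φ p)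
    (MvPolynomial.comp_aeval (R := ℂ)
      (fun μ => ∑ ν, C (flipMat n μ ν : ℂ) * X ν : Fin 4 → MvPolynomial (Fin 4) ℂ)
      (aeval v : MvPolynomial (Fin 4) ℂ →ₐ[ℂ] ℂ))
  simpa [MvPolynomial.coe_aeval_eq_eval, flipPoly] using this

lemma flipMat_shellVec (hn : n 0 ^ 2 + n 1 ^ 2 + n 2 ^ 2 = 1) (m : ℝ)
    (k : EuclideanSpace ℝ (Fin 3)) :
    (fun μ => ∑ ν, (flipMat n μ ν : ℂ) * shellVec m k ν) = shellVec m (flip3 n k) := by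
  funext μ
  rw [shellVec, waveVec_flip3 hn, flip4_apply hn]
  push_cast
  rw [Finset.mul_sum]
  refine Finset.sum_congr rfl fun ν _ => ?_
  rw [shellVec]; ring

/-- The rotation is moved onto the momentum and removed from the transforms by the substitution `k ↦
flip3 n k`, which preserves volume and energy. Only the symbol is then rotated. -/
lemma causalKernel_flipTest (hn : n 0 ^ 2 + n 1 ^ 2 + n 2 ^ 2 = 1) (m : ℝ)
    (p : MvPolynomial (Fin 4) ℂ) (f g : Test) :
    causalKernel m p (flipTest n f) (flipTest n g) = causalKernel m (flipPoly n p) f g := by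
  have he : ∀ k, energy m (flip3 n k) = energy m k := fun k => by simp [energy]
  have hv : ∀ k, eval (-shellVec m k) (flipPoly n p) = eval (-shellVec m (flip3 n k)) p := by
    intro k
    rw [eval_flipPoly, ← flipMat_shellVec hn]
    congr 2; funext μ; simp
  simp only [causalKernel_eq, plusKernel_eq, Dplus_transposeOp_right, shellFourier_flipTest hn]
  congr 2
  · rw [← (flip3 n).measurePreserving.integral_comp (flip3 n).toHomeomorph.measurableEmbedding]
    simp only [flip3_flip3, he, eval_flipPoly, flipMat_shellVec hn]
  · rw [← (flip3 n).measurePreserving.integral_comp (flip3 n).toHomeomorph.measurableEmbedding]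
    simp only [flip3_flip3, he, hv]

/-- Every point of the mass shell is fixed by a rotation by `π`. -/
lemma Shell.exists_flip {m : ℝ} {v : Fin 4 → ℂ} (hv : v ∈ Shell m) :
    ∃ (n : Fin 3 → ℝ) (c : ℂ), n 0 ^ 2 + n 1 ^ 2 + n 2 ^ 2 = 1 ∧ c ≠ 0 ∧ v 1 = c * n 0 ∧ v 2 = c * n 1 ∧
      v 3 = c * n 2 := by
  obtain ⟨k, hk, h⟩ := hv
  have h0 := norm_pos_iff.2 hk
  -- The spatial part of `shellVec` is `i 𝐤`; the sign of `c` records the sheet.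
  refine ⟨fun i => k i / ‖k‖, if v = shellVec m k then Complex.I * ‖k‖ else -Complex.I * ‖k‖,
    ?_, ?_, ?_, ?_, ?_⟩
  · have : ‖k‖ ^ 2 = k 0 ^ 2 + k 1 ^ 2 + k 2 ^ 2 := by
      rw [EuclideanSpace.norm_sq_eq, Fin.sum_univ_three]; simp
    simp only [div_pow, ← add_div, ← this]
    field_simp
  · split_ifs <;> simp [hk]
  all_goals
    have h0' : (‖k‖ : ℂ) ≠ 0 := by exact_mod_cast h0.ne'
    split_ifs with hs
    · rw [hs]; simp [shellVec, waveVec]; field_simp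
    · rw [h.resolve_left hs]; simp [shellVec, waveVec]; field_simp

lemma flipMat_fix (hn : n 0 ^ 2 + n 1 ^ 2 + n 2 ^ 2 = 1) {v : Fin 4 → ℂ} {c : ℂ}
    (h1 : v 1 = c * n 0) (h2 : v 2 = c * n 1) (h3 : v 3 = c * n 2) :
    (fun μ => ∑ ν, (flipMat n μ ν : ℂ) * v ν) = v := by
  have h : (n 0 : ℂ) ^ 2 + n 1 ^ 2 + n 2 ^ 2 = 1 := by exact_mod_cast hn
  funext μ
  fin_cases μ <;> simp [flipMat, Fin.sum_univ_four, h1, h2, h3]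
  · linear_combination 2 * c * n 0 * h
  · linear_combination 2 * c * n 1 * h
  · linear_combination 2 * c * n 2 * h

end SUSY
end

/-! ### Brackets of `C` with singlets, and the anticommutator of `χ` with `χ̄` -/

noncomputable section

namespace SUSY

open MvPolynomial

section

variable {𝒜 : Type*} [Ring 𝒜] [Algebra ℂ 𝒜] {m : ℝ} {η η' : ℂ}
  {φ φ' ψ ψ' : Test →ₗ[ℂ] 𝒜} {s t : (Fin 4 → ℂ) → ℂ}

lemma HasSymbol.of_eq (h : HasSymbol m η φ ψ s)
    (e : ∀ f g, brk η' φ' ψ' f g = brk η φ ψ f g) : HasSymbol m η' φ' ψ' s := by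
  obtain ⟨p, hp, hb⟩ := h
  exact ⟨p, hp, fun f g => (e f g).trans (hb f g)⟩

lemma HasSymbol.sub_left (h : HasSymbol m η φ ψ s) (h' : HasSymbol m η φ' ψ t) :
    HasSymbol m η (φ - φ') ψ (fun v => s v - t v) := by
  refine ((h.add_left (h'.smul_left (-1))).of_eq fun f g => ?_).congr fun v _ => by ring
  simp [brk, sub_eq_add_neg]

lemma HasSymbol.raise_left {χ : Fin 2 → Test →ₗ[ℂ] 𝒜} {s : Fin 2 → (Fin 4 → ℂ) → ℂ}
    (h : ∀ c, HasSymbol m η (χ c) ψ (s c)) (b : Fin 2) :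
    HasSymbol m η (raise χ b) ψ (fun v => ∑ c, epsU b c * s c v) :=
  .sum_left fun c _ => (h c).smul_left _

lemma HasSymbol.raise_right {χ : Fin 2 → Test →ₗ[ℂ] 𝒜} {s : Fin 2 → (Fin 4 → ℂ) → ℂ}
    (h : ∀ c, HasSymbol m η φ (χ c) (s c)) (b : Fin 2) :
    HasSymbol m η φ (raise χ b) (fun v => ∑ c, epsU b c * s c v) :=
  .sum_right fun c _ => (h c).smul_right _

lemma HasSymbol.dFieldUp_left (h : HasSymbol m η φ ψ s) (μ : Fin 4) :
    HasSymbol m η (dFieldUp μ φ) ψ (fun v => gdiag μ * (v μ * s v)) :=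
  (h.dField_left μ).smul_left _

lemma HasSymbol.dF {χ : Fin 2 → Fin 2 → Test →ₗ[ℂ] 𝒜} {s : Fin 2 → Fin 2 → (Fin 4 → ℂ) → ℂ}
    (h : ∀ k c, HasSymbol m η (χ k c) ψ (s k c)) (σ : Fin 4 → Matrix (Fin 2) (Fin 2) ℂ)
    (j a : Fin 2) (μ ν : Fin 4) :
    HasSymbol m η (ReducedMultiplet.dF χ σ j a μ ν) ψ (fun v => ∑ k, Complex.I / 2 * epsL j k *
      ∑ b, (σ μ a b * (gdiag ν * (v ν * ∑ c, epsU b c * s k c v)) -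
        σ ν a b * (gdiag μ * (v μ * ∑ c, epsU b c * s k c v)))) :=
  .sum_left fun k _ => (HasSymbol.sum_left fun b _ =>
    (((HasSymbol.raise_left (h k) b).dFieldUp_left ν).smul_left _).sub_left
      (((HasSymbol.raise_left (h k) b).dFieldUp_left μ).smul_left _)).smul_left _

end

/-- With first index 0 the determinant reduces to a 3×3 one. Only this component of the closedness
of `F`, the analogue of `div B = 0`, is needed. -/
lemma levi_zero_sum (h : Fin 4 → Fin 4 → Fin 4 → ℂ) :
    ∑ ν, ∑ ρ, ∑ l, levi 0 ν ρ l * h ν ρ l =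
      h 1 2 3 + h 2 3 1 + h 3 1 2 - h 1 3 2 - h 2 1 3 - h 3 2 1 := by
  have e : ∀ ν ρ l, levi 0 ν ρ l = Matrix.det (Matrix.of ![
      ![if ν = 1 then (1 : ℂ) else 0, if ν = 2 then 1 else 0, if ν = 3 then 1 else 0],
      ![if ρ = 1 then (1 : ℂ) else 0, if ρ = 2 then 1 else 0, if ρ = 3 then 1 else 0],
      ![if l = 1 then (1 : ℂ) else 0, if l = 2 then 1 else 0, if l = 3 then 1 else 0]]) := by
    intro ν ρ l
    rw [levi, Matrix.det_succ_row_zero, Fin.sum_univ_four]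
    simp only [Matrix.of_apply, Matrix.cons_val_zero, Fin.isValue, if_true, zero_ne_one, if_false,
      Fin.reduceEq, mul_zero, zero_mul, add_zero, Fin.val_zero, pow_zero, one_mul]
    congr 1
    ext i j
    fin_cases i <;> fin_cases j <;> rfl
  simp only [e, Matrix.det_fin_three]
  simp [Fin.sum_univ_four]
  ring

namespace ReducedMultiplet

variable {𝒜 : Type*} [Ring 𝒜] [StarRing 𝒜] [Algebra ℂ 𝒜] [StarModule ℂ 𝒜] {m : ℝ}
  (M : ReducedMultiplet m 𝒜)

lemma bracket_eq_comm {I J : Comp} (h : ¬(I.IsFermi ∧ J.IsFermi)) (f g : Test) :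
    M.bracket I J f g = comm (M.field I f) (M.field J g) := by
  simp only [FieldContent.bracket, if_neg h]

lemma bracket_eq_acomm {I J : Comp} (hI : I.IsFermi) (hJ : J.IsFermi) (f g : Test) :
    M.bracket I J f g = acomm (M.field I f) (M.field J g) := by
  simp only [FieldContent.bracket, if_pos (And.intro hI hJ)]

lemma exists_comm_kernel (I J : Comp) (h : ¬(I.IsFermi ∧ J.IsFermi)) :
    ∃ p, ∀ f g, comm (M.field I f) (M.field J g) = algebraMap ℂ 𝒜 (causalKernel m p f g) := by
  obtain ⟨p, hp⟩ := M.causal I J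
  exact ⟨p, fun f g => by rw [← M.bracket_eq_comm h, hp]⟩

lemma comm_C_z (j k : Fin 2) (f g : Test) : comm (M.C j k f) (M.z g) = 0 := by
  refine M.comm_C_singlet M.z M.su2_z (fun j k f g => ?_) j k f g
  obtain ⟨p, hp⟩ := M.exists_comm_kernel (.C j k) .z (by simp [Comp.IsFermi])
  exact ⟨_, hp f g⟩

lemma comm_C_zStar (j k : Fin 2) (f g : Test) : comm (M.C j k f) (adj M.z g) = 0 := by
  refine M.comm_C_singlet (adj M.z) (fun B g => ?_) (fun j k f g => ?_) j k f g
  · rw [adj_apply]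
    nth_rewrite 2 [← M.su2_z B]
    simp [mul_assoc]
  · obtain ⟨p, hp⟩ := M.exists_comm_kernel (.C j k) .zStar (by simp [Comp.IsFermi])
    exact ⟨_, hp f g⟩

lemma comm_C_F (j k : Fin 2) (μ ν : Fin 4) (f g : Test) : comm (M.C j k f) (M.F μ ν g) = 0 := by
  refine M.comm_C_singlet (M.F μ ν) (fun B g => M.su2_F B μ ν g) (fun j k f g => ?_) j k f g
  obtain ⟨p, hp⟩ := M.exists_comm_kernel (.C j k) (.F μ ν) (by simp [Comp.IsFermi])
  exact ⟨_, hp f g⟩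

lemma comm_Q_z (j a : Fin 2) (f : Test) : comm (M.Q j a) (M.z f) = -Complex.I • M.chi j a f := by
  rw [← M.Q_z, smul_smul]
  simp

/-- The anticommutators of `χ` with a fermionic field `ψ` from the commutator of `z` with
`{Q, ψ}`. -/
lemma acomm_chi (j a : Fin 2) {ψ : Test →ₗ[ℂ] 𝒜} {R : Test →ₗ[ℂ] 𝒜}
    (hψ : ∀ f g, comm (M.z f) (ψ g) = 0) (hR : ∀ g, acomm (M.Q j a) (ψ g) = R g) (f g : Test) :
    brk 1 (M.chi j a) ψ f g = brk (-1) M.z (-Complex.I • R) f g := by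
  have h := acomm_comm_add_comm_acomm (q := M.Q j a) (hψ f g)
  rw [hR, comm_Q_z] at h
  rw [brk_one, brk_neg_one]
  have e1 : acomm (-Complex.I • M.chi j a f) (ψ g) = -Complex.I • acomm (M.chi j a f) (ψ g) := by
    simp [acomm]
  have e2 : comm (M.z f) ((-Complex.I • R) g) = -Complex.I • comm (M.z f) (R g) := by
    simp [comm, smul_sub]
  rw [e1] at h
  rw [e2, eq_neg_of_add_eq_zero_right h]
  simp [smul_smul]

lemma comm_z_chi (j a : Fin 2) (f g : Test) : comm (M.z f) (M.chi j a g) = 0 :=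
  M.mixed_comm (I := .z) (J := .chi j a) (by simp [Comp.IsFermi]) trivial f g

lemma comm_z_chiBar (j a : Fin 2) (f g : Test) : comm (M.z f) (M.chiBar j a g) = 0 :=
  M.mixed_comm (I := .z) (J := .chiBar j a) (by simp [Comp.IsFermi]) trivial f g

lemma comm_Fup_chi (μ ν : Fin 4) (j a : Fin 2) (f g : Test) :
    comm (M.Fup μ ν f) (M.chi j a g) = 0 := by
  have h : comm (M.F μ ν f) (M.chi j a g) = 0 :=
    M.mixed_comm (I := .F μ ν) (J := .chi j a) (by simp [Comp.IsFermi]) trivial f g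
  have e : comm (M.Fup μ ν f) (M.chi j a g) =
      (gdiag μ * gdiag ν) • comm (M.F μ ν f) (M.chi j a g) := by
    simp [comm, FieldContent.Fup, smul_sub]
  rw [e, h, smul_zero]

lemma comm_C_chi (k l j a : Fin 2) (f g : Test) : comm (M.C k l f) (M.chi j a g) = 0 :=
  M.mixed_comm (I := .C k l) (J := .chi j a) (by simp [Comp.IsFermi]) trivial f g

lemma hasSymbol_z_zStar : HasSymbol m (-1) M.z (adj M.z) (fun _ => -Complex.I) :=
  ⟨C (-Complex.I), by simp, fun f g => by
    rw [brk_neg_one, M.comm_z_zStar, pauliJordan_eq, ← causalKernel_C_mul, mul_one]⟩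

/-- Graded Jacobi identity for `Q`, `z`, `χ̄`: the bracket is reduced to `[z, ∂z*]`, which is given.
-/
lemma hasSymbol_chi_chiBar (j a k b : Fin 2) :
    HasSymbol m 1 (M.chi j a) (M.chiBar k b) (fun v => 2 * kd j k * ∑ μ, pauli μ a b * v μ) := by
  have h : HasSymbol m (-1) M.z (-Complex.I • ((2 * kd j k) • ∑ μ, pauli μ a b • dField μ (adj M.z)))
      _ := ((HasSymbol.sum_right fun μ _ =>
        (M.hasSymbol_z_zStar.dField_right μ).smul_right (pauli μ a b)).smul_right _).smul_right _
  refine (h.of_eq (M.acomm_chi j a (M.comm_z_chiBar k b) fun g => ?_)).congr fun v _ => ?_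
  · rw [M.Q_chiBar]; simp
  · simp only [Fin.sum_univ_four]
    linear_combination (-2 * kd j k * (pauli 0 a b * v 0 + pauli 1 a b * v 1 + pauli 2 a b * v 2 +
      pauli 3 a b * v 3)) * Complex.I_sq

lemma hasSymbol_C_z (j k : Fin 2) : HasSymbol m (-1) (M.C j k) M.z 0 :=
  .of_zero fun f g => by rw [brk_neg_one, comm_C_z]

end ReducedMultiplet

end SUSY
end

/-! ### The self-dual part of `F`, and the vanishing of `[F, z]` -/

noncomputable section

namespace SUSY

open MvPolynomial

/-- The self-dual part `σ^{μν}_{ab} γ_{μν}` of an antisymmetric tensor. -/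
def selfDual (γ : Fin 4 → Fin 4 → ℂ) : Matrix (Fin 2) (Fin 2) ℂ :=
  !![-Complex.I * γ 0 1 - γ 0 2 + Complex.I * γ 1 3 + γ 2 3, Complex.I * γ 0 3 - γ 1 2;
     Complex.I * γ 0 3 - γ 1 2, Complex.I * γ 0 1 - γ 0 2 + Complex.I * γ 1 3 - γ 2 3]

lemma sum_sigma2_mul {γ : Fin 4 → Fin 4 → ℂ} (h : ∀ μ ν, γ μ ν = -γ ν μ) (a b : Fin 2) :
    ∑ μ, ∑ ν, sigma2 μ ν a b * γ μ ν = selfDual γ a b := by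
  have hd : ∀ μ, γ μ μ = 0 := fun μ => self_eq_neg.1 (h μ μ)
  simp only [Fin.sum_univ_four, hd, h 1 0, h 2 0, h 3 0, h 2 1, h 3 1, h 3 2]
  fin_cases a <;> fin_cases b <;>
    simp [sigma2, selfDual, pauli, epsU, epsL, Fin.sum_univ_two] <;> ring_nf <;>
    simp only [Complex.I_sq] <;> ring

namespace ReducedMultiplet

variable {𝒜 : Type*} [Ring 𝒜] [StarRing 𝒜] [Algebra ℂ 𝒜] [StarModule ℂ 𝒜] {m : ℝ}
  (M : ReducedMultiplet m 𝒜)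

/-- The symbol of a linear combination of the `F_{μν}`. -/
lemma hasSymbol_Fab {η : ℂ} {ψ : Test →ₗ[ℂ] 𝒜} {G : Fin 4 → Fin 4 → (Fin 4 → ℂ) → ℂ}
    (hG : ∀ μ ν, HasSymbol m η (M.F μ ν) ψ (G μ ν)) (a b : Fin 2) :
    HasSymbol m η (M.Fab a b) ψ
      (fun v => -2 * Complex.I * ∑ μ, ∑ ν, sigma2 μ ν a b * G μ ν v) :=
  (HasSymbol.sum_left fun μ _ => HasSymbol.sum_left fun ν _ => (hG μ ν).smul_left _).smul_left _

/-- Graded Jacobi identity for `Q`, `z`, `χ`. In `{Q, χ}` the `C` part commutes with `z`, so only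
`[F, z]` contributes. -/
lemma hasSymbol_chi_chi {G : Fin 4 → Fin 4 → (Fin 4 → ℂ) → ℂ}
    (hG : ∀ μ ν, HasSymbol m (-1) (M.F μ ν) M.z (G μ ν)) (j a k b : Fin 2) :
    HasSymbol m 1 (M.chi j a) (M.chi k b) (fun v => Complex.I * epsL k j *
      (-2 * Complex.I * ∑ μ, ∑ ν, sigma2 μ ν b a * G μ ν v)) := by
  have h : HasSymbol m (-1) (Complex.I • (epsL k j • M.Fab b a + epsL b a • M.C k j)) M.z _ :=
    (((M.hasSymbol_Fab hG b a).smul_left (epsL k j)).add_left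
      ((M.hasSymbol_C_z k j).smul_left (epsL b a))).smul_left Complex.I
  refine (h.of_eq fun f g => ?_).congr fun v _ => by simp; ring
  -- The supercharge is taken from the second `χ`, so that after the exchange `F` stands to the left
  -- of `z`, as in `hG`.
  have h1 := M.acomm_chi k b (M.comm_z_chi j a) (M.acomm_Q_chi k b j a) g f
  have h2 : brk 1 (M.chi j a) (M.chi k b) f g = brk 1 (M.chi k b) (M.chi j a) g f := by
    simp [brk, add_comm]
  rw [h2, h1, brk_neg_one, brk_neg_one]
  simp only [comm, LinearMap.smul_apply, neg_smul, mul_neg, neg_mul]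
  abel

lemma hasSymbol_F_z_neg {G : Fin 4 → Fin 4 → (Fin 4 → ℂ) → ℂ}
    (hG : ∀ μ ν, HasSymbol m (-1) (M.F μ ν) M.z (G μ ν)) (μ ν : Fin 4) :
    HasSymbol m (-1) (M.Fup μ ν) M.z (fun v => gdiag μ * gdiag ν * G μ ν v) :=
  (hG μ ν).smul_left _

variable [Nontrivial 𝒜]

/-- The relation between the symbols of `{χ, χ}` and `[F, z]` that follows from `[F, χ] = 0`. -/
lemma symbol_chi_chi_F_z {G : Fin 4 → Fin 4 → (Fin 4 → ℂ) → ℂ}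
    (hG : ∀ μ ν, HasSymbol m (-1) (M.F μ ν) M.z (G μ ν)) {v : Fin 4 → ℂ} (hv : v ∈ Shell m)
    (l a k b : Fin 2) (μ ν : Fin 4) :
    (∑ n, Complex.I / 2 * epsL l n * ∑ c, (pauli μ c a * (gdiag ν * (v ν * ∑ d, epsU c d *
          (Complex.I * epsL k n * (-2 * Complex.I * ∑ μ, ∑ ν, sigma2 μ ν b d * G μ ν v)))) -
        pauli ν c a * (gdiag μ * (v μ * ∑ d, epsU c d *
          (Complex.I * epsL k n * (-2 * Complex.I * ∑ μ, ∑ ν, sigma2 μ ν b d * G μ ν v)))))) +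
      2 * kd l k * ∑ ρ, pauli ρ b a * (-v ρ * (gdiag μ * gdiag ν * G μ ν v)) = 0 := by
  have h1 := HasSymbol.dF (fun n c => M.hasSymbol_chi_chi hG n c k b)
    (fun μ => (pauli μ).transpose) l a μ ν
  have h2 : HasSymbol m (-1) (M.Fup μ ν) ((2 * kd l k) • ∑ ρ, pauli ρ b a • dField ρ M.z) _ :=
    (HasSymbol.sum_right fun ρ _ =>
      ((M.hasSymbol_F_z_neg hG μ ν).dField_right ρ).smul_right (pauli ρ b a)).smul_right _
  refine h1.add_eq_zero h2 (fun f g => ?_) hv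
  rw [brk_one, brk_neg_one, ← M.comm_Qbar_F, ← M.acomm_Qbar_chi]
  exact acomm_comm_add_comm_acomm (M.comm_Fup_chi μ ν k b f g)

lemma symbol_F_z_antisymm {G : Fin 4 → Fin 4 → (Fin 4 → ℂ) → ℂ}
    (hG : ∀ μ ν, HasSymbol m (-1) (M.F μ ν) M.z (G μ ν)) {v : Fin 4 → ℂ} (hv : v ∈ Shell m)
    (μ ν : Fin 4) : G μ ν v = -G ν μ v := by
  have h := (hG μ ν).add_eq_zero (hG ν μ) (fun f g => by rw [M.F_antisymm μ ν]; simp [brk]; abel) hv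
  linear_combination h

lemma symbol_F_z_closed {G : Fin 4 → Fin 4 → (Fin 4 → ℂ) → ℂ}
    (hG : ∀ μ ν, HasSymbol m (-1) (M.F μ ν) M.z (G μ ν)) {v : Fin 4 → ℂ} (hv : v ∈ Shell m) :
    ∑ ν, ∑ ρ, ∑ l, levi 0 ν ρ l * (v ν * G ρ l v) = 0 := by
  have h : HasSymbol m (-1) (∑ ν, ∑ ρ, ∑ l, levi 0 ν ρ l • dField ν (M.F ρ l)) M.z _ :=
    HasSymbol.sum_left fun ν _ => HasSymbol.sum_left fun ρ _ => HasSymbol.sum_left fun l _ =>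
      ((hG ρ l).dField_left ν).smul_left _
  rw [M.F_closed] at h
  exact h.unique HasSymbol.zero_left hv

/-- Conjugation with the unitary of the rotation leaves the numerical commutator fixed and rotates
the tensor `F`. At a momentum fixed by the rotation this is a linear condition on the symbol at that
one point. -/
lemma symbol_F_z_flip {G : Fin 4 → Fin 4 → MvPolynomial (Fin 4) ℂ}
    (hG : ∀ μ ν f g, comm (M.F μ ν f) (M.z g) = algebraMap ℂ 𝒜 (causalKernel m (G μ ν) f g))
    {n : Fin 3 → ℝ} (hn : n 0 ^ 2 + n 1 ^ 2 + n 2 ^ 2 = 1) {v : Fin 4 → ℂ} (hv : v ∈ Shell m)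
    (hfix : (fun μ => ∑ ν, (flipMat n μ ν : ℂ) * v ν) = v) (μ ν : Fin 4) :
    eval v (G μ ν) = ∑ ρ, ∑ l, ((flipMat n ρ μ * flipMat n l ν : ℝ) : ℂ) * eval v (G ρ l) := by
  have key : ∀ f g, causalKernel m (G μ ν) f g = causalKernel m
      (∑ ρ, ∑ l, C ((flipMat n ρ μ * flipMat n l ν : ℝ) : ℂ) * flipPoly n (G ρ l)) f g := by
    intro f g
    have h1 := star_mul_comm_mul (M.U (flipSL n hn)) (M.F μ ν f) (M.z g)
    rw [M.lorentz_z _ g (flipTest n g) (fun x => by rw [flipTest_apply, lorentzAct_flipSL]),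
      M.lorentz_F _ μ ν f (flipTest n f) (fun x => by rw [flipTest_apply, lorentzAct_flipSL]),
      hG, star_mul_algebraMap_mul, lorentz_flipSL_inv] at h1
    refine (algebraMap ℂ 𝒜).injective (h1.trans ?_)
    have h2 : ∀ x : Fin 4 → Fin 4 → 𝒜, ∀ y, comm (∑ ρ, ∑ l,
        ((flipMat n ρ μ * flipMat n l ν : ℝ) : ℂ) • x ρ l) y =
        ∑ ρ, ∑ l, ((flipMat n ρ μ * flipMat n l ν : ℝ) : ℂ) • comm (x ρ l) y := by
      intro x y
      simp only [comm, Finset.sum_mul, Finset.mul_sum, ← Finset.sum_sub_distrib, smul_mul_assoc,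
        mul_smul_comm, smul_sub]
    rw [h2]
    have h3 : ∀ (q : Fin 4 → Fin 4 → MvPolynomial (Fin 4) ℂ),
        causalKernel m (∑ ρ, ∑ l, q ρ l) f g = ∑ ρ, ∑ l, causalKernel m (q ρ l) f g := by
      intro q
      simp only [Fin.sum_univ_four, causalKernel_add]
    rw [h3, map_sum]
    refine Finset.sum_congr rfl fun ρ _ => ?_
    rw [map_sum]
    refine Finset.sum_congr rfl fun l _ => ?_
    rw [hG, causalKernel_flipTest hn, causalKernel_C_mul, map_mul, Algebra.smul_def]
  have h4 : ∀ w ∈ Shell m, eval w (G μ ν - ∑ ρ, ∑ l,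
      C ((flipMat n ρ μ * flipMat n l ν : ℝ) : ℂ) * flipPoly n (G ρ l)) = 0 := by
    refine eval_eq_zero_of_causalKernel fun f g => ?_
    rw [sub_eq_add_neg, causalKernel_add, key]
    have := causalKernel_C_mul m (-1) (∑ ρ, ∑ l,
      C ((flipMat n ρ μ * flipMat n l ν : ℝ) : ℂ) * flipPoly n (G ρ l)) f g
    rw [map_neg, map_one, neg_one_mul] at this
    rw [this]; ring
  have h5 := h4 v hv
  rw [map_sub, sub_eq_zero] at h5
  rw [h5]
  simp only [map_sum, map_mul, eval_C, eval_flipPoly, hfix]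

/-- At each momentum the symbol is an antisymmetric tensor with electric part `E` and magnetic part
`B`. Supersymmetry gives `E = iB`, closedness gives `n·B = 0`, and rotation by `π` about `n` gives
`E = n (n·E)`; together these force both parts to vanish. -/
lemma comm_F_z (μ ν : Fin 4) (f g : Test) : comm (M.F μ ν f) (M.z g) = 0 := by
  have hex := fun μ ν => M.exists_comm_kernel (.F μ ν) .z (by simp [Comp.IsFermi])
  choose G hG using hex
  have hS : ∀ μ ν, HasSymbol m (-1) (M.F μ ν) M.z (fun v => eval v (G μ ν)) := fun μ ν =>
    ⟨G μ ν, fun _ _ => rfl, fun f g => by rw [brk_neg_one]; exact hG μ ν f g⟩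
  have hzero : ∀ v ∈ Shell m, eval v (G μ ν) = eval v 0 := by
    intro v hv
    rw [map_zero]
    have ha := M.symbol_F_z_antisymm hS hv
    have hc := M.symbol_F_z_closed hS hv
    obtain ⟨n, c, hn, hc0, h1, h2, h3⟩ := Shell.exists_flip hv
    have hr := M.symbol_F_z_flip hG hn hv (flipMat_fix hn h1 h2 h3)
    have hq := M.symbol_chi_chi_F_z hS hv
    have hv0 := Shell.zero_ne hv
    rw [levi_zero_sum] at hc
    generalize hγ : (fun μ ν => eval v (G μ ν)) = γ at *
    have hγ' : ∀ μ ν, eval v (G μ ν) = γ μ ν := fun μ ν => by rw [← hγ]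
    simp only [hγ'] at *
    have hs := sum_sigma2_mul ha
    simp only [hs] at hq
    have hd : ∀ μ, γ μ μ = 0 := fun μ => self_eq_neg.1 (ha μ μ)
    -- Trace over the spinor indices: the spatial Pauli matrices drop out of the last term, and the
    -- contribution of `σ⁰` to the first vanishes because the self-dual part is symmetric. What
    -- remains carries a common factor `v 0`, which is non-zero.
    have q : ∀ i : Fin 4, _ := fun i => congrArg₂ (· + ·) (hq 0 0 0 0 0 i) (hq 0 1 0 1 0 i)
    have q1 := q 1
    have q2 := q 2
    have q3 := q 3
    have r1 := hr 0 1
    have r2 := hr 0 2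
    have r3 := hr 0 3
    simp [Fin.sum_univ_four, flipMat, hd] at r1 r2 r3
    simp [Fin.sum_univ_two, Fin.sum_univ_four, pauli, epsL, epsU, kd, gdiag, selfDual] at q1 q2 q3
    -- These three identities are `E = iB`, with `E = (γ 0 1, γ 0 2, γ 0 3)` and `B = (γ 2 3, γ 3 1,
    -- γ 1 2)`.
    have e1 : γ 0 1 = Complex.I * γ 2 3 := mul_left_cancel₀ hv0 (by
      linear_combination q1 / 2 + (v 0 * γ 0 1 * (Complex.I ^ 2 - 1) - v 0 * γ 2 3 * Complex.I) *
        Complex.I_sq)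
    have e2 : γ 0 2 = -Complex.I * γ 1 3 := mul_left_cancel₀ hv0 (by
      linear_combination q2 / 2 + (v 0 * γ 0 2 * (Complex.I ^ 2 - 1) -
        v 0 * γ 1 3 * (Complex.I ^ 3 - Complex.I)) * Complex.I_sq)
    have e3 : γ 0 3 = Complex.I * γ 1 2 := mul_left_cancel₀ hv0 (by
      linear_combination q3 / 2 + (v 0 * γ 0 3 * (Complex.I ^ 2 - 1) - v 0 * γ 1 2 * Complex.I) *
        Complex.I_sq)
    -- Closedness with the momentum written as `c n`, `c ≠ 0`: the magnetic part is transverse.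
    have hB : (n 0 : ℂ) * γ 2 3 - n 1 * γ 1 3 + n 2 * γ 1 2 = 0 := by
      refine mul_left_cancel₀ hc0 ?_
      rw [h1, h2, h3, ha 3 1, ha 3 2, ha 2 1] at hc
      linear_combination hc / 2
    have hE : (n 0 : ℂ) * γ 0 1 + n 1 * γ 0 2 + n 2 * γ 0 3 = 0 := by
      rw [e1, e2, e3]; linear_combination Complex.I * hB
    -- Rotation invariance reads `E = 2 n (n·E) - E`, and the longitudinal part `n·E` is already
    -- zero.
    have z1 : γ 0 1 = 0 := by linear_combination r1 / 2 + n 0 * hE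
    have z2 : γ 0 2 = 0 := by linear_combination r2 / 2 + n 1 * hE
    have z3 : γ 0 3 = 0 := by linear_combination r3 / 2 + n 2 * hE
    have b1 : γ 2 3 = 0 := by simpa [z1] using e1.symm
    have b2 : γ 1 3 = 0 := by simpa [z2] using e2.symm
    have b3 : γ 1 2 = 0 := by simpa [z3] using e3.symm
    fin_cases μ <;> fin_cases ν <;>
      first | exact hd _ | assumption | (refine (ha _ _).trans (neg_eq_zero.2 ?_); assumption)
  have := (hS μ ν).kernel (p := 0) (fun v hv => hzero v hv) f g
  rw [← brk_neg_one, this, causalKernel_zero, map_zero]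

end ReducedMultiplet

end SUSY
end

/-! ### The brackets `[F, F]`, `[C, C]` and `{χ, χ}` -/

noncomputable section

namespace SUSY

open MvPolynomial

/-- The symbol of `[F_{μν}, F_{ρλ}]`. -/
def symFF (v : Fin 4 → ℂ) (μ ν ρ l : Fin 4) : ℂ :=
  -Complex.I / 2 * (gM μ ρ * v ν * v l - gM ν ρ * v μ * v l + gM ν l * v μ * v ρ -
    gM μ l * v ν * v ρ)

lemma symFF_antisymm (v : Fin 4 → ℂ) (μ ν ρ l : Fin 4) : symFF v μ ν ρ l = -symFF v μ ν l ρ := by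
  unfold symFF; ring

/-- The symbol of `{[Q_{ja}, F^{μν}], χ_{kb}}` up to the factor `i ε_{jk}`. -/
lemma selfDual_symFF_aux (v : Fin 4 → ℂ) (a b : Fin 2) {μ ν : Fin 4} (h : μ < ν) :
    gdiag ν * v ν * (∑ c, pauli μ a c * ∑ d, epsU c d * ∑ ρ, pauli ρ b d * v ρ) -
      gdiag μ * v μ * (∑ c, pauli ν a c * ∑ d, epsU c d * ∑ ρ, pauli ρ b d * v ρ) =
      2 * gdiag μ * gdiag ν * selfDual (symFF v μ ν) a b := by
  fin_cases μ <;> fin_cases ν <;> first | exact absurd h (by decide) | skip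
  all_goals
    fin_cases a <;> fin_cases b <;>
    simp [Fin.sum_univ_two, Fin.sum_univ_four, pauli, epsL, epsU, gdiag, selfDual, symFF, gM] <;>
    ring_nf <;> simp only [Complex.I_sq] <;> ring

/-- The sum `σ̄^{μν}_{āb̄} γ_{μν}` over an antisymmetric tensor, with the complex conjugate
coefficients. -/
def antiSelfDual (γ : Fin 4 → Fin 4 → ℂ) : Matrix (Fin 2) (Fin 2) ℂ :=
  !![Complex.I * γ 0 1 - γ 0 2 - Complex.I * γ 1 3 + γ 2 3, -Complex.I * γ 0 3 - γ 1 2;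
     -Complex.I * γ 0 3 - γ 1 2, -Complex.I * γ 0 1 - γ 0 2 - Complex.I * γ 1 3 - γ 2 3]

lemma sum_conj_sigma2_mul {γ : Fin 4 → Fin 4 → ℂ} (h : ∀ μ ν, γ μ ν = -γ ν μ) (a b : Fin 2) :
    ∑ μ, ∑ ν, (starRingEnd ℂ) (sigma2 μ ν a b) * γ μ ν = antiSelfDual γ a b := by
  have h' : ∀ μ ν, (starRingEnd ℂ) (γ μ ν) = -(starRingEnd ℂ) (γ ν μ) := fun μ ν => by
    rw [h, map_neg]
  have := congrArg (starRingEnd ℂ)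
    (sum_sigma2_mul (γ := fun μ ν => (starRingEnd ℂ) (γ μ ν)) h' a b)
  simp only [map_sum, map_mul, Complex.conj_conj] at this
  rw [this]
  fin_cases a <;> fin_cases b <;> simp [selfDual, antiSelfDual] <;> ring

lemma antiSelfDual_symFF_aux (v : Fin 4 → ℂ) (a b : Fin 2) {μ ν : Fin 4} (h : μ < ν) :
    gdiag ν * v ν * (∑ c, pauli μ c a * ∑ d, epsU c d * ∑ ρ, pauli ρ d b * v ρ) -
      gdiag μ * v μ * (∑ c, pauli ν c a * ∑ d, epsU c d * ∑ ρ, pauli ρ d b * v ρ) =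
      -2 * gdiag μ * gdiag ν * antiSelfDual (symFF v μ ν) a b := by
  fin_cases μ <;> fin_cases ν <;> first | exact absurd h (by decide) | skip
  all_goals
    fin_cases a <;> fin_cases b <;>
    simp [Fin.sum_univ_two, Fin.sum_univ_four, pauli, epsL, epsU, gdiag, antiSelfDual, symFF, gM] <;>
    ring_nf <;> simp only [Complex.I_sq] <;> ring

/-- The three self-dual and three anti-self-dual contractions are six independent combinations of
the six components. -/
lemma eq_of_selfDual_of_antiSelfDual {γ γ' : Fin 4 → Fin 4 → ℂ} (h : ∀ μ ν, γ μ ν = -γ ν μ)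
    (h' : ∀ μ ν, γ' μ ν = -γ' ν μ) (hs : ∀ a b, selfDual γ a b = selfDual γ' a b)
    (ha : ∀ a b, antiSelfDual γ a b = antiSelfDual γ' a b) (μ ν : Fin 4) : γ μ ν = γ' μ ν := by
  have s00 := hs 0 0
  have s01 := hs 0 1
  have s11 := hs 1 1
  have a00 := ha 0 0
  have a01 := ha 0 1
  have a11 := ha 1 1
  simp [selfDual, antiSelfDual] at s00 s01 s11 a00 a01 a11
  have hd : ∀ μ, γ μ μ = γ' μ μ := fun μ => by
    rw [self_eq_neg.1 (h μ μ), self_eq_neg.1 (h' μ μ)]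
  have e02 : γ 0 2 = γ' 0 2 := by linear_combination -(s00 + s11 + a00 + a11) / 4
  have e23 : γ 2 3 = γ' 2 3 := by linear_combination (s00 - s11 + a00 - a11) / 4
  have e12 : γ 1 2 = γ' 1 2 := by linear_combination -(s01 + a01) / 2
  have e01 : γ 0 1 = γ' 0 1 := mul_left_cancel₀ Complex.I_ne_zero (by
    linear_combination (s11 - s00 + a00 - a11) / 4)
  have e13 : γ 1 3 = γ' 1 3 := mul_left_cancel₀ Complex.I_ne_zero (by
    linear_combination (s00 + s11 - a00 - a11) / 4)
  have e03 : γ 0 3 = γ' 0 3 := mul_left_cancel₀ Complex.I_ne_zero (by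
    linear_combination (s01 - a01) / 2)
  fin_cases μ <;> fin_cases ν <;>
    first | exact hd _ | assumption | (refine (h _ _).trans (Eq.trans ?_ (h' _ _).symm);
                                       exact congrArg Neg.neg (by assumption))

lemma epsL_antisymm (a b : Fin 2) : epsL a b = -epsL b a := by
  fin_cases a <;> fin_cases b <;> simp [epsL]

/-- The product `(σ·v) ε (σ·v)ᵀ` is a multiple of `ε` by the Minkowski square, which is constant on
the shell. This is the source of the factor `m²`. -/
lemma sum_pauli_eps_pauli {m : ℝ} {v : Fin 4 → ℂ} (hv : v ∈ Shell m) :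
    ∑ μ, ∑ b, pauli μ 0 b * (v μ * ∑ c, epsU b c * ∑ ρ, pauli ρ 1 c * v ρ) = m ^ 2 := by
  have h := Shell.sq hv
  simp [Fin.sum_univ_two, Fin.sum_univ_four, pauli, epsL, epsU]
  linear_combination -h - v 2 ^ 2 * Complex.I_sq

lemma comm_symm_eq_zero {𝒜 : Type*} [Ring 𝒜] {x y : 𝒜} (h : comm x y = 0) : comm y x = 0 := by
  rw [show comm y x = -comm x y by simp [comm], h, neg_zero]

namespace ReducedMultiplet

variable {𝒜 : Type*} [Ring 𝒜] [StarRing 𝒜] [Algebra ℂ 𝒜] [StarModule ℂ 𝒜] {m : ℝ}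
  (M : ReducedMultiplet m 𝒜)

lemma comm_adj_eq_zero {φ ψ : Test →ₗ[ℂ] 𝒜} (h : ∀ f g, comm (φ f) (ψ g) = 0) (f g : Test) :
    comm (adj φ f) (adj ψ g) = 0 := by
  have := congrArg star (h (conjTest f) (conjTest g))
  rw [star_comm, star_zero, neg_eq_zero] at this
  exact this

lemma acomm_adj_eq_zero {φ ψ : Test →ₗ[ℂ] 𝒜} (h : ∀ f g, acomm (φ f) (ψ g) = 0) (f g : Test) :
    acomm (adj φ f) (adj ψ g) = 0 := by
  have := congrArg star (h (conjTest f) (conjTest g))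
  rw [star_acomm, star_zero] at this
  exact this

lemma comm_Fup_chiBar (μ ν : Fin 4) (j a : Fin 2) (f g : Test) :
    comm (M.Fup μ ν f) (M.chiBar j a g) = 0 := by
  have h := comm_adj_eq_zero (M.comm_Fup_chi μ ν j a) f g
  rwa [adj_Fup] at h

lemma hasSymbol_chiBar_chi (j a k b : Fin 2) :
    HasSymbol m 1 (M.chiBar j a) (M.chi k b) (fun v => 2 * kd k j * ∑ μ, pauli μ b a * v μ) :=
  ((M.hasSymbol_chi_chiBar k b j a).swap (by simp)).congr fun v _ => by
    simp only [Pi.neg_apply, mul_neg, Finset.sum_neg_distrib]; ring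

variable [Nontrivial 𝒜]

lemma hasSymbol_F_z (μ ν : Fin 4) : HasSymbol m (-1) (M.F μ ν) M.z 0 :=
  .of_zero fun f g => by rw [brk_neg_one, comm_F_z]

/-- By `hasSymbol_chi_chi`, now that `F` commutes with `z`. -/
lemma acomm_chi_chi (j a k b : Fin 2) (f g : Test) :
    acomm (M.chi j a f) (M.chi k b g) = 0 := by
  rw [← brk_one, (M.hasSymbol_chi_chi M.hasSymbol_F_z j a k b).kernel (p := 0) (by simp),
    causalKernel_zero, map_zero]

/-- Graded Jacobi identity for `Q`, `C`, `χ`. The `F` part of `{Q, χ}` commutes with `C`, and the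
two Pauli matrices, one from `[Q, C]` and one from `{χ̄, χ}`, combine to `m²`. -/
lemma hasSymbol_C_C (k l j n : Fin 2) :
    HasSymbol m (-1) (M.C k l) (M.C j n)
      (fun _ => -2 * Complex.I * m ^ 2 * (epsL k j * epsL l n + epsL k n * epsL l j)) := by
  obtain ⟨p, hp⟩ := M.exists_comm_kernel (.C k l) (.C j n) (by simp [Comp.IsFermi])
  have hS : HasSymbol m (-1) (M.C k l) (M.C j n) (fun v => eval v p) :=
    ⟨p, fun _ _ => rfl, fun f g => by rw [brk_neg_one]; exact hp f g⟩
  refine hS.congr fun v hv => ?_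
  -- Spinor components 0 and 1 are chosen so that `C j n` enters `{Q, χ}` with coefficient `epsL 0 1
  -- = 1`.
  have h1 : HasSymbol m 1 (-Complex.I • ∑ μ, ∑ b, pauli μ 0 b • ∑ p,
      (epsL j k * epsL l p + epsL j l * epsL k p) • dField μ (raise (M.chiBar p) b)) (M.chi n 1) _ :=
    (HasSymbol.sum_left fun μ _ => HasSymbol.sum_left fun b _ =>
      (HasSymbol.sum_left fun p _ => ((HasSymbol.raise_left
        (fun c => M.hasSymbol_chiBar_chi p c n 1) b).dField_left μ).smul_left _).smul_left
          (pauli μ 0 b)).smul_left _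
  have hCF : ∀ μ ν, HasSymbol m (-1) (M.F μ ν) (M.C k l) 0 := fun μ ν => .of_zero fun f g => by
    rw [brk_neg_one]; exact comm_symm_eq_zero (M.comm_C_F k l μ ν g f)
  have hCF' : HasSymbol m (-1) (M.C k l) (M.Fab 0 1) 0 :=
    ((M.hasSymbol_Fab hCF 0 1).swap (by simp)).congr fun v _ => by simp
  have h2 : HasSymbol m (-1) (M.C k l) (epsL j n • M.Fab 0 1 + epsL 0 1 • M.C j n) _ :=
    (hCF'.smul_right _).add_right (hS.smul_right _)
  have h3 := h1.add_eq_zero h2 (fun f g => by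
    rw [brk_one, brk_neg_one, ← M.acomm_Q_chi, ← M.comm_Q_C]
    exact acomm_comm_add_comm_acomm (M.comm_C_chi k l n 1 f g)) hv
  have hX := sum_pauli_eps_pauli hv
  simp only [Fin.sum_univ_two, Fin.sum_univ_four, Pi.zero_apply] at h3 hX
  have hε : epsL 0 1 = 1 := rfl
  have h10 : kd 1 0 = 0 := rfl
  have h01 : kd 0 1 = 0 := rfl
  have h00 : kd 0 0 = 1 := rfl
  have h11 : kd 1 1 = 1 := rfl
  rw [epsL_antisymm k j, epsL_antisymm l j]
  fin_cases n <;> simp only [Fin.zero_eta, Fin.mk_one, hε, h10, h01, h00, h11] at h3 ⊢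
  · linear_combination h3 + 2 * Complex.I * (epsL j k * epsL l 0 + epsL j l * epsL k 0) * hX
  · linear_combination h3 + 2 * Complex.I * (epsL j k * epsL l 1 + epsL j l * epsL k 1) * hX

lemma hasSymbol_F_F (μ ν ρ l : Fin 4) :
    HasSymbol m (-1) (M.F μ ν) (M.F ρ l) (fun v => symFF v μ ν ρ l) := by
  have hex := fun μ ν ρ l => M.exists_comm_kernel (.F μ ν) (.F ρ l) (by simp [Comp.IsFermi])
  choose H hH using hex
  have hS : ∀ μ ν ρ l, HasSymbol m (-1) (M.F μ ν) (M.F ρ l) (fun v => eval v (H μ ν ρ l)) :=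
    fun μ ν ρ l => ⟨H μ ν ρ l, fun _ _ => rfl, fun f g => by
      rw [brk_neg_one]; exact hH μ ν ρ l f g⟩
  refine (hS μ ν ρ l).congr fun v hv => ?_
  have hleft : ∀ μ ν ρ l, eval v (H μ ν ρ l) = -eval v (H ν μ ρ l) := fun μ ν ρ l => by
    have h := (hS μ ν ρ l).add_eq_zero (hS ν μ ρ l)
      (fun f g => by rw [M.F_antisymm μ ν]; simp [brk]; abel) hv
    linear_combination h
  have hright : ∀ μ ν ρ l, eval v (H μ ν ρ l) = -eval v (H μ ν l ρ) := fun μ ν ρ l => by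
    have h := (hS μ ν ρ l).add_eq_zero (hS μ ν l ρ)
      (fun f g => by rw [M.F_antisymm ρ l]; simp [brk]; abel) hv
    linear_combination h
  -- By antisymmetry in the first pair it suffices to treat `μ < ν`, where the explicit spinor
  -- identities apply.
  have hlt : ∀ μ ν, μ < ν → ∀ ρ l, eval v (H μ ν ρ l) = symFF v μ ν ρ l := by
    intro μ ν hμν
    have hg : gdiag μ * gdiag ν ≠ 0 := by
      fin_cases μ <;> fin_cases ν <;> simp [gdiag]
    have hFF : ∀ a b, HasSymbol m (-1) (M.Fup μ ν) (M.Fab a b) (fun v => -2 * Complex.I *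
        ∑ ρ, ∑ l, sigma2 ρ l a b * (gdiag μ * gdiag ν * eval v (H μ ν ρ l))) := fun a b =>
      (HasSymbol.sum_right fun ρ _ => HasSymbol.sum_right fun l _ =>
        HasSymbol.smul_right (HasSymbol.smul_left (hS μ ν ρ l) _) _).smul_right _
    have hFF' : ∀ a b, HasSymbol m (-1) (M.Fup μ ν) (adj (M.Fab a b)) (fun v => 2 * Complex.I *
        ∑ ρ, ∑ l, (starRingEnd ℂ) (sigma2 ρ l a b) * (gdiag μ * gdiag ν * eval v (H μ ν ρ l))) := by
      intro a b
      have e : adj (M.Fab a b) = (2 * Complex.I) • ∑ ρ, ∑ l,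
          (starRingEnd ℂ) (sigma2 ρ l a b) • M.F ρ l := by
        simp only [Fab_eq, adj_smul, adj_sum, M.F_real, map_mul, map_neg, map_ofNat, Complex.conj_I,
          neg_mul_neg]
      rw [e]
      exact (HasSymbol.sum_right fun ρ _ => HasSymbol.sum_right fun l _ =>
        HasSymbol.smul_right (HasSymbol.smul_left (hS μ ν ρ l) _) _).smul_right _
    have hFC : ∀ j k, HasSymbol m (-1) (M.Fup μ ν) (M.C j k) 0 := fun j k =>
      .of_zero fun f g => by
        rw [brk_neg_one, FieldContent.Fup]
        refine comm_symm_eq_zero ?_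
        have := M.comm_C_F j k μ ν g f
        simp only [comm, LinearMap.smul_apply, mul_smul_comm, smul_mul_assoc, ← smul_sub] at this ⊢
        rw [this, smul_zero]
    have hFC' : ∀ j k, HasSymbol m (-1) (M.Fup μ ν) (adj (M.C j k)) 0 := fun j k => by
      rw [M.C_real]
      exact (HasSymbol.sum_right fun l _ => HasSymbol.sum_right fun n _ =>
        (hFC l n).smul_right (epsL j l * epsL k n)).congr fun v _ => by simp
    have hε : epsL 0 1 = 1 := rfl
    have h00 : epsL 0 0 = 0 := rfl
    have h10 : kd 1 0 = 0 := rfl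
    have h01 : kd 0 1 = 0 := rfl
    have h11 : kd 1 1 = 1 := rfl
    refine eq_of_selfDual_of_antiSelfDual (hright μ ν) (symFF_antisymm v μ ν) (fun a b => ?_)
      (fun a b => ?_)
    -- Isospin components 0 and 1 give the self-dual part of `F` the coefficient `epsL 0 1 = 1` in
    -- `{Q, χ}`; the `C` part drops out since it commutes with `F`.
    · have h1 := HasSymbol.dF (fun n c => M.hasSymbol_chiBar_chi n c 1 b) pauli 0 a μ ν
      have h2 : HasSymbol m (-1) (M.Fup μ ν) (epsL 0 1 • M.Fab a b + epsL a b • M.C 0 1) _ :=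
        ((hFF a b).smul_right _).add_right ((hFC 0 1).smul_right _)
      have h3 := h1.add_eq_zero h2 (fun f g => by
        rw [brk_one, brk_neg_one, ← M.comm_Q_F, ← M.acomm_Q_chi]
        exact acomm_comm_add_comm_acomm (M.comm_Fup_chi μ ν 1 b f g)) hv
      have h4 := sum_sigma2_mul (hright μ ν) a b
      have h5 := selfDual_symFF_aux v a b hμν
      rw [← h4]
      refine mul_left_cancel₀ (mul_ne_zero hg Complex.I_ne_zero) ?_
      simp only [Fin.sum_univ_two, Fin.sum_univ_four, Pi.zero_apply, hε, h00, h10, h11]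
        at h3 h5 ⊢
      linear_combination -h3 / 2 + Complex.I / 2 * h5
    -- The conjugate supercharge acting on `χ̄` supplies the anti-self-dual contractions.
    · have h1 := HasSymbol.dF (fun n c => M.hasSymbol_chi_chiBar n c 1 b)
        (fun μ => (pauli μ).transpose) 0 a μ ν
      have h2 : HasSymbol m (-1) (M.Fup μ ν)
          (epsL 0 1 • adj (M.Fab a b) + epsL a b • adj (M.C 0 1)) _ :=
        ((hFF' a b).smul_right _).add_right ((hFC' 0 1).smul_right _)
      have h3 := h1.add_eq_zero h2 (fun f g => by
        rw [brk_one, brk_neg_one, ← M.comm_Qbar_F, ← M.acomm_Qbar_chiBar]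
        exact acomm_comm_add_comm_acomm (M.comm_Fup_chiBar μ ν 1 b f g)) hv
      have h4 := sum_conj_sigma2_mul (hright μ ν) a b
      have h5 := antiSelfDual_symFF_aux v a b hμν
      rw [← h4]
      refine mul_left_cancel₀ (mul_ne_zero hg Complex.I_ne_zero) ?_
      simp only [Fin.sum_univ_two, Fin.sum_univ_four, Pi.zero_apply, Matrix.transpose_apply, hε, h00,
        h01, h11] at h3 h5 ⊢
      linear_combination h3 / 2 - Complex.I / 2 * h5
  rcases lt_trichotomy μ ν with h | h | h
  · exact hlt μ ν h ρ l
  · subst h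
    have h1 : eval v (H μ μ ρ l) = 0 := self_eq_neg.1 (hleft μ μ ρ l)
    have h2 : symFF v μ μ ρ l = 0 := by unfold symFF; ring
    rw [h1, h2]
  · rw [hleft, hlt ν μ h]
    unfold symFF; ring

end ReducedMultiplet

end SUSY
end

/-! ### Adjoint brackets and the complete list -/

noncomputable section

namespace SUSY

open MvPolynomial

/-- From `ε εᵀ = 1`. Together with the reality condition it converts `[C, C]` into `[C, C*]`;
`sum_eps_mul_kd` goes on to `[C*, C*]`. -/
lemma sum_eps_mul_eps (m : ℝ) (j k l n : Fin 2) :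
    ∑ p, ∑ q, epsL l p * epsL n q *
      (-2 * Complex.I * m ^ 2 * (epsL j p * epsL k q + epsL j q * epsL k p)) =
    -2 * Complex.I * m ^ 2 * (kd j l * kd k n + kd j n * kd k l) := by
  have h : ∀ a b : Fin 2, epsL a 0 * epsL b 0 + epsL a 1 * epsL b 1 = kd b a := by
    intro a b
    fin_cases a <;> fin_cases b <;> simp [epsL, kd]
  rw [← h l j, ← h n k, ← h n j, ← h l k]
  simp only [Fin.sum_univ_two]
  ring

lemma sum_eps_mul_kd (m : ℝ) (j k l n : Fin 2) :
    ∑ p, ∑ q, epsL j p * epsL k q *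
      (-2 * Complex.I * m ^ 2 * (kd p l * kd q n + kd p n * kd q l)) =
    -2 * Complex.I * m ^ 2 * (epsL j l * epsL k n + epsL j n * epsL k l) := by
  have h : ∀ a b : Fin 2, epsL a 0 * kd 0 b + epsL a 1 * kd 1 b = epsL a b := by
    intro a b
    fin_cases a <;> fin_cases b <;> simp [epsL, kd]
  rw [← h j l, ← h k n, ← h j n, ← h k l]
  simp only [Fin.sum_univ_two]
  ring

lemma kd_symm (a b : Fin 2) : kd a b = kd b a := by
  simp only [kd, eq_comm]

namespace ReducedMultiplet

variable {𝒜 : Type*} [Ring 𝒜] [StarRing 𝒜] [Algebra ℂ 𝒜] [StarModule ℂ 𝒜] {m : ℝ}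
  (M : ReducedMultiplet m 𝒜)

lemma bracket_of_comm_zero {I J : Comp} {p : MvPolynomial (Fin 4) ℂ} {f g : Test}
    (h : ¬(I.IsFermi ∧ J.IsFermi)) (hp : p = 0)
    (h0 : comm (M.field I f) (M.field J g) = 0) :
    M.bracket I J f g = algebraMap ℂ 𝒜 (causalKernel m p f g) := by
  rw [M.bracket_eq_comm h, h0, hp, causalKernel_zero, map_zero]

lemma bracket_of_acomm_zero {I J : Comp} {p : MvPolynomial (Fin 4) ℂ} {f g : Test}
    (hI : I.IsFermi) (hJ : J.IsFermi) (hp : p = 0)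
    (h0 : acomm (M.field I f) (M.field J g) = 0) :
    M.bracket I J f g = algebraMap ℂ 𝒜 (causalKernel m p f g) := by
  rw [M.bracket_eq_acomm hI hJ, h0, hp, causalKernel_zero, map_zero]

lemma bracket_of_comm {I J : Comp} {p : MvPolynomial (Fin 4) ℂ} {s : (Fin 4 → ℂ) → ℂ}
    {f g : Test} (h : ¬(I.IsFermi ∧ J.IsFermi)) (hs : HasSymbol m (-1) (M.field I) (M.field J) s)
    (hp : ∀ v, s v = eval v p) :
    M.bracket I J f g = algebraMap ℂ 𝒜 (causalKernel m p f g) := by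
  rw [M.bracket_eq_comm h, ← brk_neg_one, hs.kernel fun v _ => hp v]

lemma bracket_of_acomm {I J : Comp} {p : MvPolynomial (Fin 4) ℂ} {s : (Fin 4 → ℂ) → ℂ}
    {f g : Test} (hI : I.IsFermi) (hJ : J.IsFermi) (hs : HasSymbol m 1 (M.field I) (M.field J) s)
    (hp : ∀ v, s v = eval v p) :
    M.bracket I J f g = algebraMap ℂ 𝒜 (causalKernel m p f g) := by
  rw [M.bracket_eq_acomm hI hJ, ← brk_one, hs.kernel fun v _ => hp v]

lemma hasSymbol_zStar_z : HasSymbol m (-1) (adj M.z) M.z (fun _ => -Complex.I) :=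
  (M.hasSymbol_z_zStar.swap (by simp)).congr fun v _ => by simp

lemma comm_zStar_zStar (f g : Test) : comm (adj M.z f) (adj M.z g) = 0 :=
  comm_adj_eq_zero M.comm_z_z f g

lemma comm_CStar_z (j k : Fin 2) (f g : Test) : comm (adj (M.C j k) f) (M.z g) = 0 := by
  have := comm_adj_eq_zero (M.comm_C_zStar j k) f g
  rwa [adj_adj] at this

lemma comm_CStar_zStar (j k : Fin 2) (f g : Test) : comm (adj (M.C j k) f) (adj M.z g) = 0 :=
  comm_adj_eq_zero (M.comm_C_z j k) f g

lemma comm_CStar_F (j k : Fin 2) (μ ν : Fin 4) (f g : Test) :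
    comm (adj (M.C j k) f) (M.F μ ν g) = 0 := by
  have := comm_adj_eq_zero (M.comm_C_F j k μ ν) f g
  rwa [M.F_real] at this

/-- Adjoint of the reality condition, `ε` being real; it is what kills `scriptD`. -/
lemma sum_eps_adj_C (j k : Fin 2) :
    ∑ l, ∑ n, (epsL j l * epsL k n) • adj (M.C l n) = M.C j k := by
  have h := congrArg adj (M.C_real j k)
  rw [adj_adj] at h
  simp only [adj_sum, adj_smul, map_mul, conj_epsL] at h
  exact h.symm

lemma scriptD_eq_zero (j k : Fin 2) : M.scriptD j k = 0 := by
  ext f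
  simp only [FieldContent.scriptD, sum_eps_adj_C, sub_self, smul_zero,
    LinearMap.zero_apply]

lemma scriptC_eq (j k : Fin 2) : M.scriptC j k = M.C j k := by
  ext f
  simp only [FieldContent.scriptC, sum_eps_adj_C, LinearMap.smul_apply, LinearMap.add_apply]
  rw [← two_smul ℂ, smul_smul]; norm_num

variable [Nontrivial 𝒜]

lemma comm_F_zStar (μ ν : Fin 4) (f g : Test) : comm (M.F μ ν f) (adj M.z g) = 0 := by
  have := comm_adj_eq_zero (M.comm_F_z μ ν) f g
  rwa [M.F_real] at this

lemma acomm_chiBar_chiBar (j a k b : Fin 2) (f g : Test) :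
    acomm (M.chiBar j a f) (M.chiBar k b g) = 0 :=
  acomm_adj_eq_zero (M.acomm_chi_chi j a k b) f g

lemma hasSymbol_C_CStar (j k l n : Fin 2) :
    HasSymbol m (-1) (M.C j k) (adj (M.C l n))
      (fun _ => -2 * Complex.I * m ^ 2 * (kd j l * kd k n + kd j n * kd k l)) := by
  rw [M.C_real l n]
  exact (HasSymbol.sum_right fun p _ => HasSymbol.sum_right fun q _ =>
    (M.hasSymbol_C_C j k p q).smul_right _).congr fun v _ => sum_eps_mul_eps m j k l n

lemma hasSymbol_CStar_C (j k l n : Fin 2) :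
    HasSymbol m (-1) (adj (M.C j k)) (M.C l n)
      (fun _ => -2 * Complex.I * m ^ 2 * (kd j l * kd k n + kd j n * kd k l)) :=
  ((M.hasSymbol_C_CStar l n j k).swap (by simp)).congr fun v _ => by
    rw [kd_symm l, kd_symm n k, kd_symm l k, kd_symm n j]; ring

lemma hasSymbol_CStar_CStar (j k l n : Fin 2) :
    HasSymbol m (-1) (adj (M.C j k)) (adj (M.C l n))
      (fun _ => -2 * Complex.I * m ^ 2 * (epsL j l * epsL k n + epsL j n * epsL k l)) := by
  rw [M.C_real j k]
  exact (HasSymbol.sum_left fun p _ => HasSymbol.sum_left fun q _ =>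
    (M.hasSymbol_C_CStar p q l n).smul_left _).congr fun v _ => sum_eps_mul_kd m j k l n

theorem hasCommutators : M.HasCommutators m (reducedTable m) := by
  intro I J f g
  match I, J with
  | .z, .z => exact M.bracket_of_comm_zero (by exact fun h => h.1) rfl (M.comm_z_z f g)
  | .z, .zStar =>
    exact M.bracket_of_comm (by exact fun h => h.1) M.hasSymbol_z_zStar (by simp [reducedTable])
  | .z, .F _ _ =>
    exact M.bracket_of_comm_zero (by exact fun h => h.1) rfl (comm_symm_eq_zero (M.comm_F_z _ _ g f))
  | .z, .C _ _ =>
    exact M.bracket_of_comm_zero (by exact fun h => h.1) rfl (comm_symm_eq_zero (M.comm_C_z _ _ g f))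
  | .z, .CStar _ _ =>
    exact M.bracket_of_comm_zero (by exact fun h => h.1) rfl (comm_symm_eq_zero (M.comm_CStar_z _ _ g f))
  | .zStar, .z =>
    exact M.bracket_of_comm (by exact fun h => h.1) M.hasSymbol_zStar_z (by simp [reducedTable])
  | .zStar, .zStar => exact M.bracket_of_comm_zero (by exact fun h => h.1) rfl (M.comm_zStar_zStar f g)
  | .zStar, .F _ _ =>
    exact M.bracket_of_comm_zero (by exact fun h => h.1) rfl (comm_symm_eq_zero (M.comm_F_zStar _ _ g f))
  | .zStar, .C _ _ =>
    exact M.bracket_of_comm_zero (by exact fun h => h.1) rfl (comm_symm_eq_zero (M.comm_C_zStar _ _ g f))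
  | .zStar, .CStar _ _ =>
    exact M.bracket_of_comm_zero (by exact fun h => h.1) rfl (comm_symm_eq_zero (M.comm_CStar_zStar _ _ g f))
  | .F _ _, .z => exact M.bracket_of_comm_zero (by exact fun h => h.1) rfl (M.comm_F_z _ _ f g)
  | .F _ _, .zStar => exact M.bracket_of_comm_zero (by exact fun h => h.1) rfl (M.comm_F_zStar _ _ f g)
  | .F _ _, .F _ _ =>
    exact M.bracket_of_comm (by exact fun h => h.1) (M.hasSymbol_F_F _ _ _ _) (by simp [reducedTable, symFF])
  | .F _ _, .C _ _ =>
    exact M.bracket_of_comm_zero (by exact fun h => h.1) rfl (comm_symm_eq_zero (M.comm_C_F _ _ _ _ g f))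
  | .F _ _, .CStar _ _ =>
    exact M.bracket_of_comm_zero (by exact fun h => h.1) rfl (comm_symm_eq_zero (M.comm_CStar_F _ _ _ _ g f))
  | .C _ _, .z => exact M.bracket_of_comm_zero (by exact fun h => h.1) rfl (M.comm_C_z _ _ f g)
  | .C _ _, .zStar => exact M.bracket_of_comm_zero (by exact fun h => h.1) rfl (M.comm_C_zStar _ _ f g)
  | .C _ _, .F _ _ => exact M.bracket_of_comm_zero (by exact fun h => h.1) rfl (M.comm_C_F _ _ _ _ f g)
  | .C _ _, .C _ _ =>
    exact M.bracket_of_comm (by exact fun h => h.1) (M.hasSymbol_C_C _ _ _ _) (by simp [reducedTable])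
  | .C _ _, .CStar _ _ =>
    exact M.bracket_of_comm (by exact fun h => h.1) (M.hasSymbol_C_CStar _ _ _ _) (by simp [reducedTable])
  | .CStar _ _, .z => exact M.bracket_of_comm_zero (by exact fun h => h.1) rfl (M.comm_CStar_z _ _ f g)
  | .CStar _ _, .zStar => exact M.bracket_of_comm_zero (by exact fun h => h.1) rfl (M.comm_CStar_zStar _ _ f g)
  | .CStar _ _, .F _ _ => exact M.bracket_of_comm_zero (by exact fun h => h.1) rfl (M.comm_CStar_F _ _ _ _ f g)
  | .CStar _ _, .C _ _ =>
    exact M.bracket_of_comm (by exact fun h => h.1) (M.hasSymbol_CStar_C _ _ _ _) (by simp [reducedTable])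
  | .CStar _ _, .CStar _ _ =>
    exact M.bracket_of_comm (by exact fun h => h.1) (M.hasSymbol_CStar_CStar _ _ _ _) (by simp [reducedTable])
  | .chi _ _, .chi _ _ =>
    exact M.bracket_of_acomm_zero (by trivial) (by trivial) rfl (M.acomm_chi_chi _ _ _ _ f g)
  | .chiBar _ _, .chiBar _ _ =>
    exact M.bracket_of_acomm_zero (by trivial) (by trivial) rfl (M.acomm_chiBar_chiBar _ _ _ _ f g)
  | .chi _ _, .chiBar _ _ =>
    exact M.bracket_of_acomm (by trivial) (by trivial) (M.hasSymbol_chi_chiBar _ _ _ _)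
      (by simp [reducedTable])
  | .chiBar _ _, .chi _ _ =>
    exact M.bracket_of_acomm (by trivial) (by trivial) (M.hasSymbol_chiBar_chi _ _ _ _)
      (by simp [reducedTable])
  | .z, .chi _ _ | .z, .chiBar _ _
  | .zStar, .chi _ _ | .zStar, .chiBar _ _
  | .F _ _, .chi _ _ | .F _ _, .chiBar _ _
  | .C _ _, .chi _ _ | .C _ _, .chiBar _ _
  | .CStar _ _, .chi _ _ | .CStar _ _, .chiBar _ _ =>
    exact M.bracket_of_comm_zero (by exact fun h => h.1) rfl (M.mixed_comm (by exact fun h => h) (by trivial) f g)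
  | .chi _ _, .z | .chiBar _ _, .z
  | .chi _ _, .zStar | .chiBar _ _, .zStar
  | .chi _ _, .F _ _ | .chiBar _ _, .F _ _
  | .chi _ _, .C _ _ | .chiBar _ _, .C _ _
  | .chi _ _, .CStar _ _ | .chiBar _ _, .CStar _ _ =>
    exact M.bracket_of_comm_zero (by exact fun h => h.2) rfl
      (comm_symm_eq_zero (M.mixed_comm (by exact fun h => h) (by trivial) g f))

end ReducedMultiplet

end SUSY
end

/-! ### Spinor identities for the unreduced multiplet -/

noncomputable section

namespace SUSY

open MvPolynomial

/-- The components of the reduced multiplet from which a field of the unreduced one is built. -/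
def FullComp.Base : FullComp → Comp → Prop
  | .z, .z => True
  | .D, .zStar => True
  | .F _ _, .F _ _ => True
  | .C _ _, .C _ _ => True
  | .lam _ _, .chiBar _ _ => True
  | .chi _ _, .chi _ _ => True
  | _, _ => False

section

variable {𝒜 : Type*} [Ring 𝒜] [Algebra ℂ 𝒜]

lemma boxField_eq (φ : Test →ₗ[ℂ] 𝒜) :
    boxField φ = ∑ μ, gdiag μ • dField μ (dField μ φ) := by
  ext f
  simp [boxField, box, dField]

end

lemma sum_pauli_eps_pauli' {m : ℝ} {v : Fin 4 → ℂ} (hv : v ∈ Shell m) (a b : Fin 2) :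
    ∑ μ, ∑ c, pauli μ a c * (v μ * ∑ d, epsU c d * ∑ ρ, pauli ρ b d * v ρ) =
      m ^ 2 * epsL a b := by
  have h := Shell.sq hv
  fin_cases a <;> fin_cases b <;>
    simp [Fin.sum_univ_two, Fin.sum_univ_four, pauli, epsL, epsU]
  · ring
  · linear_combination -h - v 2 ^ 2 * Complex.I_sq
  · linear_combination h + v 2 ^ 2 * Complex.I_sq
  · ring

/-- Two self-dual projections leave only the scalar part of the second-order symbol, the Minkowski
square, which on the shell is `-m²`. -/
lemma selfDual_selfDual_symFF {m : ℝ} {v : Fin 4 → ℂ} (hv : v ∈ Shell m) (a b c d : Fin 2) :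
    -2 * Complex.I * (-2 * Complex.I * selfDual (fun μ ν => selfDual (symFF v μ ν) c d) a b) =
      Complex.I * (2 * m ^ 2) * (epsL a c * epsL b d + epsL a d * epsL b c) := by
  have h := Shell.sq hv
  have h3 : Complex.I ^ 3 = -Complex.I := Complex.I_pow_three
  have h5 : Complex.I ^ 5 = Complex.I := by linear_combination Complex.I * Complex.I_pow_four
  fin_cases a <;> fin_cases b <;> fin_cases c <;> fin_cases d <;>
    simp [selfDual, symFF, gM, gdiag, epsL] <;> ring_nf <;>
    simp only [h3, h5, h] <;> ring

/-- A polynomial identity in `v`: opposite dualities keep the second derivatives, and the mass shell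
is not needed. -/
lemma selfDual_antiSelfDual_symFF (v : Fin 4 → ℂ) (a b c d : Fin 2) :
    -2 * Complex.I * (2 * Complex.I * selfDual (fun μ ν => antiSelfDual (symFF v μ ν) c d) a b) =
      2 * Complex.I * ∑ μ, ∑ ν, (pauli μ a c * pauli ν b d + pauli μ a d * pauli ν b c) *
        v μ * v ν := by
  have h3 : Complex.I ^ 3 = -Complex.I := Complex.I_pow_three
  have h4 : Complex.I ^ 4 = 1 := Complex.I_pow_four
  have h5 : Complex.I ^ 5 = Complex.I := by linear_combination Complex.I * h4
  fin_cases a <;> fin_cases b <;> fin_cases c <;> fin_cases d <;>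
    simp [selfDual, antiSelfDual, symFF, gM, gdiag, pauli, Fin.sum_univ_four] <;> ring_nf <;>
    simp only [Complex.I_sq, h3, h4, h5] <;> ring

end SUSY
end

/-! ### Brackets of the composite fields `D`, `F_{ab}` and `λ` -/

noncomputable section

namespace SUSY

open MvPolynomial

lemma brk_swap_eq_zero {𝒜 : Type*} [Ring 𝒜] [Algebra ℂ 𝒜] {η : ℂ} (hη : η * η = 1) {φ ψ : Test →ₗ[ℂ] 𝒜}
    (h : ∀ f g, brk η φ ψ f g = 0) (f g : Test) : brk η ψ φ f g = 0 := by
  have : brk η ψ φ f g = η • brk η φ ψ g f := by simp [brk, smul_smul, hη, add_comm]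
  rw [this, h, smul_zero]

namespace ReducedMultiplet

variable {𝒜 : Type*} [Ring 𝒜] [StarRing 𝒜] [Algebra ℂ 𝒜] [StarModule ℂ 𝒜] {m : ℝ}
  (M : ReducedMultiplet m 𝒜)

lemma adj_field (i : Comp) : adj (M.field i) = M.field i.conj := by
  cases i <;> simp only [FieldContent.field, Comp.conj, adj_adj, M.F_real, adj_chiBar]
  all_goals rfl

lemma boxField_zStar : boxField (adj M.z) = (-(m : ℂ) ^ 2) • adj M.z := by
  have h := congrArg adj M.klein_gordon
  have h1 : adj (boxField M.z) = boxField (adj M.z) := by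
    simp only [boxField_eq, adj_sum, adj_smul, adj_dField, conj_gdiag]
  have h2 : adj (0 : Test →ₗ[ℂ] 𝒜) = 0 := by ext f; simp [adj_apply]
  rw [adj_add, adj_smul, h1, h2, map_pow, Complex.conj_ofReal] at h
  ext f
  have := congrArg (fun φ : Test →ₗ[ℂ] 𝒜 => φ f) h
  simpa [add_eq_zero_iff_eq_neg] using this

/-- By the Klein–Gordon equation for `z*` the field `D` is a multiple of `z*`, so its brackets are
those of `z` and `z*`. -/
lemma fullField_D : M.fullField .D = (2 * Complex.I * (m : ℂ) ^ 2) • adj M.z := by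
  rw [FieldContent.fullField, boxField_zStar, smul_smul]
  congr 1; ring

lemma adj_fullField_D : adj (M.fullField .D) = (-2 * Complex.I * (m : ℂ) ^ 2) • M.z := by
  rw [fullField_D, adj_smul, adj_adj]
  congr 1
  simp only [map_mul, map_ofNat, Complex.conj_I, map_pow, Complex.conj_ofReal]
  ring

lemma adj_fullField_lam (j a : Fin 2) : adj (M.fullField (.lam j a)) =
    ∑ k, (-Complex.I * epsL j k) • ∑ μ, ∑ b, pauli μ b a • dField μ (raise (M.chi k) b) := by
  simp only [FieldContent.fullField, adj_sum, adj_smul, adj_dField, adj_raise, adj_chiBar, conj_pauli,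
    map_mul, Complex.conj_I, conj_epsL]

/-- A property of fields that is stable under linear combinations and derivatives holds for a
field of the unreduced multiplet if it holds for its constituents. -/
lemma fullField_induction {P : (Test →ₗ[ℂ] 𝒜) → Prop} (h0 : P 0)
    (hadd : ∀ φ ψ, P φ → P ψ → P (φ + ψ)) (hsmul : ∀ (c : ℂ) φ, P φ → P (c • φ))
    (hd : ∀ μ φ, P φ → P (dField μ φ)) (I : FullComp) (h : ∀ i, I.Base i → P (M.field i)) :
    P (M.fullField I) := by
  have hsum : ∀ {ι : Type} [Fintype ι] (φ : ι → Test →ₗ[ℂ] 𝒜), (∀ i, P (φ i)) → P (∑ i, φ i) :=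
    fun φ hφ => Finset.sum_induction φ P (fun a b => hadd a b) h0 fun i _ => hφ i
  cases I with
  | z => exact h .z trivial
  | D =>
    rw [FieldContent.fullField, boxField_eq]
    exact hsmul _ _ (hsum _ fun μ => hsmul _ _ (hd _ _ (hd _ _ (h .zStar trivial))))
  | F a b => exact hsmul _ _ (hsum _ fun μ => hsum _ fun ν => hsmul _ _ (h (.F μ ν) trivial))
  | C j k => exact h (.C j k) trivial
  | lam j a =>
    exact hsum _ fun k => hsmul _ _ (hsum _ fun μ => hsum _ fun b => hsmul _ _
      (hd _ _ (hsum _ fun c => hsmul _ _ (h (.chiBar k c) trivial))))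
  | chi j a => exact h (.chi j a) trivial

lemma brk_adj_eq_zero {η : ℂ} (hη : (starRingEnd ℂ) η = η) (hη' : η * η = 1)
    {φ ψ : Test →ₗ[ℂ] 𝒜} (h : ∀ f g, brk η φ ψ f g = 0) (f g : Test) :
    brk η (adj φ) (adj ψ) f g = 0 := by
  have h1 := congrArg star (h (conjTest f) (conjTest g))
  simp only [brk, star_add, star_smul, star_mul, star_zero, ← adj_apply, RCLike.star_def, hη] at h1
  have h2 := congrArg (η • ·) h1
  simp only [smul_add, smul_smul, hη', one_smul, smul_zero] at h2
  rw [brk, add_comm]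
  exact h2

lemma brk_fullField_left_eq_zero {η : ℂ} {I : FullComp} {ψ : Test →ₗ[ℂ] 𝒜}
    (h : ∀ i, I.Base i → ∀ f g, brk η (M.field i) ψ f g = 0) (f g : Test) :
    brk η (M.fullField I) ψ f g = 0 := by
  revert f g
  refine M.fullField_induction (P := fun φ => ∀ f g, brk η φ ψ f g = 0) (by simp [brk])
    (fun φ ψ h1 h2 f g => ?_) (fun c φ h1 f g => ?_) (fun μ φ h1 f g => ?_) I fun i hi => h i hi
  · have := congrArg₂ (· + ·) (h1 f g) (h2 f g)
    simp only [brk, add_zero] at this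
    rw [← this]
    simp only [brk, LinearMap.add_apply, add_mul, mul_add, smul_add]
    abel
  · have := congrArg (c • ·) (h1 f g)
    simp only [smul_zero] at this
    rw [← this]
    simp only [brk, LinearMap.smul_apply, smul_mul_assoc, mul_smul_comm, smul_add, smul_comm c]
  · have := h1 (partialD μ f) g
    rw [← neg_eq_zero, ← this]
    simp [brk, dField, add_comm]

lemma brk_fullField_eq_zero {η : ℂ} (hη : η * η = 1) {I J : FullComp}
    (h : ∀ i j, I.Base i → J.Base j → ∀ f g, brk η (M.field i) (M.field j) f g = 0) (f g : Test) :
    brk η (M.fullField I) (M.fullField J) f g = 0 :=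
  M.brk_fullField_left_eq_zero (fun i hi => brk_swap_eq_zero hη
    (M.brk_fullField_left_eq_zero fun j hj => brk_swap_eq_zero hη (h i j hi hj))) f g

/-- The adjoint of a composite field is not covered by `fullField_induction`. The bracket is
therefore exchanged and conjugated, which puts the composite field itself on the left; this needs
`η` real with `η² = 1`. -/
lemma brk_fullField_adj_eq_zero {η : ℂ} (hη : (starRingEnd ℂ) η = η) (hη' : η * η = 1)
    {I J : FullComp}
    (h : ∀ i j, I.Base i → J.Base j → ∀ f g, brk η (M.field i) (M.field j.conj) f g = 0)
    (f g : Test) : brk η (M.fullField I) (adj (M.fullField J)) f g = 0 := by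
  refine M.brk_fullField_left_eq_zero (fun i hi => brk_swap_eq_zero hη' fun f g => ?_) f g
  have h1 := M.brk_fullField_left_eq_zero (η := η) (I := J) (ψ := adj (M.field i))
    fun j hj f g => ?_
  · have := brk_adj_eq_zero hη hη' h1 f g
    rwa [adj_adj] at this
  · have := brk_adj_eq_zero hη hη' (brk_swap_eq_zero hη' (h i j hi hj)) f g
    rwa [← adj_field, adj_adj] at this

/-- The derivative in `λ` meets the one in `{χ̄, χ}`, and on the shell the pair collapses to `m² ε`;
the symbol is constant. -/
lemma hasSymbol_lam_chi (j a k b : Fin 2) :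
    HasSymbol m 1 (M.fullField (.lam j a)) (M.chi k b)
      (fun _ => Complex.I * (2 * m ^ 2) * epsL a b * epsL j k) := by
  have h : HasSymbol m 1 (M.fullField (.lam j a)) (M.chi k b) _ :=
    HasSymbol.sum_left fun n _ => (HasSymbol.sum_left fun μ _ => HasSymbol.sum_left fun c _ =>
      ((HasSymbol.raise_left (fun d => M.hasSymbol_chiBar_chi n d k b) c).dField_left μ).smul_left
        (pauli μ a c)).smul_left (Complex.I * epsL j n)
  refine h.congr fun v hv => ?_
  have hX := sum_pauli_eps_pauli' hv a b
  have h10 : kd 1 0 = 0 := rfl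
  have h01 : kd 0 1 = 0 := rfl
  have h00 : kd 0 0 = 1 := rfl
  have h11 : kd 1 1 = 1 := rfl
  simp only [Fin.sum_univ_two, Fin.sum_univ_four] at hX ⊢
  fin_cases k <;> simp only [Fin.zero_eta, Fin.mk_one, h10, h01, h00, h11]
  · linear_combination 2 * Complex.I * epsL j 0 * hX
  · linear_combination 2 * Complex.I * epsL j 1 * hX

/-- With `{λ, χ}` known to have a constant symbol, only the derivative inside the adjoint of `λ`
survives. -/
lemma hasSymbol_lam_adj_lam (j a k b : Fin 2) :
    HasSymbol m 1 (M.fullField (.lam j a)) (adj (M.fullField (.lam k b)))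
      (fun v => 2 * kd j k * m ^ 2 * ∑ μ, pauli μ a b * v μ) := by
  rw [adj_fullField_lam]
  refine HasSymbol.congr (HasSymbol.sum_right fun n _ => (HasSymbol.sum_right fun μ _ =>
    HasSymbol.sum_right fun c _ => ((HasSymbol.raise_right
      (fun d => M.hasSymbol_lam_chi j a n d) c).dField_right μ).smul_right
        (pauli μ c b)).smul_right (-Complex.I * epsL k n)) fun v hv => ?_
  simp only [Fin.sum_univ_two, Fin.sum_univ_four]
  fin_cases j <;> fin_cases k <;> fin_cases a <;> simp [kd, epsL, epsU] <;> ring_nf <;>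
    simp only [Complex.I_sq] <;> ring

variable [Nontrivial 𝒜]

lemma comm_field_eq_zero {i j : Comp} (h : ¬(i.IsFermi ∧ j.IsFermi)) (ht : reducedTable m i j = 0)
    (f g : Test) : brk (-1) (M.field i) (M.field j) f g = 0 := by
  have := M.hasCommutators i j f g
  rwa [M.bracket_eq_comm h, ht, causalKernel_zero, map_zero, ← brk_neg_one] at this

lemma acomm_field_eq_zero {i j : Comp} (hi : i.IsFermi) (hj : j.IsFermi)
    (ht : reducedTable m i j = 0) (f g : Test) : brk 1 (M.field i) (M.field j) f g = 0 := by
  have := M.hasCommutators i j f g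
  rwa [M.bracket_eq_acomm hi hj, ht, causalKernel_zero, map_zero, ← brk_one] at this

lemma hasSymbol_Fab_Fab (a b c d : Fin 2) :
    HasSymbol m (-1) (M.Fab a b) (M.Fab c d)
      (fun _ => Complex.I * (2 * m ^ 2) * (epsL a c * epsL b d + epsL a d * epsL b c)) := by
  have h1 : ∀ μ ν, HasSymbol m (-1) (M.F μ ν) (M.Fab c d)
      (fun v => -2 * Complex.I * selfDual (symFF v μ ν) c d) := fun μ ν =>
    (HasSymbol.smul_right (HasSymbol.sum_right fun ρ _ => HasSymbol.sum_right fun l _ =>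
      (M.hasSymbol_F_F μ ν ρ l).smul_right _) _).congr fun v _ => by
        rw [sum_sigma2_mul (symFF_antisymm v μ ν)]
  refine (M.hasSymbol_Fab h1 a b).congr fun v hv => ?_
  rw [← selfDual_selfDual_symFF hv, sum_sigma2_mul]
  · congr 1
    fin_cases a <;> fin_cases b <;> simp [selfDual] <;> ring
  · intro μ ν
    fin_cases c <;> fin_cases d <;> simp [selfDual, symFF] <;> ring

lemma hasSymbol_Fab_adj_Fab (a b c d : Fin 2) :
    HasSymbol m (-1) (M.Fab a b) (adj (M.Fab c d)) (fun v => 2 * Complex.I * ∑ μ, ∑ ν,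
      (pauli μ a c * pauli ν b d + pauli μ a d * pauli ν b c) * v μ * v ν) := by
  have e : adj (M.Fab c d) = (2 * Complex.I) • ∑ ρ, ∑ l,
      (starRingEnd ℂ) (sigma2 ρ l c d) • M.F ρ l := by
    simp only [Fab_eq, adj_smul, adj_sum, M.F_real, map_mul, map_neg, map_ofNat, Complex.conj_I,
      neg_mul_neg]
  have h1 : ∀ μ ν, HasSymbol m (-1) (M.F μ ν) (adj (M.Fab c d))
      (fun v => 2 * Complex.I * antiSelfDual (symFF v μ ν) c d) := fun μ ν => by
    rw [e]
    exact (HasSymbol.smul_right (HasSymbol.sum_right fun ρ _ => HasSymbol.sum_right fun l _ =>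
      (M.hasSymbol_F_F μ ν ρ l).smul_right _) _).congr fun v _ => by
        rw [sum_conj_sigma2_mul (symFF_antisymm v μ ν)]
  refine (M.hasSymbol_Fab h1 a b).congr fun v hv => ?_
  rw [← selfDual_antiSelfDual_symFF v, sum_sigma2_mul]
  · congr 1
    fin_cases a <;> fin_cases b <;> simp [selfDual] <;> ring
  · intro μ ν
    fin_cases c <;> fin_cases d <;> simp [antiSelfDual, symFF] <;> ring

end ReducedMultiplet

end SUSY
end

/-! ### Determination of the parameter `α` -/

noncomputable section

namespace SUSY

open MvPolynomial

lemma FullComp.Base.isFermi {I : FullComp} {i : Comp} (h : I.Base i) : i.IsFermi ↔ I.IsFermi := by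
  cases I <;> cases i <;> simp_all [FullComp.Base, Comp.IsFermi, FullComp.IsFermi]

lemma Comp.conj_isFermi (i : Comp) : i.conj.IsFermi ↔ i.IsFermi := by
  cases i <;> simp [Comp.conj, Comp.IsFermi]

open Classical in
/-- The sign of the graded bracket. -/
def fullSign (I J : FullComp) : ℂ := if I.IsFermi ∧ J.IsFermi then 1 else -1

lemma fullSign_sq (I J : FullComp) : fullSign I J * fullSign I J = 1 := by
  unfold fullSign; split_ifs <;> simp

lemma conj_fullSign (I J : FullComp) : (starRingEnd ℂ) (fullSign I J) = fullSign I J := by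
  unfold fullSign; split_ifs <;> simp

lemma fullSign_eq_one {I J : FullComp} (hI : I.IsFermi) (hJ : J.IsFermi) : fullSign I J = 1 :=
  if_pos ⟨hI, hJ⟩

lemma fullSign_eq_neg_one {I J : FullComp} (h : ¬(I.IsFermi ∧ J.IsFermi)) : fullSign I J = -1 :=
  if_neg h

open Classical in
lemma brk_fullSign {𝒜 : Type*} [Ring 𝒜] [Algebra ℂ 𝒜] (I J : FullComp) (φ ψ : Test →ₗ[ℂ] 𝒜)
    (f g : Test) : (if I.IsFermi ∧ J.IsFermi then acomm (φ f) (ψ g) else comm (φ f) (ψ g)) =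
      brk (fullSign I J) φ ψ f g := by
  unfold fullSign
  split_ifs
  · rw [brk_one]
  · rw [brk_neg_one]

lemma full_nonzero {𝒜 : Type*} [Ring 𝒜] [Algebra ℂ 𝒜] {m : ℝ} {η : ℂ} {φ ψ : Test →ₗ[ℂ] 𝒜} {s : (Fin 4 → ℂ) → ℂ}
    {p : MvPolynomial (Fin 4) ℂ} {f g : Test} {I J : FullComp} (hη : fullSign I J = η)
    (hs : HasSymbol m η φ ψ s) (hp : ∀ v, s v = eval v p) :
    brk (fullSign I J) φ ψ f g = algebraMap ℂ 𝒜 (causalKernel m p f g) := by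
  rw [hη, hs.kernel fun v _ => hp v]

namespace ReducedMultiplet

variable {𝒜 : Type*} [Ring 𝒜] [StarRing 𝒜] [Algebra ℂ 𝒜] [StarModule ℂ 𝒜] {m : ℝ}
  (M : ReducedMultiplet m 𝒜)

lemma hasSymbol_z_D : HasSymbol m (-1) M.z (M.fullField .D) (fun _ => 2 * (m : ℂ) ^ 2) := by
  rw [fullField_D]
  refine (M.hasSymbol_z_zStar.smul_right _).congr fun v _ => ?_
  linear_combination -2 * (m : ℂ) ^ 2 * Complex.I_sq

variable [Nontrivial 𝒜]

lemma brk_field_eq_zero {I J : FullComp} {i j : Comp} (hi : i.IsFermi ↔ I.IsFermi)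
    (hj : j.IsFermi ↔ J.IsFermi) (ht : reducedTable m i j = 0) (f g : Test) :
    brk (fullSign I J) (M.field i) (M.field j) f g = 0 := by
  by_cases h : i.IsFermi ∧ j.IsFermi
  · rw [fullSign_eq_one (hi.1 h.1) (hj.1 h.2)]
    exact M.acomm_field_eq_zero h.1 h.2 ht f g
  · rw [fullSign_eq_neg_one (by rwa [← hi, ← hj])]
    exact M.comm_field_eq_zero h ht f g

lemma full_zero {I J : FullComp} {p : MvPolynomial (Fin 4) ℂ} (hp : p = 0)
    (h : ∀ i j, I.Base i → J.Base j → reducedTable m i j = 0) (f g : Test) :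
    brk (fullSign I J) (M.fullField I) (M.fullField J) f g =
      algebraMap ℂ 𝒜 (causalKernel m p f g) := by
  rw [hp, causalKernel_zero, map_zero]
  exact M.brk_fullField_eq_zero (fullSign_sq I J)
    (fun i j hi hj => M.brk_field_eq_zero hi.isFermi hj.isFermi (h i j hi hj)) f g

lemma full_star_zero {I J : FullComp} {p : MvPolynomial (Fin 4) ℂ} (hp : p = 0)
    (h : ∀ i j, I.Base i → J.Base j → reducedTable m i j.conj = 0) (f g : Test) :
    brk (fullSign I J) (M.fullField I) (adj (M.fullField J)) f g =
      algebraMap ℂ 𝒜 (causalKernel m p f g) := by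
  rw [hp, causalKernel_zero, map_zero]
  exact M.brk_fullField_adj_eq_zero (conj_fullSign I J) (fullSign_sq I J)
    (fun i j hi hj => M.brk_field_eq_zero hi.isFermi (j.conj_isFermi.trans hj.isFermi)
      (h i j hi hj)) f g

lemma hasFullCommutators : M.HasFullCommutators m (2 * (m : ℂ) ^ 2) := by
  intro I J f g
  rw [brk_fullSign, brk_fullSign]
  constructor
  · cases I <;> cases J
    case z.D => exact full_nonzero (fullSign_eq_neg_one fun h => h.1) M.hasSymbol_z_D (by simp [fullTable])
    case D.z =>
      exact full_nonzero (fullSign_eq_neg_one fun h => h.1) (M.hasSymbol_z_D.swap (by simp))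
        (by simp [fullTable])
    case F.F =>
      exact full_nonzero (fullSign_eq_neg_one fun h => h.1) (M.hasSymbol_Fab_Fab _ _ _ _)
        (by simp [fullTable])
    case C.C =>
      refine full_nonzero (fullSign_eq_neg_one fun h => h.1) (M.hasSymbol_C_C _ _ _ _) fun v => ?_
      simp only [fullTable, eval_C]; ring
    case chi.lam =>
      refine full_nonzero (fullSign_eq_one trivial trivial)
        ((M.hasSymbol_lam_chi _ _ _ _).swap (by simp)) fun v => ?_
      rename_i j a k b
      simp only [fullTable, eval_C]
      rw [epsL_antisymm b a, epsL_antisymm k j]; ring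
    case lam.chi =>
      refine full_nonzero (fullSign_eq_one trivial trivial) (M.hasSymbol_lam_chi _ _ _ _)
        fun v => ?_
      rename_i j a k b
      simp only [fullTable, eval_C]
      rw [epsL_antisymm b a, epsL_antisymm k j]; ring
    all_goals
      refine M.full_zero rfl (fun i j hi hj => ?_) f g
      -- For each remaining pair, all brackets of the constituents are zero entries of
      -- `reducedTable`.
      cases i <;> first | exact hi.elim | (cases j <;> first | exact hj.elim | rfl)
  · cases I <;> cases J
    case z.z =>
      exact full_nonzero (fullSign_eq_neg_one fun h => h.1) M.hasSymbol_z_zStar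
        (by simp [fullStarTable])
    case D.D =>
      rw [adj_fullField_D, fullField_D]
      refine full_nonzero (fullSign_eq_neg_one fun h => h.1)
        ((M.hasSymbol_zStar_z.smul_left _).smul_right _) fun v => ?_
      simp only [fullStarTable, eval_C]
      linear_combination 4 * Complex.I * (m : ℂ) ^ 4 * Complex.I_sq
    case F.F =>
      exact full_nonzero (fullSign_eq_neg_one fun h => h.1) (M.hasSymbol_Fab_adj_Fab _ _ _ _)
        (by simp [fullStarTable])
    case C.C =>
      exact full_nonzero (fullSign_eq_neg_one fun h => h.1) (M.hasSymbol_C_CStar _ _ _ _)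
        (by simp [fullStarTable])
    case chi.chi =>
      exact full_nonzero (fullSign_eq_one trivial trivial) (M.hasSymbol_chi_chiBar _ _ _ _)
        (by simp [fullStarTable])
    case lam.lam =>
      exact full_nonzero (fullSign_eq_one trivial trivial) (M.hasSymbol_lam_adj_lam _ _ _ _)
        (by simp [fullStarTable])
    all_goals
      refine M.full_star_zero rfl (fun i j hi hj => ?_) f g
      cases i <;> first | exact hi.elim | (cases j <;> first | exact hj.elim | rfl)

/-- For necessity the relation `[z, D] = α D_m` is enough: two constant symbols of one bracket are
compared at a single point of the shell. -/
theorem hasFullCommutators_iff (α : ℂ) :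
    M.HasFullCommutators m α ↔ α = 2 * (m : ℂ) ^ 2 := by
  refine ⟨fun h => ?_, fun h => h ▸ M.hasFullCommutators⟩
  obtain ⟨v, hv⟩ := Shell.nonempty m
  have h1 : HasSymbol m (-1) M.z (M.fullField .D) (fun _ => α) :=
    ⟨C α, by simp, fun f g => by
      have := (h .z .D f g).1
      rw [brk_fullSign, fullSign_eq_neg_one (by exact fun h => h.1)] at this
      exact this⟩
  exact h1.unique M.hasSymbol_z_D hv

end ReducedMultiplet

end SUSY
end

noncomputable section

namespace SUSY

open MvPolynomial MeasureTheory Filter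

/-! ### Positivity of the two-point functions -/

/-- The factor `i` of `D_m^{(+)}` is absorbed into the symbol, which becomes the matrix of a
sesquilinear form in the transforms at each momentum. -/
lemma plusKernel_conjTest (m : ℝ) (p : MvPolynomial (Fin 4) ℂ) (f g : Test) :
    plusKernel m p (conjTest f) g = ((1 / (2 * Real.pi) ^ 3 : ℝ) : ℂ) *
      ∫ k, Complex.I * eval (shellVec m k) p *
        ((starRingEnd ℂ) (shellFourier m 1 f k) * shellFourier m 1 g k) / (2 * energy m k : ℂ) := by
  have h : ∀ k, Complex.I * eval (shellVec m k) p *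
        ((starRingEnd ℂ) (shellFourier m 1 f k) * shellFourier m 1 g k) / (2 * energy m k : ℂ) =
      Complex.I * (eval (shellVec m k) p * (shellFourier m (-1) (conjTest f) k *
        shellFourier m 1 g k) / (2 * energy m k : ℂ)) := fun k => by
    rw [shellFourier_conjTest, neg_neg]; ring
  simp only [h, integral_const_mul]
  rw [plusKernel_eq]
  push_cast
  ring

lemma integrable_plus (m : ℝ) (p : MvPolynomial (Fin 4) ℂ) (f g : Test) :
    Integrable fun k => Complex.I * eval (shellVec m k) p *
        ((starRingEnd ℂ) (shellFourier m 1 f k) * shellFourier m 1 g k) / (2 * energy m k : ℂ) := by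
  refine ((integrable_upper m p (conjTest f) g).const_mul Complex.I).congr
    (Eventually.of_forall fun k => ?_)
  simp only [shellFourier_conjTest, neg_neg]
  ring

/-- The quadratic form of the one-particle states at the momentum `k`. -/
def shellForm (m : ℝ) (T : Comp → Comp → MvPolynomial (Fin 4) ℂ) (k : EuclideanSpace ℝ (Fin 3))
    (x : Comp → ℂ) : ℂ :=
  ∑ I, ∑ J, Complex.I * eval (shellVec m k) (T I.conj J) * ((starRingEnd ℂ) (x I) * x J)

lemma oneParticleNormSq_eq (m : ℝ) (T : Comp → Comp → MvPolynomial (Fin 4) ℂ) (f : Comp → Test) :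
    oneParticleNormSq m T f = ((1 / (2 * Real.pi) ^ 3 : ℝ) : ℂ) *
      ∫ k, shellForm m T k (fun I => shellFourier m 1 (f I) k) / (2 * energy m k : ℂ) := by
  simp only [oneParticleNormSq, plusKernel_conjTest, ← Finset.mul_sum]
  congr 1
  simp only [shellForm, Finset.sum_div]
  rw [integral_finsetSum _ fun I _ => integrable_finsetSum _ fun J _ => integrable_plus m _ _ _]
  refine Finset.sum_congr rfl fun I _ => ?_
  rw [integral_finsetSum _ fun J _ => integrable_plus m _ _ _]

lemma oneParticleNormSq_nonneg {m : ℝ} {T : Comp → Comp → MvPolynomial (Fin 4) ℂ}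
    (h : ∀ k x, ∃ r : ℝ, 0 ≤ r ∧ shellForm m T k x = r) (f : Comp → Test) :
    0 ≤ (oneParticleNormSq m T f).re ∧ (oneParticleNormSq m T f).im = 0 := by
  choose r hr hf using h
  have e : oneParticleNormSq m T f = ((1 / (2 * Real.pi) ^ 3 *
      ∫ k, r k (fun I => shellFourier m 1 (f I) k) / (2 * energy m k) : ℝ) : ℂ) := by
    rw [oneParticleNormSq_eq, Complex.ofReal_mul, ← integral_complex_ofReal]
    congr 2
    funext k
    rw [hf]; push_cast; rfl
  rw [e, Complex.ofReal_re, Complex.ofReal_im]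
  refine ⟨mul_nonneg (by positivity) (integral_nonneg fun k => ?_), rfl⟩
  exact div_nonneg (hr _ _) (mul_nonneg zero_le_two (energy_nonneg m k))

/-- Continuity spreads positivity from one momentum to an open set avoiding the apex, which has
positive measure. -/
lemma integral_shell_pos {m : ℝ} {r : EuclideanSpace ℝ (Fin 3) → ℝ} (hc : Continuous r)
    (h0 : ∀ k, 0 ≤ r k) (hi : Integrable fun k => r k / (2 * energy m k))
    {k₀ : EuclideanSpace ℝ (Fin 3)} (hk₀ : k₀ ≠ 0) (hr : 0 < r k₀) :
    0 < ∫ k, r k / (2 * energy m k) := by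
  rw [integral_pos_iff_support_of_nonneg (fun k => div_nonneg (h0 k)
    (mul_nonneg zero_le_two (energy_nonneg m k))) hi]
  have ho : IsOpen ({k | 0 < r k} ∩ {0}ᶜ) :=
    (isOpen_lt continuous_const hc).inter isOpen_compl_singleton
  refine (ho.measure_pos volume ⟨k₀, hr, hk₀⟩).trans_le (measure_mono ?_)
  rintro k ⟨hk, hk0⟩
  have := energy_pos m (k := k) hk0
  have hk' : 0 < r k := hk
  exact (div_pos hk' (by positivity)).ne'

lemma exists_plusKernel_pos {m : ℝ} {p : MvPolynomial (Fin 4) ℂ}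
    {c : EuclideanSpace ℝ (Fin 3) → ℝ} (h0 : ∀ k, 0 ≤ c k) {k₀ : EuclideanSpace ℝ (Fin 3)}
    (hk₀ : k₀ ≠ 0) (hr : 0 < c k₀) (hp : ∀ k, Complex.I * eval (shellVec m k) p = c k) :
    ∃ f : Test, 0 < (plusKernel m p (conjTest f) f).re := by
  -- The conjugate of the bump function has transform 1 at `k₀` for the opposite sign of the
  -- exponent, as required here.
  obtain ⟨f, hf, -⟩ := exists_bump m hk₀
  refine ⟨conjTest f, ?_⟩
  have hc : Continuous c := by
    have : c = fun k => (Complex.I * eval (shellVec m k) p).re := funext fun k => by rw [hp]; simp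
    rw [this]
    fun_prop
  have hi := integrable_plus m p (conjTest f) (conjTest f)
  have e : ∀ k, Complex.I * eval (shellVec m k) p * ((starRingEnd ℂ)
      (shellFourier m 1 (conjTest f) k) * shellFourier m 1 (conjTest f) k) / (2 * energy m k : ℂ) =
      ((c k * Complex.normSq (shellFourier m 1 (conjTest f) k) / (2 * energy m k) : ℝ) : ℂ) := by
    intro k
    rw [hp, ← Complex.normSq_eq_conj_mul_self]; push_cast; rfl
  rw [plusKernel_conjTest]
  simp only [e] at hi ⊢
  rw [integral_complex_ofReal, ← Complex.ofReal_mul, Complex.ofReal_re]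
  refine mul_pos (by positivity) (integral_shell_pos ?_ (fun k => mul_nonneg (h0 k)
    (Complex.normSq_nonneg _)) hi.re hk₀ ?_)
  · exact hc.mul (Complex.continuous_normSq.comp (by fun_prop))
  · rw [shellFourier_conjTest, hf]
    simpa using hr

/-- The components as a disjoint union. -/
def compEquiv : Unit ⊕ Unit ⊕ (Fin 4 × Fin 4) ⊕ (Fin 2 × Fin 2) ⊕ (Fin 2 × Fin 2) ⊕
    (Fin 2 × Fin 2) ⊕ (Fin 2 × Fin 2) ≃ Comp where
  toFun
    | .inl _ => .z
    | .inr (.inl _) => .zStar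
    | .inr (.inr (.inl p)) => .F p.1 p.2
    | .inr (.inr (.inr (.inl p))) => .C p.1 p.2
    | .inr (.inr (.inr (.inr (.inl p)))) => .CStar p.1 p.2
    | .inr (.inr (.inr (.inr (.inr (.inl p))))) => .chi p.1 p.2
    | .inr (.inr (.inr (.inr (.inr (.inr p))))) => .chiBar p.1 p.2
  invFun
    | .z => .inl ()
    | .zStar => .inr (.inl ())
    | .F μ ν => .inr (.inr (.inl (μ, ν)))
    | .C j k => .inr (.inr (.inr (.inl (j, k))))
    | .CStar j k => .inr (.inr (.inr (.inr (.inl (j, k)))))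
    | .chi j k => .inr (.inr (.inr (.inr (.inr (.inl (j, k))))))
    | .chiBar j k => .inr (.inr (.inr (.inr (.inr (.inr (j, k))))))
  left_inv := by rintro (_ | _ | _ | _ | _ | _ | _) <;> rfl
  right_inv := by rintro (_ | _) <;> rfl

lemma sum_comp (h : Comp → ℂ) : ∑ I, h I = h .z + (h .zStar + ((∑ μ, ∑ ν, h (.F μ ν)) +
    ((∑ j, ∑ k, h (.C j k)) + ((∑ j, ∑ k, h (.CStar j k)) + ((∑ j, ∑ k, h (.chi j k)) +
      ∑ j, ∑ k, h (.chiBar j k)))))) := by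
  rw [← compEquiv.sum_comp h]
  simp only [Fintype.sum_sum_type, Fintype.sum_prod_type, compEquiv, Equiv.coe_fn_mk,
    Finset.univ_unique, Finset.sum_singleton]

end SUSY
end

/-! ### Hermitian forms at a fixed momentum -/

noncomputable section

namespace SUSY

open MvPolynomial MeasureTheory Filter

lemma waveVec_zero_pos {m : ℝ} (hm : 0 < m) (k : EuclideanSpace ℝ (Fin 3)) :
    0 < waveVec m k 0 := by
  have h : waveVec m k 0 = energy m k := rfl
  rw [h, energy]
  positivity

lemma waveVec_sq (m : ℝ) (k : EuclideanSpace ℝ (Fin 3)) :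
    waveVec m k 0 ^ 2 = waveVec m k 1 ^ 2 + waveVec m k 2 ^ 2 + waveVec m k 3 ^ 2 + m ^ 2 := by
  have h := energy_sq m k
  simp only [waveVec]
  simpa using h

lemma abs_waveVec_lt {m : ℝ} (hm : 0 < m) (k : EuclideanSpace ℝ (Fin 3)) :
    |waveVec m k 3| < waveVec m k 0 := by
  refine abs_lt_of_sq_lt_sq ?_ (waveVec_zero_pos hm k).le
  rw [waveVec_sq m k]
  nlinarith [sq_nonneg (waveVec m k 1), sq_nonneg (waveVec m k 2), pow_pos hm 2]

/-- A vector orthogonal to a timelike one is spacelike. -/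
lemma sq_le_of_orthogonal {q a : Fin 4 → ℝ} {m : ℝ} (h0 : 0 < q 0)
    (hq : q 0 ^ 2 = q 1 ^ 2 + q 2 ^ 2 + q 3 ^ 2 + m ^ 2)
    (h : q 0 * a 0 + q 1 * a 1 + q 2 * a 2 + q 3 * a 3 = 0) :
    a 0 ^ 2 ≤ a 1 ^ 2 + a 2 ^ 2 + a 3 ^ 2 := by
  have h1 : q 0 * a 0 = -(q 1 * a 1 + q 2 * a 2 + q 3 * a 3) := by linarith
  have h2 : q 0 ^ 2 * a 0 ^ 2 ≤ q 0 ^ 2 * (a 1 ^ 2 + a 2 ^ 2 + a 3 ^ 2) := by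
    rw [← mul_pow, h1, hq]
    have : 0 ≤ m ^ 2 * (a 1 ^ 2 + a 2 ^ 2 + a 3 ^ 2) := by positivity
    -- Lagrange's identity: these squares are the deficit in the Cauchy–Schwarz inequality for the
    -- spatial parts.
    nlinarith [sq_nonneg (q 1 * a 2 - q 2 * a 1), sq_nonneg (q 1 * a 3 - q 3 * a 1),
      sq_nonneg (q 2 * a 3 - q 3 * a 2)]
  exact le_of_mul_le_mul_left h2 (by positivity)

/-- The Hermitian form `q_μ σ^μ` is non-negative for `q` timelike and future directed. -/
lemma hermitianForm_nonneg {q : Fin 4 → ℝ} {m : ℝ} (h0 : |q 3| < q 0)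
    (hq : q 0 ^ 2 = q 1 ^ 2 + q 2 ^ 2 + q 3 ^ 2 + m ^ 2) (x y : ℂ) :
    0 ≤ (q 0 + q 3) * Complex.normSq x + (q 0 - q 3) * Complex.normSq y +
      2 * (q 1 * (x.re * y.re + x.im * y.im) + q 2 * (x.re * y.im - x.im * y.re)) := by
  have h3 : 0 < q 0 + q 3 := by linarith [neg_abs_le (q 3)]
  refine le_of_mul_le_mul_left (a := q 0 + q 3) ?_ h3
  rw [mul_zero]
  simp only [Complex.normSq_apply]
  have e : (q 0 + q 3) * (q 0 - q 3) = q 1 ^ 2 + q 2 ^ 2 + m ^ 2 := by linarith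
  -- Completing the square; the determinant of the form is `m²`, which leaves the last term.
  have : (q 0 + q 3) * ((q 0 + q 3) * (x.re * x.re + x.im * x.im) +
      (q 0 - q 3) * (y.re * y.re + y.im * y.im) +
      2 * (q 1 * (x.re * y.re + x.im * y.im) + q 2 * (x.re * y.im - x.im * y.re))) =
      ((q 0 + q 3) * x.re + q 1 * y.re + q 2 * y.im) ^ 2 +
      ((q 0 + q 3) * x.im + q 1 * y.im - q 2 * y.re) ^ 2 + m ^ 2 * (y.re ^ 2 + y.im ^ 2) := by
    linear_combination (y.re * y.re + y.im * y.im) * e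
  rw [this]
  positivity

lemma I_mul_eval_sum_pauli (m : ℝ) (k : EuclideanSpace ℝ (Fin 3)) (a b : Fin 2) :
    Complex.I * eval (shellVec m k) (∑ μ, C (pauli μ a b) * X μ) =
      ∑ μ, pauli μ a b * (waveVec m k μ : ℂ) := by
  simp only [map_sum, map_mul, eval_C, eval_X, shellVec, Finset.mul_sum]
  refine Finset.sum_congr rfl fun μ _ => ?_
  linear_combination (-(pauli μ a b * (waveVec m k μ : ℂ))) * Complex.I_sq

lemma I_mul_symFF (m : ℝ) (k : EuclideanSpace ℝ (Fin 3)) (μ ν ρ l : Fin 4) :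
    Complex.I * symFF (shellVec m k) μ ν ρ l =
      -(1 / 2) * (gM μ ρ * waveVec m k ν * waveVec m k l - gM ν ρ * waveVec m k μ * waveVec m k l +
        gM ν l * waveVec m k μ * waveVec m k ρ - gM μ l * waveVec m k ν * waveVec m k ρ) := by
  unfold symFF shellVec
  ring_nf
  simp only [Complex.I_pow_four]
  ring

lemma sum_gM_mul (g : Fin 4 → ℂ) (μ : Fin 4) : ∑ ρ, gM μ ρ * g ρ = gdiag μ * g μ := by
  simp [gM]

/-- The form of the tensor field is `-½ g_{μμ} |w^μ|²` with `w^μ = (x^{μν} - x^{νμ}) q_ν`. -/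
lemma tensorForm_eq (q : Fin 4 → ℝ) (x : Fin 4 → Fin 4 → ℂ) :
    ∑ μ, ∑ ν, ∑ ρ, ∑ l, -(1 / 2) * (gM μ ρ * q ν * q l - gM ν ρ * q μ * q l +
        gM ν l * q μ * q ρ - gM μ l * q ν * q ρ) * ((starRingEnd ℂ) (x μ ν) * x ρ l) =
      ((-(1 / 2) * ∑ μ, (![1, -1, -1, -1] : Fin 4 → ℝ) μ *
        Complex.normSq (∑ ν, (x μ ν - x ν μ) * q ν) : ℝ) : ℂ) := by
  have h : ∀ μ ν, ∑ ρ, ∑ l, -(1 / 2) * (gM μ ρ * q ν * q l - gM ν ρ * q μ * q l +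
        gM ν l * q μ * q ρ - gM μ l * q ν * q ρ) * ((starRingEnd ℂ) (x μ ν) * x ρ l) =
      -(1 / 2) * (starRingEnd ℂ) (x μ ν) * (gdiag μ * (q ν * ∑ l, (x μ l - x l μ) * q l) -
        gdiag ν * (q μ * ∑ l, (x ν l - x l ν) * q l)) := fun μ ν => by
    have e : ∀ ρ l, -(1 / 2) * (gM μ ρ * q ν * q l - gM ν ρ * q μ * q l +
        gM ν l * q μ * q ρ - gM μ l * q ν * q ρ) * ((starRingEnd ℂ) (x μ ν) * x ρ l) =
        -(1 / 2) * (starRingEnd ℂ) (x μ ν) * (gM μ ρ * (q ν * (x ρ l * q l)) -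
          gM ν ρ * (q μ * (x ρ l * q l)) + gM ν l * (q μ * (x ρ l * q ρ)) -
          gM μ l * (q ν * (x ρ l * q ρ))) := fun ρ l => by ring
    simp only [e, ← Finset.mul_sum, Finset.sum_add_distrib, Finset.sum_sub_distrib, sum_gM_mul]
    simp only [sub_mul, Finset.sum_sub_distrib]
    ring
  simp only [h]
  push_cast [Complex.normSq_eq_conj_mul_self]
  simp [Fin.sum_univ_four, gdiag]
  ring

lemma tensorForm_nonneg {q : Fin 4 → ℝ} {m : ℝ} (h0 : 0 < q 0)
    (hq : q 0 ^ 2 = q 1 ^ 2 + q 2 ^ 2 + q 3 ^ 2 + m ^ 2) (x : Fin 4 → Fin 4 → ℂ) :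
    0 ≤ -(1 / 2) * ∑ μ, (![1, -1, -1, -1] : Fin 4 → ℝ) μ *
        Complex.normSq (∑ ν, (x μ ν - x ν μ) * q ν) := by
  set w : Fin 4 → ℂ := fun μ => ∑ ν, (x μ ν - x ν μ) * q ν
  -- An antisymmetric tensor contracted twice with `q` vanishes.
  have hw : (q 0 : ℂ) * w 0 + q 1 * w 1 + q 2 * w 2 + q 3 * w 3 = 0 := by
    simp [w, Fin.sum_univ_four]; ring
  have hr := congrArg Complex.re hw
  have hi := congrArg Complex.im hw
  simp at hr hi
  have h1 := sq_le_of_orthogonal (a := fun μ => (w μ).re) h0 hq hr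
  have h2 := sq_le_of_orthogonal (a := fun μ => (w μ).im) h0 hq hi
  have e : ∀ μ, (∑ ν, (x μ ν - x ν μ) * q ν) = w μ := fun μ => rfl
  simp only [e, Fin.sum_univ_four, Complex.normSq_apply]
  simp
  linarith

/-- The coefficients of `C` and `C*` enter only through combinations respecting the reality
condition, so the form is degenerate. The overall factor `m²` is what makes `C` null at `m = 0`. -/
lemma scalarForm_eq (m : ℝ) (c d : Fin 2 → Fin 2 → ℂ) :
    ∑ j, ∑ k, ((∑ l, ∑ n, 2 * (m : ℂ) ^ 2 * (kd j l * kd k n + kd j n * kd k l) *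
        ((starRingEnd ℂ) (c j k) * c l n)) +
      ∑ l, ∑ n, 2 * (m : ℂ) ^ 2 * (epsL j l * epsL k n + epsL j n * epsL k l) *
        ((starRingEnd ℂ) (c j k) * d l n)) +
    ∑ j, ∑ k, ((∑ l, ∑ n, 2 * (m : ℂ) ^ 2 * (epsL j l * epsL k n + epsL j n * epsL k l) *
        ((starRingEnd ℂ) (d j k) * c l n)) +
      ∑ l, ∑ n, 2 * (m : ℂ) ^ 2 * (kd j l * kd k n + kd j n * kd k l) *
        ((starRingEnd ℂ) (d j k) * d l n)) =
    ((2 * m ^ 2 * (2 * Complex.normSq (c 0 0 + d 1 1) + 2 * Complex.normSq (c 1 1 + d 0 0) +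
      Complex.normSq (c 0 1 + c 1 0 - d 0 1 - d 1 0)) : ℝ) : ℂ) := by
  push_cast [Complex.normSq_eq_conj_mul_self]
  simp [Fin.sum_univ_two, kd, epsL]
  ring

/-- Transposition changes only the sign of `σ₂`, the sole difference from `spinorForm_transpose_eq`.
-/
lemma spinorForm_eq (q : Fin 4 → ℝ) (x : Fin 2 → ℂ) :
    ∑ a, ∑ b, (∑ μ, pauli μ b a * (q μ : ℂ)) * ((starRingEnd ℂ) (x a) * x b) =
      (((q 0 + q 3) * Complex.normSq (x 0) + (q 0 - q 3) * Complex.normSq (x 1) +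
      2 * (q 1 * ((x 0).re * (x 1).re + (x 0).im * (x 1).im) +
        q 2 * (-((x 0).re * (x 1).im - (x 0).im * (x 1).re))) : ℝ) : ℂ) := by
  apply Complex.ext <;>
  simp [Fin.sum_univ_two, Fin.sum_univ_four, pauli, Complex.normSq_apply] <;> ring

lemma spinorForm_transpose_eq (q : Fin 4 → ℝ) (x : Fin 2 → ℂ) :
    ∑ a, ∑ b, (∑ μ, pauli μ a b * (q μ : ℂ)) * ((starRingEnd ℂ) (x a) * x b) =
      (((q 0 + q 3) * Complex.normSq (x 0) + (q 0 - q 3) * Complex.normSq (x 1) +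
      2 * (q 1 * ((x 0).re * (x 1).re + (x 0).im * (x 1).im) +
        q 2 * ((x 0).re * (x 1).im - (x 0).im * (x 1).re)) : ℝ) : ℂ) := by
  apply Complex.ext <;>
  simp [Fin.sum_univ_two, Fin.sum_univ_four, pauli, Complex.normSq_apply] <;> ring

end SUSY
end

/-! ### Positivity for the listed two-point functions -/

noncomputable section

namespace SUSY

open MvPolynomial MeasureTheory Filter

lemma I_mul_eval_scalar (v : Fin 4 → ℂ) (m : ℝ) (e : ℂ) :
    Complex.I * eval v (C (-2 * Complex.I * m ^ 2 * e)) = 2 * (m : ℂ) ^ 2 * e := by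
  rw [eval_C]
  linear_combination (-2 * (m : ℂ) ^ 2 * e) * Complex.I_sq

lemma I_mul_eval_table_F (m : ℝ) (k : EuclideanSpace ℝ (Fin 3)) (μ ν ρ l : Fin 4) :
    Complex.I * eval (shellVec m k) (reducedTable m (.F μ ν) (.F ρ l)) =
      -(1 / 2) * (gM μ ρ * waveVec m k ν * waveVec m k l - gM ν ρ * waveVec m k μ * waveVec m k l +
        gM ν l * waveVec m k μ * waveVec m k ρ - gM μ l * waveVec m k ν * waveVec m k ρ) := by
  rw [← I_mul_symFF]
  simp [reducedTable, symFF]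

lemma I_mul_eval_spinor (m : ℝ) (k : EuclideanSpace ℝ (Fin 3)) (c : ℂ) (a b : Fin 2) :
    Complex.I * eval (shellVec m k) (C c * ∑ μ, C (pauli μ a b) * X μ) =
      c * ∑ μ, pauli μ a b * (waveVec m k μ : ℂ) := by
  rw [← I_mul_eval_sum_pauli, map_mul, eval_C]
  ring

/-- The zero entries of the table make the form block diagonal: `z`, `z*`, `F`, the pair `C`, `C*`,
and each isospin component of `χ` and of `χ̄`. -/
lemma shellForm_reducedTable (m : ℝ) (k : EuclideanSpace ℝ (Fin 3)) (x : Comp → ℂ) :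
    shellForm m (reducedTable m) k x =
      ((Complex.normSq (x .z) + Complex.normSq (x .zStar) : ℝ) : ℂ) +
      (∑ μ, ∑ ν, ∑ ρ, ∑ l, Complex.I * eval (shellVec m k) (reducedTable m (.F μ ν) (.F ρ l)) *
        ((starRingEnd ℂ) (x (.F μ ν)) * x (.F ρ l))) +
      (∑ j, ∑ k, ((∑ l, ∑ n, 2 * (m : ℂ) ^ 2 * (kd j l * kd k n + kd j n * kd k l) *
        ((starRingEnd ℂ) (x (.C j k)) * x (.C l n))) +
      ∑ l, ∑ n, 2 * (m : ℂ) ^ 2 * (epsL j l * epsL k n + epsL j n * epsL k l) *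
        ((starRingEnd ℂ) (x (.C j k)) * x (.CStar l n))) +
      ∑ j, ∑ k, ((∑ l, ∑ n, 2 * (m : ℂ) ^ 2 * (epsL j l * epsL k n + epsL j n * epsL k l) *
        ((starRingEnd ℂ) (x (.CStar j k)) * x (.C l n))) +
      ∑ l, ∑ n, 2 * (m : ℂ) ^ 2 * (kd j l * kd k n + kd j n * kd k l) *
        ((starRingEnd ℂ) (x (.CStar j k)) * x (.CStar l n)))) +
      2 * ∑ j, ((∑ a, ∑ b, (∑ μ, pauli μ b a * (waveVec m k μ : ℂ)) *
          ((starRingEnd ℂ) (x (.chi j a)) * x (.chi j b))) +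
        ∑ a, ∑ b, (∑ μ, pauli μ a b * (waveVec m k μ : ℂ)) *
          ((starRingEnd ℂ) (x (.chiBar j a)) * x (.chiBar j b))) := by
  have hz : ∀ y : ℂ, Complex.I * eval (shellVec m k) (C (-Complex.I)) *
      ((starRingEnd ℂ) y * y) = (Complex.normSq y : ℂ) := fun y => by
    rw [Complex.normSq_eq_conj_mul_self, eval_C]
    linear_combination (-((starRingEnd ℂ) y * y)) * Complex.I_sq
  have hd : ∀ (j : Fin 2) (g h : Fin 2 → Fin 2 → ℂ),
      ∑ l, ∑ b, 2 * kd j l * g l b * h l b = 2 * ∑ b, g j b * h j b := fun j g h => by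
    simp [kd, mul_assoc, ← Finset.mul_sum]
  have hd' : ∀ (j : Fin 2) (g h : Fin 2 → Fin 2 → ℂ),
      ∑ l, ∑ b, 2 * kd l j * g l b * h l b = 2 * ∑ b, g j b * h j b := fun j g h => by
    simp [kd, mul_assoc, ← Finset.mul_sum]
  rw [shellForm]
  simp only [sum_comp, Comp.conj, reducedTable, map_zero, mul_zero, zero_mul,
    Finset.sum_const_zero, add_zero, zero_add, hz, I_mul_eval_scalar, I_mul_eval_spinor]
  have e1 : ∀ j a, ∑ l, ∑ b, 2 * kd l j * (∑ μ, pauli μ b a * (waveVec m k μ : ℂ)) *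
      ((starRingEnd ℂ) (x (.chi j a)) * x (.chi l b)) =
      2 * ∑ b, (∑ μ, pauli μ b a * (waveVec m k μ : ℂ)) *
      ((starRingEnd ℂ) (x (.chi j a)) * x (.chi j b)) := fun j a =>
    hd' j (fun _ b => ∑ μ, pauli μ b a * (waveVec m k μ : ℂ))
      fun l b => (starRingEnd ℂ) (x (.chi j a)) * x (.chi l b)
  have e2 : ∀ j a, ∑ l, ∑ b, 2 * kd j l * (∑ μ, pauli μ a b * (waveVec m k μ : ℂ)) *
      ((starRingEnd ℂ) (x (.chiBar j a)) * x (.chiBar l b)) =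
      2 * ∑ b, (∑ μ, pauli μ a b * (waveVec m k μ : ℂ)) *
      ((starRingEnd ℂ) (x (.chiBar j a)) * x (.chiBar j b)) := fun j a =>
    hd j (fun _ b => ∑ μ, pauli μ a b * (waveVec m k μ : ℂ))
      fun l b => (starRingEnd ℂ) (x (.chiBar j a)) * x (.chiBar l b)
  simp only [e1, e2, ← Finset.mul_sum, Finset.sum_add_distrib]
  push_cast
  ring

lemma shellForm_reducedTable_nonneg {m : ℝ} (hm : 0 < m) (k : EuclideanSpace ℝ (Fin 3))
    (x : Comp → ℂ) : ∃ r : ℝ, 0 ≤ r ∧ shellForm m (reducedTable m) k x = r := by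
  have h0 := waveVec_zero_pos hm k
  have hq := waveVec_sq m k
  have h3 := abs_waveVec_lt hm k
  rw [shellForm_reducedTable]
  simp only [I_mul_eval_table_F]
  rw [tensorForm_eq (fun μ => waveVec m k μ) fun μ ν => x (.F μ ν),
    scalarForm_eq m (fun j k => x (.C j k)) fun j k => x (.CStar j k)]
  simp only [fun j => spinorForm_eq (fun μ => waveVec m k μ) fun a => x (.chi j a),
    fun j => spinorForm_transpose_eq (fun μ => waveVec m k μ) fun a => x (.chiBar j a)]
  have hF := tensorForm_nonneg (q := fun μ => waveVec m k μ) h0 hq fun μ ν => x (.F μ ν)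
  -- The form of `χ` contains the transposed Pauli matrices; it is the untransposed form at complex
  -- conjugate arguments.
  have hχ := fun j => hermitianForm_nonneg (q := fun μ => waveVec m k μ) h3 hq
    ((starRingEnd ℂ) (x (.chi j 0))) ((starRingEnd ℂ) (x (.chi j 1)))
  have hχ' := fun j => hermitianForm_nonneg (q := fun μ => waveVec m k μ) h3 hq
    (x (.chiBar j 0)) (x (.chiBar j 1))
  simp only [← Complex.ofReal_ofNat, ← Complex.ofReal_add, ← Complex.ofReal_sum,
    ← Complex.ofReal_mul]
  refine ⟨_, ?_, rfl⟩
  refine add_nonneg (add_nonneg (add_nonneg (add_nonneg (Complex.normSq_nonneg _)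
    (Complex.normSq_nonneg _)) hF) ?_) (mul_nonneg zero_le_two
      (Finset.sum_nonneg fun j _ => add_nonneg ?_ (hχ' j)))
  · refine mul_nonneg (by positivity) ?_
    have := Complex.normSq_nonneg
    linarith [this (x (.C 0 0) + x (.CStar 1 1)), this (x (.C 1 1) + x (.CStar 0 0)),
      this (x (.C 0 1) + x (.C 1 0) - x (.CStar 0 1) - x (.CStar 1 0))]
  · have h := hχ j
    simp only [Complex.normSq_conj, Complex.conj_re, Complex.conj_im] at h
    linarith

/-- The momentum `(1, 1, 1)` serves as a common witness: no spatial component vanishes and each is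
smaller than the energy, so all diagonal entries of proper components are positive when `m > 0`. -/
lemma waveVec_one (m : ℝ) (μ : Fin 4) (h : μ ≠ 0) : waveVec m !₂[1, 1, 1] μ = -1 := by
  fin_cases μ <;> simp [waveVec] at h ⊢

lemma one_lt_waveVec (m : ℝ) : 1 < waveVec m !₂[1, 1, 1] 0 ^ 2 := by
  rw [waveVec_sq, waveVec_one m 1 (by decide), waveVec_one m 2 (by decide),
    waveVec_one m 3 (by decide)]
  nlinarith [sq_nonneg m]

/-- The diagonal of the form, as a function of the momentum. -/
def diagForm (m : ℝ) (k : EuclideanSpace ℝ (Fin 3)) : Comp → ℝ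
  | .z => 1
  | .zStar => 1
  | .F μ ν => if μ = ν then 0 else
      -(1 / 2) * ((![1, -1, -1, -1] : Fin 4 → ℝ) μ * waveVec m k ν ^ 2 +
        (![1, -1, -1, -1] : Fin 4 → ℝ) ν * waveVec m k μ ^ 2)
  | .C j l => 2 * m ^ 2 * (1 + if j = l then 1 else 0)
  | .CStar j l => 2 * m ^ 2 * (1 + if j = l then 1 else 0)
  | .chi _ a => 2 * (waveVec m k 0 + ![1, -1] a * waveVec m k 3)
  | .chiBar _ a => 2 * (waveVec m k 0 + ![1, -1] a * waveVec m k 3)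

lemma I_mul_eval_table_diag (m : ℝ) (k : EuclideanSpace ℝ (Fin 3)) (I : Comp) :
    Complex.I * eval (shellVec m k) (reducedTable m I.conj I) = diagForm m k I := by
  cases I with
  | z | zStar => simp [Comp.conj, reducedTable, diagForm]
  | F μ ν =>
    rw [Comp.conj, I_mul_eval_table_F, diagForm]
    fin_cases μ <;> fin_cases ν <;> simp [gM, gdiag] <;> ring
  | C j l | CStar j l =>
    simp only [Comp.conj, reducedTable, I_mul_eval_scalar, diagForm]
    fin_cases j <;> fin_cases l <;> simp [kd]
  | chi j a | chiBar j a =>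
    simp only [Comp.conj, reducedTable, I_mul_eval_spinor, diagForm]
    fin_cases a <;> simp [kd, pauli, Fin.sum_univ_four]

/-- A diagonal entry is the value of the non-negative form at a unit vector. -/
lemma diagForm_nonneg {m : ℝ} (hm : 0 < m) (k : EuclideanSpace ℝ (Fin 3)) (I : Comp) :
    0 ≤ diagForm m k I := by
  classical
  obtain ⟨r, hr, h⟩ := shellForm_reducedTable_nonneg hm k (Pi.single I 1)
  have e : shellForm m (reducedTable m) k (Pi.single I 1) = diagForm m k I := by
    rw [shellForm, Finset.sum_eq_single I, Finset.sum_eq_single I, I_mul_eval_table_diag]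
    · simp
    · intro J _ hJ; simp [hJ]
    · simp
    · intro J _ hJ; simp [hJ]
    · simp
  rw [e] at h
  exact (Complex.ofReal_injective h) ▸ hr

lemma diagForm_pos {m : ℝ} (hm : 0 < m) {I : Comp} (hI : I.IsProper) :
    0 < diagForm m !₂[1, 1, 1] I := by
  have h0 := one_lt_waveVec m
  have h1 := waveVec_one m
  have h2 := abs_lt.1 (abs_waveVec_lt hm !₂[1, 1, 1])
  cases I with
  | z | zStar => simp [diagForm]
  | F μ ν =>
    have hI : μ ≠ ν := hI
    rw [diagForm, if_neg hI]
    fin_cases μ <;> fin_cases ν <;> first | exact absurd rfl hI | skip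
    all_goals
      simp [h1]
      try linarith
  | C j l | CStar j l => rw [diagForm]; positivity
  | chi j a | chiBar j a =>
    rw [diagForm]
    fin_cases a <;> simp <;> linarith

lemma positivityCondition_reducedTable {m : ℝ} (hm : 0 ≤ m) :
    PositivityCondition m (reducedTable m) ↔ 0 < m := by
  refine ⟨fun h => hm.lt_of_ne fun h0 => ?_, fun h => ⟨oneParticleNormSq_nonneg
    (shellForm_reducedTable_nonneg h), fun I hI => exists_plusKernel_pos
      (fun k => diagForm_nonneg h k I) (k₀ := !₂[1, 1, 1]) ?_ (diagForm_pos h hI)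
      fun k => I_mul_eval_table_diag m k I⟩⟩
  -- At `m = 0` the diagonal symbol `4m²` of this component vanishes, so it creates no state of
  -- positive norm.
  · obtain ⟨f, hf⟩ := h.2 (.C 0 0) trivial
    rw [plusKernel_conjTest] at hf
    simp [I_mul_eval_table_diag, diagForm, ← h0] at hf
  · intro h
    have := congrArg (fun v : EuclideanSpace ℝ (Fin 3) => v 0) h
    simp at this

lemma PositivityCondition.congr {m : ℝ} {T T' : Comp → Comp → MvPolynomial (Fin 4) ℂ}
    (h : ∀ I J f g, plusKernel m (T I J) f g = plusKernel m (T' I J) f g) :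
    PositivityCondition m T ↔ PositivityCondition m T' := by
  simp only [PositivityCondition, oneParticleNormSq, h]

/-- The commutators determine the two-point functions. -/
lemma plusKernel_eq_of_hasCommutators {𝒜 : Type*} [Ring 𝒜] [Nontrivial 𝒜] [StarRing 𝒜]
    [Algebra ℂ 𝒜] [StarModule ℂ 𝒜] {m : ℝ} {Φ : FieldContent 𝒜}
    {T T' : Comp → Comp → MvPolynomial (Fin 4) ℂ} (h : Φ.HasCommutators m T)
    (h' : Φ.HasCommutators m T') (I J : Comp) (f g : Test) :
    plusKernel m (T I J) f g = plusKernel m (T' I J) f g := by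
  -- The difference of the two polynomials has vanishing causal kernel, hence vanishes on both
  -- sheets; the two-point function uses only the upper one.
  have h0 : ∀ f g, causalKernel m (T I J + C (-1) * T' I J) f g = 0 := fun f g => by
    have e : causalKernel m (T I J) f g = causalKernel m (T' I J) f g :=
      (algebraMap ℂ 𝒜).injective ((h I J f g).symm.trans (h' I J f g))
    rw [causalKernel_add, causalKernel_C_mul, e]
    ring
  refine plusKernel_congr (fun k hk => ?_) f g
  have := eval_eq_zero_of_causalKernel h0 (shellVec m k) ⟨k, hk, .inl rfl⟩
  rw [map_add, map_mul, eval_C] at this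
  linear_combination this

end SUSY
end

theorem mainTheorem5 (m : ℝ) (hm : 0 ≤ m) :
    (∀ (𝒜 : Type*) [Ring 𝒜] [Nontrivial 𝒜] [StarRing 𝒜] [Algebra ℂ 𝒜] [StarModule ℂ 𝒜]
      (M : SUSY.ReducedMultiplet m 𝒜),
      -- the causal (anti)commutators are the listed ones
      M.toFieldContent.HasCommutators m (SUSY.reducedTable m) ∧
      -- they are those of the unreduced multiplet exactly for the parameter `α = 2 m ^ 2`
      (∀ α : ℂ, M.toFieldContent.HasFullCommutators m α ↔ α = 2 * (m : ℂ) ^ 2) ∧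
      (∀ j k, M.toFieldContent.scriptD j k = 0) ∧
      (∀ j k, M.toFieldContent.scriptC j k = M.C j k) ∧
      -- positivity of the two-point functions, however the commutators are written
      (∀ T : SUSY.Comp → SUSY.Comp → MvPolynomial (Fin 4) ℂ,
        M.toFieldContent.HasCommutators m T → (SUSY.PositivityCondition m T ↔ 0 < m))) ∧
    -- positivity of the two-point functions given by the list
    (SUSY.PositivityCondition m (SUSY.reducedTable m) ↔ 0 < m) := by
  refine ⟨fun 𝒜 _ _ _ _ _ M => ⟨M.hasCommutators, M.hasFullCommutators_iff, M.scriptD_eq_zero,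
    M.scriptC_eq, fun T hT => ?_⟩, SUSY.positivityCondition_reducedTable hm⟩
  exact (SUSY.PositivityCondition.congr (SUSY.plusKernel_eq_of_hasCommutators hT
    M.hasCommutators)).trans (SUSY.positivityCondition_reducedTable hm)
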